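/- **Setting.** Let $\mathcal N$ be a finite ground set with $n=|\mathcal N|\ge 2$ elements. For an integer $p\ge 1$, a $p$-matchoid on $\mathcal N$ is given by finitely many matroids $M_i=(\mathcal N_i,\mathcal I_i)$, $i=1,\dots,m$, with $\mathcal N_i\subseteq\mathcal N$, such that every element of $\mathcal N$ lies in at most $p$ of the sets $\mathcal N_i$; its independent sets are $\mathcal I=\{S\subseteq\mathcal N : S\cap\mathcal N_i\in\mathcal I_i\text{ for all }i\}$. Let $f:2^{\mathcal N}\to\mathbb R_{\ge 0}$ be a nonnegative submodular function ($f(S)+f(T)\ge f(S\cup T)+f(S\cap T)$ for all $S,T\subseteq\mathcal N$) that is normalized ($f(\emptyset)=0$), and put $\mathrm{OPT}=\max_{I\in\mathcal I}f(I)$. A randomized algorithm knows $p$, $\varepsilon$, $\mathcal N$ and the sets $\mathcal N_i$, and accesses $f$ only through a value oracle (returning $f(S)$ for a queried set $S$) and the matroids only through their rank oracles (returning the rank in $M_i$ of a queried set). Oracle queries are made in adaptive rounds: a round consists of finitely many simultaneous queries, which depend only on the algorithm's random choices and on the answers of strictly earlier rounds. Internal computation is not charged. **Theorem.** There are a constant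 $C>0$, an exponent $d\in\mathbb N$, and a sequence $\eta(p)$ with $\eta(p)\to 0$ as $p\to\infty$, namely $\frac{1+\eta(p)}{4(p+1)}=2p+1-2\sqrt{p(p+1)}$ for $p\ge1$, such that for all $\varepsilon\in(0,1)$ and every $p$-matchoid and $f$ as above, the following hold. 1. There is a randomized algorithm that always outputs a set $I\in\mathcal I$, with $$\mathbb E[f(I)]\ \ge\ (1-\varepsilon)\,\frac{1+\eta(p)}{4(p+1)}\,\mathrm{OPT},$$ using at most $C\log^2 n/\varepsilon^2$ adaptive rounds in expectation. 2. For some integer $1\le\ell\le C/\varepsilon$ there is a randomized algorithm that always outputs $\ell$ independent sets $I_1,\dots,I_\ell\in\mathcal I$, using at most $C\log^2 n/\varepsilon^3$ adaptive rounds in expectation, such that if, given $I_1,\dots,I_\ell$, each $J_k$ contains every element of $I_k$ independently with probability $1/\ell$ (independently over $k$), then $$\mathbb E[f(J_1\cup\dots\cup J_\ell)]\ \ge\ \frac{1-\varepsilon}{p}\,e^{-1/p}\,\mathrm{OPT}.$$ In both parts the expected total number of oracle queries is at most $C\,(n+m+1/\varepsilon)^d$. The algorithms depend only on $\mathcal N$,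 $(\mathcal N_i)_i$, $p$ and $\varepsilon$, not on $f$ or the families $\mathcal I_i$; the constants $C$ and $d$ depend on nothing. -/

import Mathlib

open Filter Topology
open scoped BigOperators ENNReal

noncomputable section

/-! ### Submodular functions and matchoids

The ground set is `Fin n`; a matchoid is given by underlying matroids `M i` (`i : Fin m`), the
`i`-th one on the ground set `(M i).E`, a subset of `Fin n`. -/

/-- Submodularity of a real-valued set function. -/
def IsSubmodular {n : ℕ} (f : Finset (Fin n) → ℝ) : Prop :=
  ∀ S T : Finset (Fin n), f (S ∪ T) + f (S ∩ T) ≤ f S + f T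

/-- `S` is independent in the matchoid with underlying matroids `M i`: for each `i`, the part of
`S` in the ground set of `M i` is independent in `M i`. -/
def MatchoidIndep {n m : ℕ} (M : Fin m → Matroid (Fin n)) (S : Finset (Fin n)) : Prop :=
  ∀ i : Fin m, (M i).Indep ((S : Set (Fin n)) ∩ (M i).E)

/-- The condition on the ground sets `N i` of the underlying matroids that makes a matchoid a
`p`-matchoid: every element lies in at most `p` of them. -/
def InAtMost {n m : ℕ} (p : ℕ) (N : Fin m → Finset (Fin n)) : Prop :=
  ∀ e : Fin n, (Finset.univ.filter fun i : Fin m => e ∈ N i).card ≤ p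

/-- The maximum value of `f` on an independent set of the matchoid. -/
def matchoidOpt {n m : ℕ} (M : Fin m → Matroid (Fin n)) (f : Finset (Fin n) → ℝ) : ℝ :=
  sSup (f '' {I | MatchoidIndep M I})

/-- The supremum in `matchoidOpt` is a maximum over a nonempty finite set. -/
theorem matchoidOpt_isGreatest {n m : ℕ} (M : Fin m → Matroid (Fin n))
    (f : Finset (Fin n) → ℝ) :
    IsGreatest (f '' {I | MatchoidIndep M I}) (matchoidOpt M f) := by
  have hfin : (f '' {I | MatchoidIndep M I}).Finite := (Set.toFinite _).image f
  have hne : (f '' {I | MatchoidIndep M I}).Nonempty :=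
    ⟨f ∅, ∅, fun i => by simp, rfl⟩
  exact ⟨hne.csSup_mem hfin, fun x hx => le_csSup hfin.bddAbove hx⟩

/-! ### Adaptive randomized algorithms with oracle access -/

/-- A randomized algorithm with real-valued oracle access, queries in `Q` and outputs in `α`.
It may stop with an output, draw a random number from a distribution of its choice, or make one
adaptive round: submit a finite set of queries simultaneously and continue with their answers.
What it does next depends only on earlier random draws and on the answers to earlier rounds.
(Internal computation is not charged.) -/
inductive AdaptiveAlg (Q α : Type) : Type
  | output (a : α) : AdaptiveAlg Q α
  | draw (μ : PMF ℕ) (next : ℕ → AdaptiveAlg Q α) : AdaptiveAlg Q α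
  | round (qs : Finset Q) (next : (qs → ℝ) → AdaptiveAlg Q α) : AdaptiveAlg Q α

/-- What a run produces: the output, the number of adaptive rounds, and the total number of
oracle queries. -/
structure Outcome (α : Type) : Type where
  result : α
  rounds : ℕ
  queries : ℕ

/-- The distribution of the outcome of the algorithm when the oracle is `O`. -/
def AdaptiveAlg.run {Q α : Type} (O : Q → ℝ) : AdaptiveAlg Q α → PMF (Outcome α)
  | .output a => PMF.pure ⟨a, 0, 0⟩
  | .draw μ next => μ.bind fun k => (next k).run O
  | .round qs next =>
      ((next fun q => O q.1).run O).map fun x => ⟨x.result, x.rounds + 1, x.queries + qs.card⟩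

/-- The expectation of `v` at the output of a run. -/
def expectedValue {α : Type} [Fintype α] (P : PMF (Outcome α)) (v : α → ℝ) : ℝ :=
  ∑ a : α, ((P.map Outcome.result) a).toReal * v a

/-- The expected number of adaptive rounds. -/
def expectedRounds {α : Type} (P : PMF (Outcome α)) : ℝ≥0∞ :=
  ∑' x : Outcome α, P x * (x.rounds : ℝ≥0∞)

/-- The expected total number of oracle queries. -/
def expectedQueries {α : Type} (P : PMF (Outcome α)) : ℝ≥0∞ :=
  ∑' x : Outcome α, P x * (x.queries : ℝ≥0∞)

/-- The oracle queries: `Sum.inl S` asks for the value of `f` at `S`, and `Sum.inr (i, S)` asks for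
the rank of (the part in the ground set of) `S` in the `i`-th underlying matroid. -/
abbrev MatchoidQuery (n m : ℕ) : Type := Finset (Fin n) ⊕ (Fin m × Finset (Fin n))

/-- The value oracle of `f` together with the rank oracles of the underlying matroids. -/
def matchoidOracle {n m : ℕ} (M : Fin m → Matroid (Fin n)) (f : Finset (Fin n) → ℝ) :
    MatchoidQuery n m → ℝ
  | .inl S => f S
  | .inr (i, S) => (((M i).eRk (S : Set (Fin n))).toNat : ℝ)

/-! ### Random subsampling -/

/-- The probability that the random subset of `I`, containing each element of `I` independently
with probability `q`, equals `J`. -/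
def subsampleProb {n : ℕ} (q : ℝ) (I J : Finset (Fin n)) : ℝ :=
  if J ⊆ I then q ^ J.card * (1 - q) ^ (I.card - J.card) else 0

/-- The expected value of `f (J 1 ∪ ⋯ ∪ J ℓ)`, where the `J k` are independent and `J k` contains
each element of `I k` independently with probability `1 / ℓ`. -/
def subsampledUnionValue {n ℓ : ℕ} (f : Finset (Fin n) → ℝ) (I : Fin ℓ → Finset (Fin n)) : ℝ :=
  ∑ J : Fin ℓ → Finset (Fin n),
    (∏ k, subsampleProb (1 / (ℓ : ℝ)) (I k) (J k)) * f (Finset.univ.biUnion J)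

end

noncomputable section

namespace AdaptiveAlg

variable {Q α β : Type}

/-- Sequential composition of algorithms. -/
def bind : AdaptiveAlg Q α → (α → AdaptiveAlg Q β) → AdaptiveAlg Q β
  | .output a, k => k a
  | .draw μ next, k => .draw μ fun i => (next i).bind k
  | .round qs next, k => .round qs fun a => (next a).bind k

/-- The expectation of `g` at the output. -/
def ev (O : Q → ℝ) (g : α → ℝ) : AdaptiveAlg Q α → ℝ
  | .output a => g a
  | .draw μ next => ∑' k, (μ k).toReal * (next k).ev O g
  | .round _ next => (next fun q => O q.1).ev O g

/-- All draws have finite support, and all possible outputs satisfy `r`. -/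
def Ensures (O : Q → ℝ) (r : α → Prop) : AdaptiveAlg Q α → Prop
  | .output a => r a
  | .draw μ next => μ.support.Finite ∧ ∀ k ∈ μ.support, (next k).Ensures O r
  | .round _ next => (next fun q => O q.1).Ensures O r

/-- Whatever the answers, there are at most `R` rounds and `K` queries, and the output
satisfies `r`. -/
def Within (r : α → Prop) : AdaptiveAlg Q α → ℕ → ℕ → Prop
  | .output a, _, _ => r a
  | .draw _ next, R, K => ∀ k, (next k).Within r R K
  | .round qs next, R, K => 1 ≤ R ∧ qs.card ≤ K ∧ ∀ a, (next a).Within r (R - 1) (K - qs.card)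

theorem ev_bind (O : Q → ℝ) (g : β → ℝ) (A : AdaptiveAlg Q α) (k : α → AdaptiveAlg Q β) :
    (A.bind k).ev O g = A.ev O fun a => (k a).ev O g := by
  induction A with
  | output a => rfl
  | draw μ next ih => simp only [bind, ev, ih]
  | round qs next ih => simp only [bind, ev, ih]

theorem Ensures.bind {O : Q → ℝ} {r : α → Prop} {s : β → Prop} {A : AdaptiveAlg Q α}
    {k : α → AdaptiveAlg Q β} (hA : A.Ensures O r) (hk : ∀ a, r a → (k a).Ensures O s) :
    (A.bind k).Ensures O s := by
  induction A with
  | output a => exact hk a hA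
  | draw μ next ih => exact ⟨hA.1, fun i hi => ih i (hA.2 i hi)⟩
  | round qs next ih => exact ih _ hA

theorem Ensures.mono {O : Q → ℝ} {r s : α → Prop} {A : AdaptiveAlg Q α}
    (hA : A.Ensures O r) (h : ∀ a, r a → s a) : A.Ensures O s := by
  induction A with
  | output a => exact h a hA
  | draw μ next ih => exact ⟨hA.1, fun i hi => ih i (hA.2 i hi)⟩
  | round qs next ih => exact ih _ hA

theorem Within.mono {r s : α → Prop} {A : AdaptiveAlg Q α} {R K R' K' : ℕ}
    (hA : A.Within r R K) (h : ∀ a, r a → s a) (hR : R ≤ R') (hK : K ≤ K') :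
    A.Within s R' K' := by
  induction A generalizing R K R' K' with
  | output a => exact h a hA
  | draw μ next ih => exact fun k => ih k (hA k) hR hK
  | round qs next ih =>
    exact ⟨hA.1.trans hR, hA.2.1.trans hK, fun a => ih a (hA.2.2 a) (by omega) (by omega)⟩

theorem Within.bind {r : α → Prop} {s : β → Prop} {A : AdaptiveAlg Q α}
    {k : α → AdaptiveAlg Q β} {R K R' K' : ℕ} (hA : A.Within r R K)
    (hk : ∀ a, r a → (k a).Within s R' K') : (A.bind k).Within s (R + R') (K + K') := by
  induction A generalizing R K with
  | output a => exact (hk a hA).mono (fun _ h => h) (by omega) (by omega)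
  | draw μ next ih => exact fun k => ih k (hA k)
  | round qs next ih =>
    obtain ⟨h1, h2, h3⟩ := hA
    refine ⟨by omega, by omega, fun a => (ih a (h3 a)).mono (fun _ h => h) (by omega) (by omega)⟩

theorem summable_toReal_mul (μ : PMF ℕ) (h : μ.support.Finite) (g : ℕ → ℝ) :
    Summable fun k => (μ k).toReal * g k := by
  refine summable_of_hasFiniteSupport (h.subset fun k hk => ?_)
  rw [PMF.mem_support_iff]
  intro h0
  simp [h0] at hk

theorem ev_mono {O : Q → ℝ} {r : α → Prop} {A : AdaptiveAlg Q α} {g g' : α → ℝ}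
    (hA : A.Ensures O r) (h : ∀ a, r a → g a ≤ g' a) : A.ev O g ≤ A.ev O g' := by
  induction A with
  | output a => exact h a hA
  | draw μ next ih =>
    refine Summable.tsum_le_tsum (fun k => ?_) (summable_toReal_mul μ hA.1 _)
      (summable_toReal_mul μ hA.1 _)
    by_cases hk : k ∈ μ.support
    · exact mul_le_mul_of_nonneg_left (ih k (hA.2 k hk)) ENNReal.toReal_nonneg
    · rw [PMF.mem_support_iff, not_not] at hk
      simp [hk]
  | round qs next ih => exact ih _ hA

theorem ev_add {O : Q → ℝ} {r : α → Prop} {A : AdaptiveAlg Q α} (g g' : α → ℝ)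
    (hA : A.Ensures O r) : A.ev O (fun a => g a + g' a) = A.ev O g + A.ev O g' := by
  induction A with
  | output a => rfl
  | draw μ next ih =>
    simp only [ev]
    rw [← Summable.tsum_add (summable_toReal_mul μ hA.1 _)
      (summable_toReal_mul μ hA.1 _)]
    refine tsum_congr fun k => ?_
    by_cases hk : k ∈ μ.support
    · rw [ih k (hA.2 k hk), mul_add]
    · rw [PMF.mem_support_iff, not_not] at hk
      simp [hk]
  | round qs next ih => exact ih _ hA

theorem ev_mul (O : Q → ℝ) (A : AdaptiveAlg Q α) (c : ℝ) (g : α → ℝ) :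
    A.ev O (fun a => c * g a) = c * A.ev O g := by
  induction A with
  | output a => rfl
  | draw μ next ih =>
    simp only [ev, ih]
    rw [← tsum_mul_left]
    exact tsum_congr fun k => by ring
  | round qs next ih => exact ih _

theorem tsum_toReal (μ : PMF ℕ) : ∑' k, (μ k).toReal = 1 := by
  rw [← ENNReal.tsum_toReal_eq (fun k => PMF.apply_ne_top μ k), PMF.tsum_coe]; rfl

theorem ev_const (O : Q → ℝ) (A : AdaptiveAlg Q α) (c : ℝ) :
    A.ev O (fun _ => c) = c := by
  induction A with
  | output a => rfl
  | draw μ next ih =>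
    simp only [ev, ih]
    rw [tsum_mul_right, tsum_toReal, one_mul]
  | round qs next ih => exact ih _

/-! #### Comparison with the distribution of the outcome -/

theorem Ensures.support {O : Q → ℝ} {r : α → Prop} {A : AdaptiveAlg Q α} (hA : A.Ensures O r) :
    ∀ x ∈ (A.run O).support, r x.result := by
  induction A with
  | output a =>
    intro x hx
    simp only [run, PMF.support_pure, Set.mem_singleton_iff] at hx
    subst hx; exact hA
  | draw μ next ih =>
    intro x hx
    simp only [run, PMF.mem_support_bind_iff] at hx
    obtain ⟨k, hk, hx⟩ := hx
    exact ih k (hA.2 k hk) x hx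
  | round qs next ih =>
    intro x hx
    simp only [run, PMF.mem_support_map_iff] at hx
    obtain ⟨y, hy, rfl⟩ := hx
    exact ih _ hA y hy

theorem Within.support {r : α → Prop} {A : AdaptiveAlg Q α} {R K : ℕ} (hA : A.Within r R K)
    (O : Q → ℝ) : ∀ x ∈ (A.run O).support, x.rounds ≤ R ∧ x.queries ≤ K := by
  induction A generalizing R K with
  | output a =>
    intro x hx
    simp only [run, PMF.support_pure, Set.mem_singleton_iff] at hx
    subst hx; simp
  | draw μ next ih =>
    intro x hx
    simp only [run, PMF.mem_support_bind_iff] at hx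
    obtain ⟨k, -, hx⟩ := hx
    exact ih k (hA k) x hx
  | round qs next ih =>
    intro x hx
    simp only [run, PMF.mem_support_map_iff] at hx
    obtain ⟨y, hy, rfl⟩ := hx
    have := ih _ (hA.2.2 _) y hy
    obtain ⟨h1, h2, -⟩ := hA
    constructor <;> dsimp only <;> omega

theorem tsum_le_of_support {P : PMF (Outcome α)} {c : Outcome α → ℕ} {R : ℕ}
    (h : ∀ x ∈ P.support, c x ≤ R) : ∑' x, P x * (c x : ℝ≥0∞) ≤ R := by
  calc ∑' x, P x * (c x : ℝ≥0∞) ≤ ∑' x, P x * (R : ℝ≥0∞) := by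
        refine ENNReal.tsum_le_tsum fun x => ?_
        by_cases hx : x ∈ P.support
        · gcongr; exact_mod_cast h x hx
        · rw [PMF.mem_support_iff, not_not] at hx
          simp [hx]
    _ = R := by rw [ENNReal.tsum_mul_right, PMF.tsum_coe, one_mul]

theorem Within.expectedRounds_le {r : α → Prop} {A : AdaptiveAlg Q α} {R K : ℕ}
    (hA : A.Within r R K) (O : Q → ℝ) : expectedRounds (A.run O) ≤ R :=
  tsum_le_of_support fun x hx => (hA.support O x hx).1

theorem Within.expectedQueries_le {r : α → Prop} {A : AdaptiveAlg Q α} {R K : ℕ}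
    (hA : A.Within r R K) (O : Q → ℝ) : expectedQueries (A.run O) ≤ K :=
  tsum_le_of_support fun x hx => (hA.support O x hx).2

theorem expectedValue_run [Fintype α] (O : Q → ℝ) (A : AdaptiveAlg Q α) (v : α → ℝ) :
    expectedValue (A.run O) v = A.ev O v := by
  induction A with
  | output a =>
    classical
    simp [expectedValue, run, ev, PMF.pure_map, PMF.pure_apply, apply_ite ENNReal.toReal]
  | draw μ next ih =>
    simp only [ev, ← ih, expectedValue, run, Finset.mul_sum, PMF.map_bind, PMF.bind_apply]
    have hs : ∀ a : α, Summable fun k =>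
        (μ k).toReal * ((((next k).run O).map Outcome.result) a).toReal := by
      intro a
      have h1 : Summable fun k => (μ k).toReal :=
        ENNReal.summable_toReal (by rw [PMF.tsum_coe]; exact ENNReal.one_ne_top)
      refine Summable.of_nonneg_of_le (fun k => by positivity) (fun k => ?_) h1
      refine mul_le_of_le_one_right ENNReal.toReal_nonneg ?_
      exact ENNReal.toReal_mono ENNReal.one_ne_top (PMF.coe_le_one _ _)
    have hs' : ∀ a : α, Summable fun k =>
        (μ k).toReal * (((((next k).run O).map Outcome.result) a).toReal * v a) := by
      intro a
      simpa only [mul_assoc] using (hs a).mul_right (v a)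
    rw [Summable.tsum_finsetSum fun a _ => hs' a]
    refine Finset.sum_congr rfl fun a _ => ?_
    rw [ENNReal.tsum_toReal_eq, ← tsum_mul_right]
    · exact tsum_congr fun k => by rw [ENNReal.toReal_mul, mul_assoc]
    · exact fun k => ENNReal.mul_ne_top (PMF.apply_ne_top _ _) (PMF.apply_ne_top _ _)
  | round qs next ih =>
    simp only [ev, ← ih, expectedValue, run, PMF.map_comp]
    rfl

/-! #### Asking queries -/

open Classical in
/-- One round, which asks `qs` and returns a function of the answers. -/
def ask (qs : Finset Q) (F : (Q → ℝ) → α) : AdaptiveAlg Q α :=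
  .round qs fun a => .output (F fun q => if h : q ∈ qs then a ⟨q, h⟩ else 0)

/-- `F` depends only on the answers to the queries in `qs`. -/
def LocalOn (qs : Finset Q) (F : (Q → ℝ) → α) : Prop :=
  ∀ O O' : Q → ℝ, (∀ q ∈ qs, O q = O' q) → F O = F O'

theorem LocalOn.ask_eq {qs : Finset Q} {F : (Q → ℝ) → α} (h : LocalOn qs F) (O : Q → ℝ) :
    (open Classical in F fun q => if _ : q ∈ qs then O q else 0) = F O :=
  h _ _ fun q hq => by simp [hq]

theorem ev_ask {qs : Finset Q} {F : (Q → ℝ) → α} (h : LocalOn qs F) (O : Q → ℝ) (g : α → ℝ) :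
    (ask qs F).ev O g = g (F O) := congrArg g (h.ask_eq O)

theorem ensures_ask {qs : Finset Q} {F : (Q → ℝ) → α} (h : LocalOn qs F) {O : Q → ℝ}
    {r : α → Prop} (hr : r (F O)) : (ask qs F).Ensures O r := by
  rw [← h.ask_eq O] at hr
  exact hr

theorem within_ask (qs : Finset Q) (F : (Q → ℝ) → α) {K : ℕ} (hK : qs.card ≤ K) :
    (ask qs F).Within (fun _ => True) 1 K := ⟨le_rfl, hK, fun _ => trivial⟩

end AdaptiveAlg

/-- A probability distribution on a finite type. -/
structure FinDist (Ω : Type) [Fintype Ω] where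
  w : Ω → ℝ
  nonneg : ∀ a, 0 ≤ w a
  sum_one : ∑ a, w a = 1

namespace FinDist

variable {Ω Q α : Type} [Fintype Ω]

theorem nonempty (d : FinDist Ω) : Nonempty Ω := by
  by_contra h
  rw [not_nonempty_iff] at h
  simpa using d.sum_one

/-- The expectation of `g`. -/
def ex (d : FinDist Ω) (g : Ω → ℝ) : ℝ := ∑ a, d.w a * g a

theorem ex_mono (d : FinDist Ω) {g g' : Ω → ℝ} (h : ∀ a, g a ≤ g' a) : d.ex g ≤ d.ex g' :=
  Finset.sum_le_sum fun a _ => mul_le_mul_of_nonneg_left (h a) (d.nonneg a)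

theorem ex_add (d : FinDist Ω) (g g' : Ω → ℝ) :
    d.ex (fun a => g a + g' a) = d.ex g + d.ex g' := by
  simp [ex, mul_add, Finset.sum_add_distrib]

theorem ex_sub (d : FinDist Ω) (g g' : Ω → ℝ) :
    d.ex (fun a => g a - g' a) = d.ex g - d.ex g' := by
  simp [ex, mul_sub, Finset.sum_sub_distrib]

theorem ex_mul (d : FinDist Ω) (c : ℝ) (g : Ω → ℝ) : d.ex (fun a => c * g a) = c * d.ex g := by
  simp only [ex, Finset.mul_sum]
  exact Finset.sum_congr rfl fun a _ => by ring

theorem ex_const (d : FinDist Ω) (c : ℝ) : d.ex (fun _ => c) = c := by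
  simp [ex, ← Finset.sum_mul, d.sum_one]

theorem ex_sum (d : FinDist Ω) {ι : Type*} (s : Finset ι) (g : ι → Ω → ℝ) :
    d.ex (fun a => ∑ i ∈ s, g i a) = ∑ i ∈ s, d.ex (g i) := by
  simp only [ex, Finset.mul_sum]
  exact Finset.sum_comm

theorem ex_nonneg (d : FinDist Ω) {g : Ω → ℝ} (h : ∀ a, 0 ≤ g a) : 0 ≤ d.ex g :=
  Finset.sum_nonneg fun a _ => mul_nonneg (d.nonneg a) (h a)

/-- The distribution as a `PMF`. -/
def toPMF (d : FinDist Ω) : PMF Ω :=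
  PMF.ofFintype (fun a => ENNReal.ofReal (d.w a)) (by
    rw [← ENNReal.ofReal_sum_of_nonneg fun a _ => d.nonneg a, d.sum_one, ENNReal.ofReal_one])

/-- A numbering of a finite type. -/
def code (a : Ω) : ℕ := (Fintype.equivFin Ω a).1

theorem code_injective : Function.Injective (code : Ω → ℕ) := fun _ _ h =>
  (Fintype.equivFin Ω).injective (Fin.ext h)

open Classical in
/-- Draw from a finite distribution. -/
def draw (d : FinDist Ω) (next : Ω → AdaptiveAlg Q α) : AdaptiveAlg Q α :=
  haveI := d.nonempty
  .draw (d.toPMF.map code) fun k => next (Function.invFun code k)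

theorem map_code (d : FinDist Ω) (a : Ω) :
    ((d.toPMF.map code) (code a)).toReal = d.w a := by
  classical
  rw [PMF.map_apply, tsum_eq_single a]
  · simp [toPMF, PMF.ofFintype_apply, ENNReal.toReal_ofReal (d.nonneg a)]
  · intro b hb
    rw [if_neg fun h => hb (code_injective h).symm]

theorem map_code_support (d : FinDist Ω) :
    (d.toPMF.map code).support ⊆ ((Finset.univ.image (code : Ω → ℕ) : Finset ℕ) : Set ℕ) := by
  classical
  intro k hk
  rw [PMF.mem_support_map_iff] at hk
  obtain ⟨a, -, rfl⟩ := hk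
  simp

theorem ev_draw (d : FinDist Ω) (next : Ω → AdaptiveAlg Q α) (O : Q → ℝ) (g : α → ℝ) :
    (d.draw next).ev O g = d.ex fun a => (next a).ev O g := by
  classical
  have := d.nonempty
  simp only [draw, AdaptiveAlg.ev, ex]
  rw [tsum_eq_sum (s := Finset.univ.image (code : Ω → ℕ))]
  · rw [Finset.sum_image fun _ _ _ _ h => code_injective h]
    exact Finset.sum_congr rfl fun a _ => by
      rw [map_code, Function.leftInverse_invFun code_injective a]
  · intro k hk
    have : (d.toPMF.map code) k = 0 := by
      by_contra h
      exact hk (d.map_code_support ((PMF.mem_support_iff _ _).2 h))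
    simp [this]

theorem ensures_draw (d : FinDist Ω) {next : Ω → AdaptiveAlg Q α} {O : Q → ℝ} {r : α → Prop}
    (h : ∀ a, 0 < d.w a → (next a).Ensures O r) : (d.draw next).Ensures O r := by
  classical
  have := d.nonempty
  refine ⟨(Finset.finite_toSet _).subset d.map_code_support, fun k hk => ?_⟩
  rw [PMF.mem_support_map_iff] at hk
  obtain ⟨a, ha, rfl⟩ := hk
  beta_reduce
  rw [Function.leftInverse_invFun code_injective a]
  refine h a ?_
  simpa [toPMF, PMF.mem_support_iff, PMF.ofFintype_apply] using ha

theorem within_draw (d : FinDist Ω) {next : Ω → AdaptiveAlg Q α} {r : α → Prop} {R K : ℕ}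
    (h : ∀ a, (next a).Within r R K) : (d.draw next).Within r R K := fun _ => h _

end FinDist
end

noncomputable section

namespace FinDist

variable {Ω : Type} [Fintype Ω]

/-- The distribution of independent samples. -/
def pi (d : FinDist Ω) (κ : Type) [Fintype κ] [DecidableEq κ] : FinDist (κ → Ω) where
  w x := ∏ i, d.w (x i)
  nonneg x := Finset.prod_nonneg fun i _ => d.nonneg _
  sum_one := by
    have := Finset.prod_univ_sum (fun _ : κ => (Finset.univ : Finset Ω)) (fun _ a => d.w a)
    rw [Fintype.piFinset_univ] at this
    rw [← this]
    simp [d.sum_one]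

variable {κ : Type} [Fintype κ] [DecidableEq κ]

theorem ex_pi_prod (d : FinDist Ω) (g : κ → Ω → ℝ) :
    (d.pi κ).ex (fun x => ∏ i, g i (x i)) = ∏ i, d.ex (g i) := by
  have := Finset.prod_univ_sum (fun _ : κ => (Finset.univ : Finset Ω))
    (fun i a => d.w a * g i a)
  rw [Fintype.piFinset_univ] at this
  simp only [ex, this, pi, Finset.prod_mul_distrib]

theorem ex_pi_update (d : FinDist Ω) (i : κ) (g : (κ → Ω) → ℝ) :
    (d.pi κ).ex (fun x => d.ex fun a => g (Function.update x i a)) = (d.pi κ).ex g := by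
  have key : ∀ G : (κ → Ω) → ℝ, (d.pi κ).ex G = ∑ y : {j // j ≠ i} → Ω, (∏ j, d.w (y j)) *
      ∑ b, d.w b * G ((Equiv.funSplitAt i Ω).symm (b, y)) := by
    intro G
    rw [ex, ← (Equiv.funSplitAt i Ω).symm.sum_comp, Fintype.sum_prod_type, Finset.sum_comm]
    refine Finset.sum_congr rfl fun y _ => ?_
    rw [Finset.mul_sum]
    refine Finset.sum_congr rfl fun b _ => ?_
    have h1 : (d.pi κ).w ((Equiv.funSplitAt i Ω).symm (b, y)) = d.w b * ∏ j, d.w (y j) := by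
      simp only [pi]
      rw [Fintype.prod_eq_mul_prod_subtype_ne _ i]
      congr 1
      · simp
      · refine Finset.prod_congr rfl fun j _ => ?_
        simp [j.2]
    rw [h1]; ring
  rw [key, key]
  refine Finset.sum_congr rfl fun y _ => ?_
  congr 1
  have h2 : ∀ b, (d.ex fun a => g (Function.update ((Equiv.funSplitAt i Ω).symm (b, y)) i a)) =
      ∑ a, d.w a * g ((Equiv.funSplitAt i Ω).symm (a, y)) := by
    intro b
    refine Finset.sum_congr rfl fun a _ => ?_
    beta_reduce
    congr 2
    funext j
    by_cases hj : j = i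
    · subst hj; simp
    · simp [hj]
  simp only [h2]
  rw [← Finset.sum_mul, d.sum_one, one_mul]

/-- A biased coin. -/
def coin (q : ℝ) (h0 : 0 ≤ q) (h1 : q ≤ 1) : FinDist Bool where
  w b := if b then q else 1 - q
  nonneg b := by cases b <;> simp [h0, h1]
  sum_one := by simp

theorem ex_coin (q : ℝ) (h0 : 0 ≤ q) (h1 : q ≤ 1) (g : Bool → ℝ) :
    (coin q h0 h1).ex g = q * g true + (1 - q) * g false := by
  simp [ex, coin]

/-- The uniform distribution on a nonempty finite set. -/
def uniform [DecidableEq Ω] (Y : Finset Ω) (h : Y.Nonempty) : FinDist Ω where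
  w a := if a ∈ Y then (Y.card : ℝ)⁻¹ else 0
  nonneg a := by split_ifs <;> positivity
  sum_one := by
    have : (Y.card : ℝ) ≠ 0 := by exact_mod_cast h.card_pos.ne'
    simp [this]

theorem ex_uniform [DecidableEq Ω] (Y : Finset Ω) (h : Y.Nonempty) (g : Ω → ℝ) :
    (uniform Y h).ex g = (∑ a ∈ Y, g a) / Y.card := by
  simp [ex, uniform, Finset.sum_ite_mem, ← Finset.mul_sum, div_eq_inv_mul]

end FinDist

/-- The part of `I k` selected by `x`, for `k = 1, …, ℓ`. -/
def thin {n ℓ : ℕ} (x : Fin ℓ × Fin n → Bool) (I : Fin ℓ → Finset (Fin n)) (k : Fin ℓ) :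
    Finset (Fin n) :=
  (I k).filter fun e => x (k, e) = true

theorem sum_coin_match (δ : ℝ) (h0 : 0 ≤ δ) (h1 : δ ≤ 1) {n : ℕ} (I J : Finset (Fin n)) :
    ∏ e, (FinDist.coin δ h0 h1).ex
      (fun b => if (e ∈ I ∧ b = true ↔ e ∈ J) then 1 else 0) = subsampleProb δ I J := by
  have hv : ∀ e, (FinDist.coin δ h0 h1).ex
      (fun b => if (e ∈ I ∧ b = true ↔ e ∈ J) then (1 : ℝ) else 0) =
      if e ∈ I then (if e ∈ J then δ else 1 - δ) else (if e ∈ J then 0 else 1) := by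
    intro e
    rw [FinDist.ex_coin]
    by_cases h : e ∈ I <;> by_cases h' : e ∈ J <;> simp [h, h']
  simp only [hv, subsampleProb]
  split_ifs with hJ
  · rw [Finset.prod_ite]
    have h2 : (∏ e ∈ Finset.univ.filter (fun e => e ∉ I), if e ∈ J then (0 : ℝ) else 1) = 1 :=
      Finset.prod_eq_one fun e he => by
        rw [Finset.mem_filter] at he
        rw [if_neg fun h => he.2 (hJ h)]
    rw [h2, mul_one, Finset.prod_ite, Finset.prod_const, Finset.prod_const,
      ← Finset.card_sdiff_of_subset hJ]
    congr 3 <;> ext e <;> simp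
    exact fun h => hJ h
  · obtain ⟨e, heJ, heI⟩ := Finset.not_subset.1 hJ
    exact Finset.prod_eq_zero (Finset.mem_univ e) (by simp [heJ, heI])

theorem subsampledUnionValue_eq_ex {n ℓ : ℕ} (f : Finset (Fin n) → ℝ)
    (I : Fin ℓ → Finset (Fin n)) (h0 : 0 ≤ 1 / (ℓ : ℝ)) (h1 : 1 / (ℓ : ℝ) ≤ 1) :
    subsampledUnionValue f I = ((FinDist.coin (1 / (ℓ : ℝ)) h0 h1).pi (Fin ℓ × Fin n)).ex
      fun x => f (Finset.univ.biUnion (thin x I)) := by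
  have hp : ∀ J : Fin ℓ → Finset (Fin n), ∏ k, subsampleProb (1 / (ℓ : ℝ)) (I k) (J k) =
      ((FinDist.coin (1 / (ℓ : ℝ)) h0 h1).pi (Fin ℓ × Fin n)).ex
        fun x => if thin x I = J then 1 else 0 := by
    intro J
    simp only [← sum_coin_match _ h0 h1]
    rw [← Fintype.prod_prod_type'
      (f := fun k e => (FinDist.coin (1 / (ℓ : ℝ)) h0 h1).ex
        (fun b => if (e ∈ I k ∧ b = true ↔ e ∈ J k) then 1 else 0)), ← FinDist.ex_pi_prod]
    congr 1
    funext x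
    by_cases h : thin x I = J
    · rw [if_pos h]
      refine Finset.prod_eq_one fun ke _ => ?_
      rw [if_pos]
      rw [← h, thin, Finset.mem_filter]
    · rw [if_neg h]
      have : ∃ k e, ¬ (e ∈ I k ∧ x (k, e) = true ↔ e ∈ J k) := by
        by_contra! hc
        exact h (funext fun k => Finset.ext fun e => by
          rw [thin, Finset.mem_filter]; exact hc k e)
      obtain ⟨k, e, hke⟩ := this
      exact Finset.prod_eq_zero (Finset.mem_univ (k, e)) (if_neg hke)
  simp only [subsampledUnionValue, hp, FinDist.ex, Finset.sum_mul]
  rw [Finset.sum_comm]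
  refine Finset.sum_congr rfl fun x _ => ?_
  rw [Finset.sum_eq_single (thin x I)]
  · simp
  · intro J _ hJ
    rw [if_neg (Ne.symm hJ)]; simp
  · simp

namespace FinDist

variable {Ω : Type} [Fintype Ω]

theorem ex_exp_le (d : FinDist Ω) (Y : Ω → ℝ) {B s : ℝ} (hY : ∀ a, |Y a| ≤ B)
    (hs : |s| * (2 * B) ≤ 1) :
    d.ex (fun a => Real.exp (s * (Y a - d.ex Y))) ≤ Real.exp (s ^ 2 * (2 * B) ^ 2) := by
  have hE : |d.ex Y| ≤ B := by
    rw [abs_le]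
    constructor
    · calc -B = d.ex fun _ => -B := (d.ex_const _).symm
        _ ≤ _ := d.ex_mono fun a => (abs_le.1 (hY a)).1
    · calc _ ≤ d.ex fun _ => B := d.ex_mono fun a => (abs_le.1 (hY a)).2
        _ = B := d.ex_const _
  have hc : ∀ a, |Y a - d.ex Y| ≤ 2 * B := fun a =>
    (abs_sub _ _).trans (by linarith [hY a])
  have hB : 0 ≤ B := (abs_nonneg _).trans hE
  have h1 : ∀ a, Real.exp (s * (Y a - d.ex Y)) ≤
      1 + s ^ 2 * (2 * B) ^ 2 + s * (Y a - d.ex Y) := by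
    intro a
    have habs : |s * (Y a - d.ex Y)| ≤ 1 := by
      rw [abs_mul]
      exact (mul_le_mul_of_nonneg_left (hc a) (abs_nonneg _)).trans hs
    have h2 := (abs_le.1 (Real.abs_exp_sub_one_sub_id_le habs)).2
    have h3 : (s * (Y a - d.ex Y)) ^ 2 ≤ s ^ 2 * (2 * B) ^ 2 := by
      rw [mul_pow]
      gcongr 1
      exact sq_le_sq' (by linarith [(abs_le.1 (hc a)).1]) (abs_le.1 (hc a)).2
    linarith
  calc _ ≤ _ := d.ex_mono h1
    _ = 1 + s ^ 2 * (2 * B) ^ 2 := by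
      rw [d.ex_add, d.ex_const, d.ex_mul, d.ex_sub, d.ex_const]; ring
    _ ≤ _ := by linarith [Real.add_one_le_exp (s ^ 2 * (2 * B) ^ 2)]

/-- The expected maximal deviation of finitely many empirical means. -/
theorem ex_sup_dev_le (d : FinDist Ω) {ι : Type*} [Fintype ι] [Nonempty ι] (Y : ι → Ω → ℝ)
    {B σ : ℝ} (hB : 0 < B) (hY : ∀ j a, |Y j a| ≤ B) (hσ : 0 < σ) (hσ1 : σ ≤ 1) {N : ℕ}
    (hN0 : 0 < N) (hN : 16 * Real.log (2 * Fintype.card ι) ≤ σ ^ 2 * N) :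
    (d.pi (Fin N)).ex (fun x => Finset.univ.sup' Finset.univ_nonempty
      fun j => |(∑ i, Y j (x i)) / N - d.ex (Y j)|) ≤ σ * B := by
  set s : ℝ := σ / (8 * B) with hsdef
  have hs : 0 < s := by positivity
  have hN' : (0 : ℝ) < N := by exact_mod_cast hN0
  have hsB : |s| * (2 * B) ≤ 1 := by
    rw [abs_of_pos hs, hsdef]; field_simp; linarith
  have hsB' : |-s| * (2 * B) ≤ 1 := by rwa [abs_neg]
  set A : ℝ := 2 * Fintype.card ι * Real.exp (N * (s ^ 2 * (2 * B) ^ 2)) with hA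
  have hcard : (0 : ℝ) < Fintype.card ι := by exact_mod_cast Fintype.card_pos
  have hApos : 0 < A := by positivity
  let S : ι → (Fin N → Ω) → ℝ := fun j x => ∑ i, (Y j (x i) - d.ex (Y j))
  have hS : ∀ j x, (∑ i, Y j (x i)) / N - d.ex (Y j) = S j x / N := by
    intro j x
    simp only [S, Finset.sum_sub_distrib, Finset.sum_const, Finset.card_univ, Fintype.card_fin,
      nsmul_eq_mul]
    field_simp
  have hexp : ∀ (t : ℝ), |t| * (2 * B) ≤ 1 → ∀ j,
      (d.pi (Fin N)).ex (fun x => Real.exp (t * S j x)) ≤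
        Real.exp (N * (t ^ 2 * (2 * B) ^ 2)) := by
    intro t ht j
    have : (fun x => Real.exp (t * S j x)) = fun x : Fin N → Ω =>
        ∏ i, Real.exp (t * (Y j (x i) - d.ex (Y j))) := by
      funext x
      rw [← Real.exp_sum, Finset.mul_sum]
    rw [this, d.ex_pi_prod (fun _ a => Real.exp (t * (Y j a - d.ex (Y j)))), Finset.prod_const,
      Finset.card_univ, Fintype.card_fin, Real.exp_nat_mul]
    exact pow_le_pow_left₀ (d.ex_nonneg fun a => (Real.exp_pos _).le)
      (d.ex_exp_le (Y j) (hY j) ht) N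
  have hpt : ∀ x : Fin N → Ω, Finset.univ.sup' Finset.univ_nonempty
      (fun j => |(∑ i, Y j (x i)) / N - d.ex (Y j)|) ≤
      (s * N)⁻¹ * (A⁻¹ * ∑ j, (Real.exp (s * S j x) + Real.exp (-s * S j x)) +
        (Real.log A - 1)) := by
    intro x
    refine Finset.sup'_le _ _ fun j _ => ?_
    rw [hS, abs_div, abs_of_pos hN', ← div_eq_inv_mul, le_div_iff₀ (by positivity)]
    have h1 : |S j x| / N * (s * N) = s * |S j x| := by field_simp
    rw [h1]
    have h2 : Real.exp (s * |S j x|) ≤ ∑ j, (Real.exp (s * S j x) + Real.exp (-s * S j x)) := by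
      refine le_trans ?_ (Finset.single_le_sum
        (f := fun j => Real.exp (s * S j x) + Real.exp (-s * S j x))
        (fun i _ => by positivity) (Finset.mem_univ j))
      rcases abs_cases (S j x) with ⟨h, -⟩ | ⟨h, -⟩ <;> rw [h]
      · linarith [Real.exp_pos (-s * S j x)]
      · rw [show s * -S j x = -s * S j x by ring]
        linarith [Real.exp_pos (s * S j x)]
    have h3 := Real.add_one_le_exp (s * |S j x| - Real.log A)
    rw [Real.exp_sub, Real.exp_log hApos, div_eq_inv_mul] at h3
    have h4 := mul_le_mul_of_nonneg_left h2 (inv_pos.2 hApos).le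
    linarith
  calc _ ≤ _ := ex_mono _ hpt
    _ = (s * N)⁻¹ * (A⁻¹ * ∑ j, ((d.pi (Fin N)).ex (fun x => Real.exp (s * S j x)) +
        (d.pi (Fin N)).ex (fun x => Real.exp (-s * S j x))) + (Real.log A - 1)) := by
      rw [ex_mul, ex_add, ex_mul, ex_sum, ex_const]
      simp only [ex_add]
    _ ≤ (s * N)⁻¹ * (A⁻¹ * A + (Real.log A - 1)) := by
      gcongr
      calc _ ≤ ∑ _j : ι, 2 * Real.exp (N * (s ^ 2 * (2 * B) ^ 2)) := by
            refine Finset.sum_le_sum fun j _ => ?_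
            have e1 := hexp s hsB j
            have e2 := hexp (-s) hsB' j
            rw [neg_sq] at e2
            linarith
        _ = A := by rw [Finset.sum_const, nsmul_eq_mul, Finset.card_univ]; ring
    _ = (s * N)⁻¹ * Real.log A := by rw [inv_mul_cancel₀ hApos.ne']; ring
    _ ≤ (s * N)⁻¹ * (σ ^ 2 * N / 8) := by
      gcongr
      rw [hA, Real.log_mul (by positivity) (Real.exp_pos _).ne', Real.log_exp]
      have : s ^ 2 * (2 * B) ^ 2 = σ ^ 2 / 16 := by rw [hsdef]; field_simp; norm_num
      rw [this]; linarith
    _ = σ * B := by rw [hsdef]; field_simp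

end FinDist
end

noncomputable section

/-- Contracting one element costs at most one element of an independent set. -/
theorem Matroid.Indep.exists_sdiff_singleton_contractElem {α : Type*} {M : Matroid α} {I : Set α}
    (hI : M.Indep I) (u : α) : ∃ x, (M.contract {u}).Indep (I \ {x}) := by
  by_cases huE : u ∈ M.E
  · by_cases hu : M.IsNonloop u
    · by_cases huI : M.Indep (insert u I)
      · refine ⟨u, hu.contractElem_indep_iff.2 ⟨by simp, ?_⟩⟩
        rw [Set.insert_sdiff_singleton]
        exact huI
      · have hcl : u ∈ M.closure I := by
          by_contra h
          exact huI (hI.insert_indep_iff.2 (Or.inl ⟨huE, h⟩))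
        have hnI : u ∉ I := fun h => huI (by rwa [Set.insert_eq_of_mem h])
        have hC := hI.fundCircuit_isCircuit hcl hnI
        obtain ⟨x, hx, hxu⟩ : ∃ x ∈ M.fundCircuit u I, x ≠ u := by
          by_contra! h
          have h1 : M.fundCircuit u I ⊆ {u} := h
          exact hC.dep.not_indep (hu.indep.subset h1)
        have h2 := (hI.mem_fundCircuit_iff hcl hnI).1 hx
        refine ⟨x, hu.contractElem_indep_iff.2 ⟨fun h => hnI h.1, ?_⟩⟩
        rwa [Set.insert_sdiff_singleton_comm hxu.symm]
    · rw [Matroid.not_isNonloop_iff] at hu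
      refine ⟨u, ?_⟩
      rw [Matroid.contract_eq_delete_of_subset_loops (Set.singleton_subset_iff.2 hu), Matroid.delete_indep_iff]
      exact ⟨hI.subset Set.sdiff_subset, by simp⟩
  · exact ⟨u, by rw [Matroid.contractElem_eq_self huE]; exact hI.subset Set.sdiff_subset⟩

variable {n m : ℕ}

/-- According to the rank oracles, adding `e` to `P` increases the ranks in all underlying
matroids that contain `e`. -/
def Unblocked (N : Fin m → Finset (Fin n)) (O : MatchoidQuery n m → ℝ) (P : Finset (Fin n))
    (e : Fin n) : Prop :=
  ∀ i, e ∈ N i → O (.inr (i, P)) < O (.inr (i, insert e P))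

theorem rank_oracle_lt_iff (M : Fin m → Matroid (Fin n)) (f : Finset (Fin n) → ℝ)
    (P : Finset (Fin n)) {e : Fin n} {i : Fin m} (he : e ∈ (M i).E) :
    matchoidOracle M f (.inr (i, P)) < matchoidOracle M f (.inr (i, insert e P)) ↔
      e ∉ (M i).closure P := by
  have hfin : ∀ S : Finset (Fin n), (M i).eRk (S : Set (Fin n)) ≠ ⊤ := fun S =>
    ne_top_of_le_ne_top (by simp) ((M i).eRk_le_encard S)
  simp only [matchoidOracle, Nat.cast_lt, Finset.coe_insert]
  constructor
  · intro h hcl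
    have : (M i).eRk (insert e (P : Set (Fin n))) = (M i).eRk P := by
      rw [← Matroid.eRk_insert_closure_eq, Set.insert_eq_of_mem hcl, Matroid.eRk_closure_eq]
    rw [this] at h
    exact lt_irrefl _ h
  · intro h
    rw [Matroid.eRk_insert_eq_add_one ⟨he, h⟩, ENat.toNat_add (hfin P) (by simp)]
    simp

theorem unblocked_iff {N : Fin m → Finset (Fin n)} {M : Fin m → Matroid (Fin n)}
    (hE : ∀ i, (M i).E = (N i : Set (Fin n))) (f : Finset (Fin n) → ℝ) (P : Finset (Fin n))
    (e : Fin n) : Unblocked N (matchoidOracle M f) P e ↔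
      ∀ i, e ∈ (M i).E → e ∉ (M i).closure P := by
  refine forall_congr' fun i => ?_
  rw [hE]
  refine forall_congr' fun he => rank_oracle_lt_iff M f P (by rw [hE]; exact he)

theorem MatchoidIndep.insert {M : Fin m → Matroid (Fin n)} {G P : Finset (Fin n)} {e : Fin n}
    (hG : MatchoidIndep M G) (hGP : G ⊆ P)
    (he : ∀ i, e ∈ (M i).E → e ∉ (M i).closure P) : MatchoidIndep M (insert e G) := by
  intro i
  rw [Finset.coe_insert]
  by_cases h : e ∈ (M i).E
  · rw [Set.insert_inter_of_mem h, (hG i).insert_indep_iff]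
    refine Or.inl ⟨h, fun hcl => he i h ?_⟩
    exact (M i).closure_subset_closure
      (Set.inter_subset_left.trans (Finset.coe_subset.2 hGP)) hcl
  · rw [Set.insert_inter_of_notMem h]
    exact hG i

/-- `D` remains independent in all underlying matroids after contracting `P`. -/
def IndepOver (M : Fin m → Matroid (Fin n)) (P D : Finset (Fin n)) : Prop :=
  ∀ i, ((M i).contract (P : Set (Fin n))).Indep ((D : Set (Fin n)) ∩ (M i).E)

theorem IndepOver.notMem_closure {M : Fin m → Matroid (Fin n)} {P D : Finset (Fin n)}
    (h : IndepOver M P D) {e : Fin n} (he : e ∈ D) (i : Fin m) (hi : e ∈ (M i).E) :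
    e ∉ (M i).closure P :=
  (Matroid.contract_isNonloop_iff.1 ((h i).isNonloop_of_mem ⟨he, hi⟩)).2

theorem IndepOver.subset {M : Fin m → Matroid (Fin n)} {P D D' : Finset (Fin n)}
    (h : IndepOver M P D) (hD : D' ⊆ D) : IndepOver M P D' := fun i =>
  (h i).subset (Set.inter_subset_inter_left _ (Finset.coe_subset.2 hD))

theorem IndepOver.insert_erase {M : Fin m → Matroid (Fin n)} {P D : Finset (Fin n)}
    (h : IndepOver M P D) {u : Fin n} (hu : u ∈ D) : IndepOver M (insert u P) (D.erase u) := by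
  intro i
  rw [Finset.coe_insert, Set.insert_eq, Set.union_comm, ← Matroid.contract_contract]
  by_cases huE : u ∈ (M i).E
  · have hnl := (h i).isNonloop_of_mem ⟨hu, huE⟩
    rw [hnl.contractElem_indep_iff]
    refine ⟨by simp, (h i).subset ?_⟩
    rintro x (rfl | ⟨h1, h2⟩)
    · exact ⟨hu, huE⟩
    · exact ⟨Finset.mem_of_mem_erase h1, h2⟩
  · rw [Matroid.contractElem_eq_self (by simp [huE])]
    exact (h i).subset (Set.inter_subset_inter_left _ (Finset.coe_subset.2 (Finset.erase_subset _ _)))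

/-- Adding an element to `P` costs at most `p` elements of `D`. -/
theorem IndepOver.exists_insert {N : Fin m → Finset (Fin n)} {M : Fin m → Matroid (Fin n)}
    (hE : ∀ i, (M i).E = (N i : Set (Fin n))) {p : ℕ} (hp : InAtMost p N)
    {P D : Finset (Fin n)} (h : IndepOver M P D) (u : Fin n) :
    ∃ X : Finset (Fin n), X.card ≤ p ∧ IndepOver M (insert u P) (D \ X) := by
  choose x hx using fun i => (h i).exists_sdiff_singleton_contractElem u
  refine ⟨(Finset.univ.filter fun i => u ∈ N i).image x, Finset.card_image_le.trans (hp u), ?_⟩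
  intro i
  rw [Finset.coe_insert, Set.insert_eq, Set.union_comm, ← Matroid.contract_contract]
  by_cases hu : u ∈ N i
  · refine (hx i).subset ?_
    rintro e ⟨he, heE⟩
    rw [Finset.mem_coe, Finset.mem_sdiff] at he
    refine ⟨⟨he.1, heE⟩, fun hex => he.2 ?_⟩
    rw [Set.mem_singleton_iff] at hex
    exact Finset.mem_image.2 ⟨i, by simpa using hu, hex.symm⟩
  · have huE : u ∉ (M i).E := by rw [hE]; exact hu
    rw [Matroid.contractElem_eq_self (by simp [huE])]
    exact (h i).subset (Set.inter_subset_inter_left _ (Finset.coe_subset.2 Finset.sdiff_subset))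

theorem MatchoidIndep.indepOver_empty {M : Fin m → Matroid (Fin n)} {D : Finset (Fin n)}
    (h : MatchoidIndep M D) : IndepOver M ∅ D := fun i => by
  simpa using h i
end

noncomputable section

/-! ### Threshold sampling along a random order -/

/-- The state of threshold sampling: the elements considered so far, those among them that were
marked, those that were candidates when they were considered, those that were selected (marked
candidates), and the current threshold. -/
structure PState (n : ℕ) where
  C : Finset (Fin n)
  P : Finset (Fin n)
  H : Finset (Fin n)
  G : Finset (Fin n)
  lam : ℝ

namespace PState

variable {n : ℕ} (alive : Finset (Fin n) → Fin n → Prop) (w : Finset (Fin n) → Fin n → ℝ)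
  (θ : ℝ) (s : PState n)

open Classical in
/-- The elements that can still be selected. -/
def avail : Finset (Fin n) := Finset.univ.filter fun e => e ∉ s.C ∧ alive s.P e

/-- The available elements whose weight reaches the threshold. -/
def cands : Finset (Fin n) := (s.avail alive).filter fun e => s.lam ≤ w s.P e

/-- The largest weight of an available element. -/
def top : ℝ := if h : (s.avail alive).Nonempty then (s.avail alive).sup' h (w s.P) else 0

/-- Lower the threshold if no available element reaches it. -/
def lower : PState n :=
  { s with lam := if s.lam ≤ s.top alive w then s.lam else (1 - θ) * s.top alive w }

/-- The updated state and the set of elements to be sampled. -/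
def prep : PState n × Finset (Fin n) :=
  if 0 < s.top alive w then (s.lower alive w θ, (s.lower alive w θ).cands alive w) else (s, ∅)

open Classical in
/-- Consider the element `x.1`, with mark `x.2`. -/
def step (x : Fin n × Bool) : PState n where
  C := insert x.1 s.C
  P := if x.2 then insert x.1 s.P else s.P
  H := if x.1 ∈ s.cands alive w then insert x.1 s.H else s.H
  G := if x.2 = true ∧ x.1 ∈ s.cands alive w then insert x.1 s.G else s.G
  lam := s.lam

/-- Consider the elements of a list until there are fewer than `B` candidates. -/
def walk (B : ℝ) : List (Fin n × Bool) → PState n → PState n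
  | [], s => s
  | x :: l, s => if (((s.step alive w x).cands alive w).card : ℝ) < B then s.step alive w x
      else walk B l (s.step alive w x)

/-- The sets of marked elements that occur along a list. -/
def visited : List (Fin n × Bool) → Finset (Fin n) → Finset (Finset (Fin n))
  | [], P => {P}
  | x :: l, P => insert P (visited l (if x.2 then insert x.1 P else P))

theorem mem_visited_self (l : List (Fin n × Bool)) (P : Finset (Fin n)) : P ∈ visited l P := by
  cases l <;> simp [visited]

theorem card_visited_le (l : List (Fin n × Bool)) (P : Finset (Fin n)) :
    (visited l P).card ≤ l.length + 1 := by
  induction l generalizing P with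
  | nil => simp [visited]
  | cons x l ih =>
    refine (Finset.card_insert_le _ _).trans ?_
    simpa using ih _

variable {alive w θ s}

theorem mem_avail {e : Fin n} : e ∈ s.avail alive ↔ e ∉ s.C ∧ alive s.P e := by
  simp [avail]

theorem mem_cands {e : Fin n} :
    e ∈ s.cands alive w ↔ (e ∉ s.C ∧ alive s.P e) ∧ s.lam ≤ w s.P e := by
  simp [cands, mem_avail]

theorem le_top {e : Fin n} (h : e ∈ s.avail alive) : w s.P e ≤ s.top alive w := by
  rw [top, dif_pos ⟨e, h⟩]
  exact Finset.le_sup' (w s.P) h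

theorem exists_eq_top (h : 0 < s.top alive w) :
    ∃ e ∈ s.avail alive, w s.P e = s.top alive w := by
  by_cases hne : (s.avail alive).Nonempty
  · rw [top, dif_pos hne]
    obtain ⟨e, he, h1⟩ := Finset.exists_mem_eq_sup' hne (w s.P)
    exact ⟨e, he, h1.symm⟩
  · rw [top, dif_neg hne] at h
    exact absurd h (lt_irrefl 0)

theorem prep_congr {alive' : Finset (Fin n) → Fin n → Prop} {w' : Finset (Fin n) → Fin n → ℝ}
    (ha : alive s.P = alive' s.P) (hw : w s.P = w' s.P) :
    s.prep alive w θ = s.prep alive' w' θ := by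
  have h1 : s.avail alive = s.avail alive' := by ext e; simp only [mem_avail, ha]
  have h2 : s.top alive w = s.top alive' w' := by simp only [top, h1, hw]
  have h3 : s.lower alive w θ = s.lower alive' w' θ := by simp only [lower, h2]
  have h4 : (s.lower alive' w' θ).cands alive w = (s.lower alive' w' θ).cands alive' w' := by
    ext e
    rw [mem_cands, mem_cands]
    simp only [lower, ha, hw]
  rw [prep, prep, h2, h3, h4]

theorem cands_congr {alive' : Finset (Fin n) → Fin n → Prop} {w' : Finset (Fin n) → Fin n → ℝ}
    (ha : alive s.P = alive' s.P) (hw : w s.P = w' s.P) :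
    s.cands alive w = s.cands alive' w' := by
  ext e
  simp only [mem_cands, ha, hw]

theorem walk_congr {alive' : Finset (Fin n) → Fin n → Prop} {w' : Finset (Fin n) → Fin n → ℝ}
    (B : ℝ) (l : List (Fin n × Bool)) (s : PState n)
    (h : ∀ P ∈ visited l s.P, alive P = alive' P ∧ w P = w' P) :
    walk alive w B l s = walk alive' w' B l s := by
  induction l generalizing s with
  | nil => rfl
  | cons x l ih =>
    have h0 := h s.P (mem_visited_self _ _)
    have hs : s.step alive w x = s.step alive' w' x := by
      simp only [step, cands_congr h0.1 h0.2]
    have hrec : ∀ P ∈ visited l (s.step alive' w' x).P, alive P = alive' P ∧ w P = w' P :=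
      fun P hP => h P (Finset.mem_insert_of_mem hP)
    have h1 := hrec _ (mem_visited_self _ _)
    rw [walk, walk, hs, cands_congr h1.1 h1.2, ih _ hrec]

/-- The invariant of threshold sampling, where `J` is a property of the selected set. -/
structure Inv (alive : Finset (Fin n) → Fin n → Prop) (w : Finset (Fin n) → Fin n → ℝ) (θ : ℝ)
    (J : Finset (Fin n) → Prop) (s : PState n) : Prop where
  G_sub : s.G ⊆ s.P
  P_sub : s.P ⊆ s.C
  G_sub_H : s.G ⊆ s.H
  H_sub : s.H ⊆ s.C
  good : J s.G
  lam_nonneg : 0 ≤ s.lam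
  bound : ∀ e, e ∉ s.C → alive s.P e → w s.P e ≤ s.lam / (1 - θ)

/-- The set `Y` of the elements that are still to be considered in the current iteration. -/
structure Pending (alive : Finset (Fin n) → Fin n → Prop) (w : Finset (Fin n) → Fin n → ℝ)
    (θ : ℝ) (s : PState n) (Y : Finset (Fin n)) : Prop where
  fresh : ∀ a ∈ Y, a ∉ s.C
  bound : ∀ a ∈ Y, w s.P a ≤ s.lam / (1 - θ)
  cands_sub : s.cands alive w ⊆ Y

/-- The properties of the process that do not change with time. -/
structure Setup (alive : Finset (Fin n) → Fin n → Prop) (w : Finset (Fin n) → Fin n → ℝ)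
    (J : Finset (Fin n) → Prop) : Prop where
  alive_anti : ∀ ⦃P P' : Finset (Fin n)⦄ e, P ⊆ P' → alive P' e → alive P e
  w_anti : ∀ ⦃P P' : Finset (Fin n)⦄ e, P ⊆ P' → w P' e ≤ w P e
  J_insert : ∀ ⦃P G : Finset (Fin n)⦄ e, G ⊆ P → alive P e → J G → J (insert e G)

variable {J : Finset (Fin n) → Prop}

theorem P_sub_step (x : Fin n × Bool) : s.P ⊆ (s.step alive w x).P := by
  dsimp only [step]
  split_ifs
  · exact Finset.subset_insert _ _
  · exact subset_rfl

theorem Inv.step (hS : Setup alive w J) (h : s.Inv alive w θ J) (x : Fin n × Bool) :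
    (s.step alive w x).Inv alive w θ J where
  G_sub := by
    dsimp only [PState.step]
    split_ifs with h1 h2 h2
    · exact Finset.insert_subset_insert _ h.G_sub
    · exact absurd h1.1 h2
    · exact h.G_sub.trans (Finset.subset_insert _ _)
    · exact h.G_sub
  P_sub := by
    dsimp only [PState.step]
    split_ifs
    · exact Finset.insert_subset_insert _ h.P_sub
    · exact h.P_sub.trans (Finset.subset_insert _ _)
  G_sub_H := by
    dsimp only [PState.step]
    split_ifs with h1 h2 h2
    · exact Finset.insert_subset_insert _ h.G_sub_H
    · exact absurd h1.2 h2
    · exact h.G_sub_H.trans (Finset.subset_insert _ _)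
    · exact h.G_sub_H
  H_sub := by
    dsimp only [PState.step]
    split_ifs
    · exact Finset.insert_subset_insert _ h.H_sub
    · exact h.H_sub.trans (Finset.subset_insert _ _)
  good := by
    dsimp only [PState.step]
    split_ifs with h1
    · exact hS.J_insert _ h.G_sub (mem_cands.1 h1.2).1.2 h.good
    · exact h.good
  lam_nonneg := h.lam_nonneg
  bound e he ha := (hS.w_anti e (P_sub_step x)).trans
    (h.bound e (fun hc => he (Finset.mem_insert_of_mem hc)) (hS.alive_anti e (P_sub_step x) ha))

theorem Pending.step (hS : Setup alive w J) {Y : Finset (Fin n)} (h : s.Pending alive w θ Y)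
    (a : Fin n) (b : Bool) : (s.step alive w (a, b)).Pending alive w θ (Y.erase a) where
  fresh e he hc := by
    rcases Finset.mem_insert.1 hc with h1 | h1
    · exact (Finset.mem_erase.1 he).1 h1
    · exact h.fresh e (Finset.mem_of_mem_erase he) h1
  bound e he := (hS.w_anti e (P_sub_step _)).trans (h.bound e (Finset.mem_of_mem_erase he))
  cands_sub e he := by
    obtain ⟨⟨h1, h2⟩, h3⟩ := mem_cands.1 he
    refine Finset.mem_erase.2 ⟨fun h => h1 (h ▸ Finset.mem_insert_self _ _), h.cands_sub ?_⟩
    exact mem_cands.2 ⟨⟨fun hc => h1 (Finset.mem_insert_of_mem hc),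
      hS.alive_anti e (P_sub_step _) h2⟩, h3.trans (hS.w_anti e (P_sub_step _))⟩

variable {Q : Type}

variable (q : ℝ) (h0 : 0 ≤ q) (h1 : q ≤ 1)

/-- A uniformly random order of `Y`, with independent random marks. -/
def drawList : ℕ → Finset (Fin n) → AdaptiveAlg Q (List (Fin n × Bool))
  | 0, _ => .output []
  | k + 1, Y => if h : Y.Nonempty then
      (FinDist.uniform Y h).draw fun a => (FinDist.coin q h0 h1).draw fun b =>
        (drawList k (Y.erase a)).bind fun l => .output ((a, b) :: l)
    else .output []

theorem within_drawList (k : ℕ) (Y : Finset (Fin n)) :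
    (drawList (Q := Q) q h0 h1 k Y).Within (fun l => l.length ≤ k) 0 0 := by
  induction k generalizing Y with
  | zero => exact Nat.le_refl 0
  | succ k ih =>
    rw [drawList]
    split_ifs with h
    · refine FinDist.within_draw _ fun a => FinDist.within_draw _ fun b => ?_
      exact (ih _).bind (R' := 0) (K' := 0) fun l hl => Nat.succ_le_succ hl
    · exact Nat.zero_le (k + 1)

/-- What holds after an iteration. -/
theorem ensures_walk (hS : Setup alive w J) (O : Q → ℝ) {B : ℝ} (hB : 0 < B) (k : ℕ)
    (Y : Finset (Fin n)) (s : PState n) (hk : Y.card ≤ k) (hI : s.Inv alive w θ J)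
    (hY : s.Pending alive w θ Y) :
    (drawList (Q := Q) q h0 h1 k Y).Ensures O fun l =>
      (walk alive w B l s).Inv alive w θ J ∧ (walk alive w B l s).lam = s.lam ∧
      s.C ⊆ (walk alive w B l s).C ∧ (Y.Nonempty →
        (((walk alive w B l s).cands alive w).card : ℝ) < B ∧
        s.C.card < (walk alive w B l s).C.card) := by
  induction k generalizing Y s with
  | zero =>
    have : Y = ∅ := Finset.card_eq_zero.1 (Nat.le_zero.1 hk)
    exact ⟨hI, rfl, subset_rfl, fun h => by simp [this] at h⟩
  | succ k ih =>
    rw [drawList]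
    split_ifs with h
    · refine FinDist.ensures_draw _ fun a ha => FinDist.ensures_draw _ fun b _ => ?_
      have haY : a ∈ Y := by
        by_contra hn
        simp [FinDist.uniform, hn] at ha
      have hlt : s.C.card < (s.step alive w (a, b)).C.card := by
        refine Finset.card_lt_card (Finset.ssubset_insert (hY.fresh a haY))
      have hI' := hI.step hS (a, b)
      have hY' := hY.step hS a b
      by_cases hc : (((s.step alive w (a, b)).cands alive w).card : ℝ) < B
      · refine AdaptiveAlg.Ensures.bind (ih (Y.erase a) _ (by
          rw [Finset.card_erase_of_mem haY]; omega) hI' hY') fun l _ => ?_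
        rw [AdaptiveAlg.Ensures, walk, if_pos hc]
        exact ⟨hI', rfl, Finset.subset_insert _ _, fun _ => ⟨hc, hlt⟩⟩
      · refine AdaptiveAlg.Ensures.bind (ih (Y.erase a) _ (by
          rw [Finset.card_erase_of_mem haY]; omega) hI' hY') fun l hl => ?_
        rw [AdaptiveAlg.Ensures, walk, if_neg hc]
        refine ⟨hl.1, hl.2.1, (Finset.subset_insert _ _).trans hl.2.2.1, fun _ => ?_⟩
        have hne : (Y.erase a).Nonempty := by
          by_contra hemp
          rw [Finset.not_nonempty_iff_eq_empty] at hemp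
          have := hY'.cands_sub
          rw [hemp, Finset.subset_empty] at this
          rw [this] at hc
          simp [hB] at hc
        exact ⟨(hl.2.2.2 hne).1, hlt.trans (hl.2.2.2 hne).2⟩
    · exact ⟨hI, rfl, subset_rfl, fun h' => absurd h' h⟩

/-- `Φ` does not decrease in expectation when a random pending element is considered, as long as
most pending elements are candidates. -/
def StepIneq (alive : Finset (Fin n) → Fin n → Prop) (w : Finset (Fin n) → Fin n → ℝ) (θ : ℝ)
    (J : Finset (Fin n) → Prop) (q : ℝ) (Φ : PState n → ℝ) : Prop :=
  ∀ (s : PState n) (Y : Finset (Fin n)), s.Inv alive w θ J → s.Pending alive w θ Y →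
    Y.Nonempty → (1 - θ) * Y.card ≤ (s.cands alive w).card →
    Y.card * Φ s ≤
      ∑ a ∈ Y, (q * Φ (s.step alive w (a, true)) + (1 - q) * Φ (s.step alive w (a, false)))

theorem le_ev_walk (hS : Setup alive w J) (O : Q → ℝ) {Φ : PState n → ℝ}
    (hΦ : StepIneq alive w θ J q Φ) {B : ℝ} (hθ : θ ≤ 1) (k : ℕ)
    (Y : Finset (Fin n)) (s : PState n) (hk : Y.card ≤ k) (hI : s.Inv alive w θ J)
    (hY : s.Pending alive w θ Y) (hYB : (1 - θ) * Y.card ≤ B)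
    (hBc : B ≤ (s.cands alive w).card) :
    Φ s ≤ (drawList (Q := Q) q h0 h1 k Y).ev O fun l => Φ (walk alive w B l s) := by
  induction k generalizing Y s with
  | zero => exact le_rfl
  | succ k ih =>
    rw [drawList]
    split_ifs with h
    · rw [FinDist.ev_draw, FinDist.ex_uniform]
      have hc : (0 : ℝ) < Y.card := by exact_mod_cast h.card_pos
      rw [le_div_iff₀ hc, mul_comm]
      refine (hΦ s Y hI hY h (hYB.trans hBc)).trans (Finset.sum_le_sum fun a ha => ?_)
      rw [FinDist.ev_draw, FinDist.ex_coin]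
      have key : ∀ b, Φ (s.step alive w (a, b)) ≤ ((drawList (Q := Q) q h0 h1 k (Y.erase a)).bind
          fun l => AdaptiveAlg.output ((a, b) :: l)).ev O fun l => Φ (walk alive w B l s) := by
        intro b
        rw [AdaptiveAlg.ev_bind]
        simp only [AdaptiveAlg.ev, walk]
        by_cases hcd : (((s.step alive w (a, b)).cands alive w).card : ℝ) < B
        · simp only [if_pos hcd]
          rw [AdaptiveAlg.ev_const]
        · simp only [if_neg hcd]
          have hcard : (Y.erase a).card = Y.card - 1 := Finset.card_erase_of_mem ha
          refine ih (Y.erase a) _ (by omega) (hI.step hS _) (hY.step hS a b) ?_ (not_lt.1 hcd)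
          refine le_trans (mul_le_mul_of_nonneg_left ?_ (sub_nonneg.2 hθ)) hYB
          exact_mod_cast Finset.card_erase_le
      exact add_le_add (mul_le_mul_of_nonneg_left (key true) h0)
        (mul_le_mul_of_nonneg_left (key false) (sub_nonneg.2 h1))
    · exact le_rfl

end PState

/-- The data of threshold sampling: how availability and weights are obtained from the oracle. -/
structure Sampler (n : ℕ) (Q : Type) where
  alive : (Q → ℝ) → Finset (Fin n) → Fin n → Prop
  w : (Q → ℝ) → Finset (Fin n) → Fin n → ℝ
  qs : Finset (Fin n) → Finset Q
  congr : ∀ (O O' : Q → ℝ) (P : Finset (Fin n)), (∀ x ∈ qs P, O x = O' x) →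
    alive O P = alive O' P ∧ w O P = w O' P
  θ : ℝ
  q : ℝ
  q_nonneg : 0 ≤ q
  q_le_one : q ≤ 1

namespace Sampler

open PState

variable {n : ℕ} {Q : Type} (A : Sampler n Q)

/-- The queries for all sets of marked elements along a list. -/
def listQs (l : List (Fin n × Bool)) (P : Finset (Fin n)) : Finset Q :=
  open Classical in (visited l P).biUnion A.qs

/-- One iteration. -/
def iter (s : PState n) : AdaptiveAlg Q (PState n) :=
  (AdaptiveAlg.ask (A.qs s.P) fun O => s.prep (A.alive O) (A.w O) A.θ).bind fun x =>
    (drawList A.q A.q_nonneg A.q_le_one x.2.card x.2).bind fun l =>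
      AdaptiveAlg.ask (A.listQs l x.1.P) fun O =>
        walk (A.alive O) (A.w O) ((1 - A.θ) * x.2.card) l x.1

/-- Several iterations. -/
def loop : ℕ → PState n → AdaptiveAlg Q (PState n)
  | 0, s => .output s
  | k + 1, s => (A.iter s).bind (loop k)

theorem local_prep (s : PState n) :
    AdaptiveAlg.LocalOn (A.qs s.P) fun O => s.prep (A.alive O) (A.w O) A.θ := fun O O' h =>
  prep_congr (A.congr O O' _ h).1 (A.congr O O' _ h).2

theorem local_walk (l : List (Fin n × Bool)) (s : PState n) (B : ℝ) :
    AdaptiveAlg.LocalOn (A.listQs l s.P) fun O => walk (A.alive O) (A.w O) B l s :=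
  fun O O' h => walk_congr B l s fun P hP => A.congr O O' P fun x hx =>
    h x (by classical exact Finset.mem_biUnion.2 ⟨P, hP, hx⟩)

theorem within_iter {κ : ℕ} (hκ : ∀ P, (A.qs P).card ≤ κ) (s : PState n) :
    (A.iter s).Within (fun _ => True) 2 ((n + 2) * κ) := by
  have h1 := AdaptiveAlg.within_ask (A.qs s.P) (fun O => s.prep (A.alive O) (A.w O) A.θ)
    (hκ s.P)
  refine (h1.bind (R' := 1) (K' := (n + 1) * κ) fun x _ => ?_).mono (fun _ h => h) le_rfl
    (by ring_nf; rfl)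
  refine ((within_drawList (Q := Q) A.q A.q_nonneg A.q_le_one x.2.card x.2).bind
    (R' := 1) (K' := (n + 1) * κ) fun l hl => AdaptiveAlg.within_ask _ _ ?_).mono
    (fun _ h => h) (by omega) (by omega)
  classical
  have hX : x.2.card ≤ n := by simpa using Finset.card_le_univ x.2
  refine (Finset.card_biUnion_le_card_mul _ _ κ fun P _ => hκ P).trans ?_
  exact Nat.mul_le_mul_right _ ((card_visited_le _ _).trans (by omega))

theorem within_loop {κ : ℕ} (hκ : ∀ P, (A.qs P).card ≤ κ) (k : ℕ) (s : PState n) :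
    (A.loop k s).Within (fun _ => True) (2 * k) (k * ((n + 2) * κ)) := by
  induction k generalizing s with
  | zero => exact trivial
  | succ k ih =>
    exact ((A.within_iter hκ s).bind fun x _ => ih x).mono (fun _ h => h) (by omega)
      (by ring_nf; rfl)

variable {A} {O : Q → ℝ} {J : Finset (Fin n) → Prop}

theorem _root_.PState.Inv.lower {alive : Finset (Fin n) → Fin n → Prop}
    {w : Finset (Fin n) → Fin n → ℝ} {θ : ℝ} {s : PState n} (h : s.Inv alive w θ J) (hθ : θ < 1)
    (ht : 0 < s.top alive w) : (s.lower alive w θ).Inv alive w θ J where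
  G_sub := h.G_sub
  P_sub := h.P_sub
  G_sub_H := h.G_sub_H
  H_sub := h.H_sub
  good := h.good
  lam_nonneg := by
    dsimp only [PState.lower]
    split_ifs
    · exact h.lam_nonneg
    · exact mul_nonneg (sub_nonneg.2 hθ.le) ht.le
  bound e he ha := by
    dsimp only [PState.lower]
    split_ifs
    · exact h.bound e he ha
    · rw [mul_div_cancel_left₀ _ (sub_pos.2 hθ).ne']
      exact le_top (mem_avail.2 ⟨he, ha⟩)

theorem _root_.PState.Inv.pending_lower {alive : Finset (Fin n) → Fin n → Prop}
    {w : Finset (Fin n) → Fin n → ℝ} {θ : ℝ} {s : PState n} (h : s.Inv alive w θ J) (hθ : θ < 1)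
    (ht : 0 < s.top alive w) :
    (s.lower alive w θ).Pending alive w θ ((s.lower alive w θ).cands alive w) where
  fresh _ ha := (mem_cands.1 ha).1.1
  bound _ ha := (h.lower hθ ht).bound _ (mem_cands.1 ha).1.1 (mem_cands.1 ha).1.2
  cands_sub := subset_rfl

theorem _root_.PState.cands_lower_nonempty {alive : Finset (Fin n) → Fin n → Prop}
    {w : Finset (Fin n) → Fin n → ℝ} {θ : ℝ} {s : PState n} (hθ : 0 ≤ θ)
    (ht : 0 < s.top alive w) : ((s.lower alive w θ).cands alive w).Nonempty := by
  obtain ⟨e, he, h⟩ := exists_eq_top ht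
  refine ⟨e, mem_cands.2 ⟨mem_avail.1 he, ?_⟩⟩
  dsimp only [PState.lower]
  rw [h]
  split_ifs with h1
  · exact h1
  · nlinarith

/-- What holds after an iteration from `s` to `s'`. -/
def After (A : Sampler n Q) (O : Q → ℝ) (s s' : PState n) : Prop :=
  if 0 < s.top (A.alive O) (A.w O) then
    s'.lam = (s.lower (A.alive O) (A.w O) A.θ).lam ∧ s.C.card < s'.C.card ∧
    ((s'.cands (A.alive O) (A.w O)).card : ℝ) <
      (1 - A.θ) * ((s.lower (A.alive O) (A.w O) A.θ).cands (A.alive O) (A.w O)).card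
  else s' = s

theorem ensures_iter (hS : Setup (A.alive O) (A.w O) J) (hθ : 0 ≤ A.θ) (hθ1 : A.θ < 1)
    (s : PState n) (hI : s.Inv (A.alive O) (A.w O) A.θ J) :
    (A.iter s).Ensures O fun s' => s'.Inv (A.alive O) (A.w O) A.θ J ∧ A.After O s s' := by
  refine AdaptiveAlg.Ensures.bind (r := fun x => x = s.prep (A.alive O) (A.w O) A.θ)
    (AdaptiveAlg.ensures_ask (A.local_prep s) rfl) fun x hx => ?_
  by_cases ht : 0 < s.top (A.alive O) (A.w O)
  · rw [prep, if_pos ht] at hx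
    subst hx
    have hne := cands_lower_nonempty hθ ht
    refine AdaptiveAlg.Ensures.bind (ensures_walk A.q A.q_nonneg A.q_le_one hS O
      (B := (1 - A.θ) * ((s.lower (A.alive O) (A.w O) A.θ).cands (A.alive O) (A.w O)).card)
      (mul_pos (sub_pos.2 hθ1) (by exact_mod_cast hne.card_pos)) _ _ _ le_rfl
      (hI.lower hθ1 ht) (hI.pending_lower hθ1 ht)) fun l hl => ?_
    refine AdaptiveAlg.ensures_ask (A.local_walk l _ _) ⟨hl.1, ?_⟩
    rw [After, if_pos ht]
    exact ⟨hl.2.1, (hl.2.2.2 hne).2, (hl.2.2.2 hne).1⟩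
  · rw [prep, if_neg ht] at hx
    subst hx
    refine AdaptiveAlg.ensures_ask (A.local_walk [] s _) ⟨hI, ?_⟩
    rw [After, if_neg ht]
    rfl

theorem le_ev_iter (hS : Setup (A.alive O) (A.w O) J) (hθ : 0 ≤ A.θ) (hθ1 : A.θ < 1)
    {Φ : PState n → ℝ} (hΦ : StepIneq (A.alive O) (A.w O) A.θ J A.q Φ)
    (hlam : ∀ (s : PState n) (x : ℝ), Φ { s with lam := x } = Φ s)
    (s : PState n) (hI : s.Inv (A.alive O) (A.w O) A.θ J) : Φ s ≤ (A.iter s).ev O Φ := by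
  rw [iter, AdaptiveAlg.ev_bind, AdaptiveAlg.ev_ask (A.local_prep s), AdaptiveAlg.ev_bind]
  simp only [AdaptiveAlg.ev_ask (A.local_walk _ _ _)]
  by_cases ht : 0 < s.top (A.alive O) (A.w O)
  · rw [prep, if_pos ht]
    have hne := cands_lower_nonempty hθ ht
    have hpos : (0 : ℝ) < ((s.lower (A.alive O) (A.w O) A.θ).cands (A.alive O) (A.w O)).card := by
      exact_mod_cast hne.card_pos
    rw [← hlam s (s.lower (A.alive O) (A.w O) A.θ).lam]
    refine le_ev_walk A.q A.q_nonneg A.q_le_one hS O hΦ hθ1.le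
      _ _ _ le_rfl (hI.lower hθ1 ht) (hI.pending_lower hθ1 ht) le_rfl ?_
    exact mul_le_of_le_one_left hpos.le (by linarith)
  · rw [prep, if_neg ht]
    exact le_rfl

theorem le_ev_loop (hS : Setup (A.alive O) (A.w O) J) (hθ : 0 ≤ A.θ) (hθ1 : A.θ < 1)
    {Φ : PState n → ℝ} (hΦ : StepIneq (A.alive O) (A.w O) A.θ J A.q Φ)
    (hlam : ∀ (s : PState n) (x : ℝ), Φ { s with lam := x } = Φ s) (k : ℕ)
    (s : PState n) (hI : s.Inv (A.alive O) (A.w O) A.θ J) : Φ s ≤ (A.loop k s).ev O Φ := by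
  induction k generalizing s with
  | zero => exact le_rfl
  | succ k ih =>
    rw [loop, AdaptiveAlg.ev_bind]
    exact (le_ev_iter hS hθ hθ1 hΦ hlam s hI).trans
      (AdaptiveAlg.ev_mono (ensures_iter hS hθ hθ1 s hI) fun s' hs' => ih s' hs'.1)

/-- Progress of the iterations, in two measures. -/
def Progress (A : Sampler n Q) (O : Q → ℝ) (L : ℕ) (lam0 : ℝ) (j : ℕ) (s : PState n) : Prop :=
  s.top (A.alive O) (A.w O) ≤ 0 ∨ (j ≤ s.C.card ∧ ∃ t r : ℕ, j ≤ L * t + r ∧ r ≤ L ∧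
    s.lam ≤ (1 - A.θ) ^ t * lam0 ∧
    ((s.cands (A.alive O) (A.w O)).card : ℝ) ≤ (1 - A.θ) ^ r * n)

theorem Progress.after (hθ : 0 ≤ A.θ) (hθ1 : A.θ < 1) {L : ℕ} (hL : (1 - A.θ) ^ L * n < 1)
    {lam0 : ℝ} {j : ℕ} {s s' : PState n} (hL1 : 1 ≤ L) (h : A.Progress O L lam0 j s)
    (ha : A.After O s s') : A.Progress O L lam0 (j + 1) s' := by
  by_cases ht : 0 < s.top (A.alive O) (A.w O)
  · rw [After, if_pos ht] at ha
    obtain ⟨ha1, ha2, ha3⟩ := ha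
    obtain ⟨hj, t, r, h1, h2, h3, h4⟩ := h.resolve_left (not_le.2 ht)
    have hθ' : 0 ≤ 1 - A.θ := sub_nonneg.2 hθ1.le
    refine Or.inr ⟨by omega, ?_⟩
    by_cases hlam : s.lam ≤ s.top (A.alive O) (A.w O)
    · have hlow : s.lower (A.alive O) (A.w O) A.θ = s := by
        rw [PState.lower, if_pos hlam]
      have hne := cands_lower_nonempty (alive := A.alive O) (w := A.w O) hθ ht
      rw [hlow] at ha1 ha3 hne
      have hone : (1 : ℝ) ≤ (s.cands (A.alive O) (A.w O)).card := by
        exact_mod_cast hne.card_pos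
      have hrL : r ≠ L := by
        rintro rfl
        linarith
      refine ⟨t, r + 1, by omega, by omega, ha1 ▸ h3, ?_⟩
      rw [pow_succ]
      nlinarith
    · refine ⟨t + 1, 1, by rw [mul_add]; omega, hL1, ?_, ?_⟩
      · rw [ha1, PState.lower, pow_succ, mul_comm _ (1 - A.θ), mul_assoc]
        dsimp only
        rw [if_neg hlam]
        exact mul_le_mul_of_nonneg_left ((not_le.1 hlam).le.trans h3) hθ'
      · rw [pow_one]
        refine ha3.le.trans (mul_le_mul_of_nonneg_left ?_ hθ')
        have := Finset.card_le_univ ((s.lower (A.alive O) (A.w O) A.θ).cands (A.alive O) (A.w O))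
        rw [Fintype.card_fin] at this
        exact_mod_cast this
  · rw [After, if_neg ht] at ha
    subst ha
    exact Or.inl (not_lt.1 ht)

theorem ensures_loop (hS : Setup (A.alive O) (A.w O) J) (hθ : 0 ≤ A.θ) (hθ1 : A.θ < 1) {L : ℕ}
    (hL : (1 - A.θ) ^ L * n < 1) (hL1 : 1 ≤ L) {lam0 : ℝ} (k j : ℕ)
    (s : PState n) (hI : s.Inv (A.alive O) (A.w O) A.θ J) (hP : A.Progress O L lam0 j s) :
    (A.loop k s).Ensures O fun s' => s'.Inv (A.alive O) (A.w O) A.θ J ∧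
      A.Progress O L lam0 (j + k) s' := by
  induction k generalizing s j with
  | zero => exact ⟨hI, hP⟩
  | succ k ih =>
    refine AdaptiveAlg.Ensures.bind (ensures_iter hS hθ hθ1 s hI) fun s' hs' => ?_
    have := ih (j + 1) s' hs'.1 (hP.after hθ hθ1 hL hL1 hs'.2)
    rwa [show j + 1 + k = j + (k + 1) by ring] at this

/-- After sufficiently many iterations, all available elements have small weight. -/
theorem ensures_loop_init (hS : Setup (A.alive O) (A.w O) J) (hθ : 0 ≤ A.θ) (hθ1 : A.θ < 1)
    {L : ℕ} (hL : (1 - A.θ) ^ L * n < 1) (hL1 : 1 ≤ L) {lam0 : ℝ} (hlam0 : 0 ≤ lam0) (T : ℕ)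
    (hI : (⟨∅, ∅, ∅, ∅, lam0⟩ : PState n).Inv (A.alive O) (A.w O) A.θ J) :
    (A.loop (min n (L * (T + 2))) ⟨∅, ∅, ∅, ∅, lam0⟩).Ensures O fun s =>
      s.Inv (A.alive O) (A.w O) A.θ J ∧
      ∀ e, e ∉ s.C → A.alive O s.P e → A.w O s.P e ≤ (1 - A.θ) ^ T * lam0 := by
  have hθ' : 0 < 1 - A.θ := sub_pos.2 hθ1
  refine (ensures_loop hS hθ hθ1 hL hL1 (lam0 := lam0) _ 0 _ hI ?_).mono fun s hs => ⟨hs.1, ?_⟩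
  · refine Or.inr ⟨by simp, 0, 0, by simp, by simp, by simp, ?_⟩
    have := Finset.card_le_univ ((⟨∅, ∅, ∅, ∅, lam0⟩ : PState n).cands (A.alive O) (A.w O))
    rw [Fintype.card_fin] at this
    simpa using this
  · intro e he ha
    have hnn : 0 ≤ (1 - A.θ) ^ T * lam0 := by positivity
    rcases hs.2 with h | ⟨h1, t, r, h2, h3, h4, -⟩
    · exact (le_top (mem_avail.2 ⟨he, ha⟩)).trans (h.trans hnn)
    · rw [Nat.zero_add] at h1 h2
      rcases le_total n (L * (T + 2)) with hm | hm
      · rw [min_eq_left hm] at h1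
        have huniv : s.C = Finset.univ := by
          rw [← Finset.card_eq_iff_eq_univ, Fintype.card_fin]
          exact le_antisymm (by simpa using Finset.card_le_univ s.C) h1
        exact absurd (huniv ▸ Finset.mem_univ e) he
      · rw [min_eq_right hm] at h2
        have htT : T + 1 ≤ t := by
          have : L * (T + 2) ≤ L * (t + 1) := by rw [mul_add L t]; omega
          have := Nat.le_of_mul_le_mul_left this (by omega)
          omega
        refine (hs.1.bound e he ha).trans ?_
        rw [div_le_iff₀ hθ']
        refine h4.trans ?_
        rw [mul_right_comm, ← pow_succ]
        exact mul_le_mul_of_nonneg_right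
          (pow_le_pow_of_le_one hθ'.le (by linarith) htT) hlam0

end Sampler
end

noncomputable section

variable {n : ℕ}

/-! ### Marginal values -/

/-- The marginal value of `u` over `S`. -/
def marg (f : Finset (Fin n) → ℝ) (S : Finset (Fin n)) (u : Fin n) : ℝ := f (insert u S) - f S

theorem marg_of_mem (f : Finset (Fin n) → ℝ) {S : Finset (Fin n)} {u : Fin n} (h : u ∈ S) :
    marg f S u = 0 := by
  rw [marg, Finset.insert_eq_of_mem h, sub_self]

theorem IsSubmodular.marg_anti {f : Finset (Fin n) → ℝ} (hf : IsSubmodular f)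
    {S S' : Finset (Fin n)} {u : Fin n} (h : S ⊆ S') (hu : u ∈ S' → u ∈ S) :
    marg f S' u ≤ marg f S u := by
  by_cases huS : u ∈ S'
  · rw [marg_of_mem f huS, marg_of_mem f (hu huS)]
  · have h1 := hf (insert u S) S'
    rw [Finset.insert_union, Finset.union_eq_right.2 h, Finset.insert_inter_of_notMem huS,
      Finset.inter_eq_left.2 h] at h1
    rw [marg, marg]
    linarith

theorem IsSubmodular.le_add_sum_marg {f : Finset (Fin n) → ℝ} (hf : IsSubmodular f)
    (S V : Finset (Fin n)) : f (S ∪ V) ≤ f S + ∑ o ∈ V, marg f S o := by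
  induction V using Finset.induction_on with
  | empty => simp
  | insert o V ho ih =>
    rw [Finset.sum_insert ho, Finset.union_insert]
    have h : marg f (S ∪ V) o ≤ marg f S o := by
      refine hf.marg_anti Finset.subset_union_left fun h => ?_
      exact (Finset.mem_union.1 h).resolve_right ho
    rw [marg] at h
    linarith

theorem IsSubmodular.union_right {f : Finset (Fin n) → ℝ} (hf : IsSubmodular f)
    (V : Finset (Fin n)) : IsSubmodular fun S => f (S ∪ V) := by
  intro S S'
  have := hf (S ∪ V) (S' ∪ V)
  rwa [← Finset.union_union_distrib_right, ← Finset.inter_union_distrib_right] at this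

/-! ### A random base set and a random filter -/

section Stage

variable {Ω : Type} [Fintype Ω] (D : FinDist Ω) (R T : Ω → Finset (Fin n))

/-- The expected value of `g` at the random base set together with the filtered part of `P`. -/
def meanVal (g : Finset (Fin n) → ℝ) (P : Finset (Fin n)) : ℝ :=
  D.ex fun x => g (R x ∪ (P ∩ T x))

/-- The marginal value of `u`, for one sample. -/
def sampleWt (f : Finset (Fin n) → ℝ) (P : Finset (Fin n)) (u : Fin n) (x : Ω) : ℝ :=
  marg f (R x ∪ (P.erase u ∩ T x)) u

/-- The expected marginal value of `u`. -/
def meanWt (f : Finset (Fin n) → ℝ) (P : Finset (Fin n)) (u : Fin n) : ℝ :=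
  D.ex (sampleWt R T f P u)

theorem meanWt_eq (f : Finset (Fin n) → ℝ) (P : Finset (Fin n)) (u : Fin n) :
    meanWt D R T f P u = D.ex fun x => marg f (R x ∪ (P.erase u ∩ T x)) u := rfl

/-- Each element passes the filter with probability `δ`, independently of everything else. -/
def FilterIndep (δ : ℝ) : Prop :=
  ∀ (g : Finset (Fin n) → ℝ) (P : Finset (Fin n)) (u : Fin n), u ∉ P →
    meanVal D R T g (insert u P) =
      meanVal D R T g P + δ * D.ex fun x => marg g (R x ∪ (P ∩ T x)) u

variable {D R T}

omit [Fintype Ω] in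
theorem sampleWt_anti {f : Finset (Fin n) → ℝ} (hf : IsSubmodular f) {P P' : Finset (Fin n)}
    (h : P ⊆ P') (u : Fin n) (x : Ω) : sampleWt R T f P' u x ≤ sampleWt R T f P u x := by
  refine hf.marg_anti (Finset.union_subset_union_right
    (Finset.inter_subset_inter_right (Finset.erase_subset_erase u h))) fun hu => ?_
  rcases Finset.mem_union.1 hu with hu | hu
  · exact Finset.mem_union_left _ hu
  · exact absurd (Finset.mem_inter.1 hu).1 (Finset.notMem_erase u P')

theorem meanWt_anti {f : Finset (Fin n) → ℝ} (hf : IsSubmodular f) {P P' : Finset (Fin n)}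
    (h : P ⊆ P') (u : Fin n) : meanWt D R T f P' u ≤ meanWt D R T f P u :=
  D.ex_mono fun x => sampleWt_anti hf h u x

theorem FilterIndep.insert_eq {δ : ℝ} (hI : FilterIndep D R T δ) (f : Finset (Fin n) → ℝ)
    {P : Finset (Fin n)} {u : Fin n} (hu : u ∉ P) :
    meanVal D R T f (insert u P) = meanVal D R T f P + δ * meanWt D R T f P u := by
  rw [hI f P u hu]
  simp only [meanWt_eq, Finset.erase_eq_of_notMem hu]

theorem FilterIndep.ex_marg_le {δ : ℝ} (hδ0 : 0 ≤ δ) (hδ1 : δ ≤ 1) (hI : FilterIndep D R T δ)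
    (f : Finset (Fin n) → ℝ) (P : Finset (Fin n)) (u : Fin n) :
    (D.ex fun x => marg f (R x ∪ (P ∩ T x)) u) ≤ max 0 (meanWt D R T f P u) := by
  by_cases hu : u ∈ P
  · have h1 := hI.insert_eq f (Finset.notMem_erase u P)
    rw [Finset.insert_erase hu] at h1
    have h2 : meanWt D R T f (P.erase u) u = meanWt D R T f P u := by
      simp only [meanWt_eq, Finset.erase_idem]
    have h3 : (D.ex fun x => marg f (R x ∪ (P ∩ T x)) u) =
        meanVal D R T f (P.erase u) + meanWt D R T f P u - meanVal D R T f P := by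
      rw [meanVal, meanWt, meanVal, ← D.ex_add, ← D.ex_sub]
      congr 1
      funext x
      have : insert u (R x ∪ (P ∩ T x)) = insert u (R x ∪ (P.erase u ∩ T x)) := by
        ext e
        simp only [Finset.mem_insert, Finset.mem_union, Finset.mem_inter, Finset.mem_erase]
        tauto
      simp only [marg, sampleWt, this]
      ring
    rw [h3, h1, h2]
    rcases le_total 0 (meanWt D R T f P u) with h | h
    · rw [max_eq_right h]; nlinarith
    · rw [max_eq_left h]; nlinarith
  · refine le_trans (le_of_eq ?_) (le_max_right _ _)
    simp only [meanWt_eq, Finset.erase_eq_of_notMem hu]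

theorem FilterIndep.insert_ge {δ : ℝ} (hδ0 : 0 ≤ δ) (hI : FilterIndep D R T δ)
    {g : Finset (Fin n) → ℝ} (hg : IsSubmodular g) {P C : Finset (Fin n)} (hPC : P ⊆ C)
    {u : Fin n} (hu : u ∉ C) :
    meanVal D R T g P + δ * ((D.ex fun x => g (R x ∪ insert u C)) - D.ex fun x => g (R x ∪ C)) ≤
      meanVal D R T g (insert u P) := by
  rw [hI g P u fun h => hu (hPC h), ← D.ex_sub]
  gcongr
  refine D.ex_mono fun x => ?_
  rw [Finset.union_insert]
  refine hg.marg_anti (Finset.union_subset_union_right (Finset.inter_subset_left.trans hPC)) ?_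
  exact fun h => Finset.mem_union_left _ ((Finset.mem_union.1 h).resolve_right hu)

theorem FilterIndep.meanVal_union_le {δ : ℝ} (hδ0 : 0 ≤ δ) (hδ1 : δ ≤ 1)
    (hI : FilterIndep D R T δ) {f : Finset (Fin n) → ℝ} (hf : IsSubmodular f)
    (P V : Finset (Fin n)) :
    meanVal D R T (fun S => f (S ∪ V)) P ≤
      meanVal D R T f P + ∑ o ∈ V, max 0 (meanWt D R T f P o) := by
  calc _ ≤ D.ex fun x => f (R x ∪ (P ∩ T x)) + ∑ o ∈ V, marg f (R x ∪ (P ∩ T x)) o :=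
        D.ex_mono fun x => hf.le_add_sum_marg _ _
    _ = meanVal D R T f P + ∑ o ∈ V, D.ex fun x => marg f (R x ∪ (P ∩ T x)) o := by
        rw [D.ex_add, D.ex_sum]; rfl
    _ ≤ _ := by
        gcongr with o
        exact hI.ex_marg_le hδ0 hδ1 f P o

/-! ### The two potential functions -/

variable {δ q θ Z κ : ℝ} {f : Finset (Fin n) → ℝ} {V : Finset (Fin n)}
  {alive : Finset (Fin n) → Fin n → Prop} {w : Finset (Fin n) → Fin n → ℝ}
  {J : Finset (Fin n) → Prop}

open PState

variable (D R T) in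
/-- The potential that controls the loss of value of `V` by selecting elements. -/
def lossPotential (δ q : ℝ) (f : Finset (Fin n) → ℝ) (V : Finset (Fin n)) (s : PState n) : ℝ :=
  meanVal D R T (fun S => f (S ∪ V)) s.G - q * δ * D.ex fun x => f (R x ∪ s.H ∪ V)

theorem stepIneq_lossPotential (hδ0 : 0 ≤ δ) (hq0 : 0 ≤ q) (hI : FilterIndep D R T δ)
    (hf : IsSubmodular f) : StepIneq alive w θ J q (lossPotential D R T δ q f V) := by
  intro s Y hInv hY _ _
  rw [← nsmul_eq_mul, ← Finset.sum_const]
  refine Finset.sum_le_sum fun a ha => ?_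
  simp only [lossPotential, step]
  by_cases hc : a ∈ s.cands alive w
  · have haH : a ∉ s.H := fun h => hY.fresh a ha (hInv.H_sub h)
    have := hI.insert_ge hδ0 (hf.union_right V) hInv.G_sub_H haH
    simp only [hc, if_true, and_true, Bool.false_eq_true, if_false]
    nlinarith
  · simp only [hc, and_false, if_false]
    linarith

variable {m : ℕ} {M : Fin m → Matroid (Fin n)}

open Classical in
/-- The subsets of `V` that can still be added. -/
def spare (M : Fin m → Matroid (Fin n)) (V : Finset (Fin n)) (s : PState n) :
    Finset (Finset (Fin n)) :=
  V.powerset.filter fun X => Disjoint X s.C ∧ IndepOver M s.P X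

theorem mem_spare {s : PState n} {X : Finset (Fin n)} :
    X ∈ spare M V s ↔ X ⊆ V ∧ Disjoint X s.C ∧ IndepOver M s.P X := by
  simp [spare]

theorem spare_nonempty (M : Fin m → Matroid (Fin n)) (V : Finset (Fin n)) (s : PState n) :
    (spare M V s).Nonempty :=
  ⟨∅, mem_spare.2 ⟨by simp, by simp, fun i => by simp⟩⟩

/-- The total positive weight of the elements of `V` outside `X`. -/
def charge (w : Finset (Fin n) → Fin n → ℝ) (V P X : Finset (Fin n)) : ℝ :=
  ∑ o ∈ V \ X, max 0 (w P o)

/-- The least charge for a subset of `V` that can still be added. -/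
def minCharge (M : Fin m → Matroid (Fin n)) (w : Finset (Fin n) → Fin n → ℝ)
    (V : Finset (Fin n)) (s : PState n) : ℝ :=
  (spare M V s).inf' (spare_nonempty M V s) (charge w V s.P)

theorem charge_mono_right (hw : ∀ ⦃P P' : Finset (Fin n)⦄ e, P ⊆ P' → w P' e ≤ w P e)
    {P P' : Finset (Fin n)} (h : P ⊆ P') (X : Finset (Fin n)) :
    charge w V P' X ≤ charge w V P X :=
  Finset.sum_le_sum fun o _ => max_le_max le_rfl (hw o h)

theorem charge_sdiff_le {P X X' : Finset (Fin n)} {c : ℝ}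
    (hc : ∀ o ∈ X, max 0 (w P o) ≤ c) (h : X' ⊆ X) :
    charge w V P (X \ X') ≤ charge w V P X + X'.card * c := by
  have hsub : V \ (X \ X') ⊆ (V \ X) ∪ X' := by
    intro e he
    simp only [Finset.mem_sdiff, Finset.mem_union] at he ⊢
    tauto
  calc charge w V P (X \ X') ≤ ∑ o ∈ (V \ X) ∪ X', max 0 (w P o) :=
        Finset.sum_le_sum_of_subset_of_nonneg hsub fun _ _ _ => le_max_left _ _
    _ ≤ charge w V P X + ∑ o ∈ X', max 0 (w P o) := by
        rw [charge, ← Finset.sum_union_inter]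
        exact le_add_of_nonneg_right (Finset.sum_nonneg fun _ _ => le_max_left _ _)
    _ ≤ charge w V P X + X'.card * c := by
        gcongr
        rw [← nsmul_eq_mul, ← Finset.sum_const]
        exact Finset.sum_le_sum fun o ho => hc o (h ho)

/-- The expected increase of the least charge in one step. -/
theorem minCharge_step_le (hw : ∀ ⦃P P' : Finset (Fin n)⦄ e, P ⊆ P' → w P' e ≤ w P e)
    {N : Fin m → Finset (Fin n)} (hE : ∀ i, (M i).E = (N i : Set (Fin n))) {p : ℕ}
    (hp : InAtMost p N) (halive : ∀ P e, alive P e ↔ ∀ i, e ∈ (M i).E → e ∉ (M i).closure P)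
    (hq0 : 0 ≤ q) (hq1 : q ≤ 1) (hκ1 : 1 ≤ κ) (hκp : q * p ≤ κ) {s : PState n} {c : ℝ}
    (hc0 : 0 ≤ c) (hc : ∀ e, e ∉ s.C → alive s.P e → w s.P e ≤ c) {a : Fin n} (ha : a ∉ s.C) :
    q * minCharge M w V (s.step alive w (a, true)) +
      (1 - q) * minCharge M w V (s.step alive w (a, false)) ≤ minCharge M w V s + κ * c := by
  obtain ⟨X, hX, hXeq⟩ := Finset.exists_mem_eq_inf' (spare_nonempty M V s) (charge w V s.P)
  obtain ⟨hXV, hXC, hXI⟩ := mem_spare.1 hX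
  have hXc : ∀ o ∈ X, max 0 (w s.P o) ≤ c := fun o ho =>
    max_le hc0 (hc o (Finset.disjoint_left.1 hXC ho)
      ((halive _ _).2 fun i hi => hXI.notMem_closure ho i hi))
  have hle : ∀ (s' : PState n) (X' : Finset (Fin n)), X' ∈ spare M V s' →
      minCharge M w V s' ≤ charge w V s'.P X' := fun s' X' h => Finset.inf'_le _ h
  rw [show minCharge M w V s = charge w V s.P X from hXeq]
  by_cases haX : a ∈ X
  · have hdis : Disjoint (X.erase a) (insert a s.C) := by
      rw [Finset.disjoint_left] at hXC ⊢
      intro e he h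
      rcases Finset.mem_insert.1 h with h | h
      · exact (Finset.mem_erase.1 he).1 h
      · exact hXC (Finset.mem_of_mem_erase he) h
    have hch : charge w V s.P (X.erase a) ≤ charge w V s.P X + c := by
      have := charge_sdiff_le (V := V) hXc (Finset.singleton_subset_iff.2 haX)
      rwa [Finset.sdiff_singleton_eq_erase, Finset.card_singleton, Nat.cast_one, one_mul] at this
    have h1 : minCharge M w V (s.step alive w (a, true)) ≤ charge w V s.P X + c := by
      refine (hle _ (X.erase a) (mem_spare.2 ⟨(Finset.erase_subset _ _).trans hXV, hdis, ?_⟩)).trans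
        ((charge_mono_right hw (P_sub_step _) _).trans hch)
      exact hXI.insert_erase haX
    have h2 : minCharge M w V (s.step alive w (a, false)) ≤ charge w V s.P X + c :=
      (hle (s.step alive w (a, false)) (X.erase a) (mem_spare.2
        ⟨(Finset.erase_subset _ _).trans hXV, hdis, hXI.subset (Finset.erase_subset _ _)⟩)).trans hch
    nlinarith [mul_le_mul_of_nonneg_left h1 hq0,
      mul_le_mul_of_nonneg_left h2 (sub_nonneg.2 hq1), mul_le_mul_of_nonneg_right hκ1 hc0]
  · have hdis : ∀ X' ⊆ X, Disjoint X' (insert a s.C) := by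
      intro X' hX'
      rw [Finset.disjoint_left] at hXC ⊢
      intro e he h
      rcases Finset.mem_insert.1 h with rfl | h
      · exact haX (hX' he)
      · exact hXC (hX' he) h
    obtain ⟨X', hcard, hX'⟩ := hXI.exists_insert hE hp a
    have h1 : minCharge M w V (s.step alive w (a, true)) ≤ charge w V s.P X + p * c := by
      refine (hle _ (X \ X') (mem_spare.2
        ⟨Finset.sdiff_subset.trans hXV, hdis _ Finset.sdiff_subset, hX'⟩)).trans
        ((charge_mono_right hw (P_sub_step _) _).trans ?_)
      rw [← Finset.sdiff_inter_self_left]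
      refine (charge_sdiff_le hXc Finset.inter_subset_left).trans ?_
      gcongr
      exact (Finset.card_le_card Finset.inter_subset_right).trans hcard
    have h2 : minCharge M w V (s.step alive w (a, false)) ≤ charge w V s.P X :=
      hle _ X (mem_spare.2 ⟨hXV, hdis X subset_rfl, hXI⟩)
    nlinarith [mul_le_mul_of_nonneg_left h1 hq0,
      mul_le_mul_of_nonneg_left h2 (sub_nonneg.2 hq1), mul_le_mul_of_nonneg_right hκp hc0]

variable (D R T) in
/-- The potential that controls the gain. -/
def gainPotential (M : Fin m → Matroid (Fin n)) (w : Finset (Fin n) → Fin n → ℝ)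
    (δ q K Z : ℝ) (f : Finset (Fin n) → ℝ) (V : Finset (Fin n)) (s : PState n) : ℝ :=
  K * (meanVal D R T f s.G / δ + Z * s.G.card) - minCharge M w V s
    - (meanVal D R T f s.P - Z * δ * s.P.card)
    + (meanVal D R T (fun S => f (S ∪ V)) s.P - q * δ * D.ex fun x => f (R x ∪ s.C ∪ V))

theorem stepIneq_gainPotential (hδ0 : 0 < δ) (hI : FilterIndep D R T δ)
    (hf : IsSubmodular f)
    (hw : ∀ ⦃P P' : Finset (Fin n)⦄ e, P ⊆ P' → w P' e ≤ w P e)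
    (hwZ : ∀ P e, |w P e - meanWt D R T f P e| ≤ Z)
    {N : Fin m → Finset (Fin n)} (hE : ∀ i, (M i).E = (N i : Set (Fin n))) {p : ℕ}
    (hp : InAtMost p N) (halive : ∀ P e, alive P e ↔ ∀ i, e ∈ (M i).E → e ∉ (M i).closure P)
    (hq0 : 0 < q) (hq1 : q ≤ 1) (hκ1 : 1 ≤ κ) (hκp : q * p ≤ κ) (hθ1 : θ < 1)
    {K : ℝ} (hK : K = (κ / q + δ) / (1 - θ) ^ 2) :
    StepIneq alive w θ J q (gainPotential D R T M w δ q K Z f V) := by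
  intro s Y hInv hY _ hcard
  have hθ' : 0 < 1 - θ := sub_pos.2 hθ1
  set c : ℝ := s.lam / (1 - θ) with hcdef
  have hc0 : 0 ≤ c := div_nonneg hInv.lam_nonneg hθ'.le
  have hK0 : 0 ≤ K := by rw [hK]; positivity
  have key : ∀ a ∈ Y, gainPotential D R T M w δ q K Z f V s +
      (q * K * s.lam * (if a ∈ s.cands alive w then 1 else 0) - (q * δ + κ) * c) ≤
      q * gainPotential D R T M w δ q K Z f V (s.step alive w (a, true)) +
      (1 - q) * gainPotential D R T M w δ q K Z f V (s.step alive w (a, false)) := by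
    intro a ha
    have haC := hY.fresh a ha
    have haP : a ∉ s.P := fun h => haC (hInv.P_sub h)
    have haG : a ∉ s.G := fun h => haP (hInv.G_sub h)
    have e1 := minCharge_step_le (V := V) hw hE hp halive hq0.le hq1 hκ1 hκp hc0 hInv.bound haC
    have e2 : meanVal D R T f (insert a s.P) - Z * δ * (insert a s.P).card ≤
        meanVal D R T f s.P - Z * δ * s.P.card + δ * c := by
      rw [hI.insert_eq f haP, Finset.card_insert_of_notMem haP]
      push_cast
      have h1 := (abs_le.1 (hwZ s.P a)).1
      have h2 := hY.bound a ha
      nlinarith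
    have e3 := hI.insert_ge hδ0.le (hf.union_right V) hInv.P_sub haC
    have e4 : a ∈ s.cands alive w → meanVal D R T f s.G / δ + Z * s.G.card + s.lam ≤
        meanVal D R T f (insert a s.G) / δ + Z * (insert a s.G).card := by
      intro hc
      rw [hI.insert_eq f haG, Finset.card_insert_of_notMem haG, add_div,
        mul_div_cancel_left₀ _ hδ0.ne']
      push_cast
      have h1 := (abs_le.1 (hwZ s.P a)).2
      have h2 := (mem_cands.1 hc).2
      have h3 := meanWt_anti (D := D) (R := R) (T := T) hf hInv.G_sub a
      linarith
    have e3' := mul_le_mul_of_nonneg_left e3 hq0.le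
    have e2' := mul_le_mul_of_nonneg_left e2 hq0.le
    by_cases hc : a ∈ s.cands alive w
    · have e4' := mul_le_mul_of_nonneg_left (e4 hc) (mul_nonneg hq0.le hK0)
      simp only [gainPotential, step, hc, and_true, if_true, Bool.false_eq_true, if_false] at e1 ⊢
      linarith
    · simp only [gainPotential, step, hc, and_false, if_true, Bool.false_eq_true, if_false] at e1 ⊢
      linarith
  refine le_trans ?_ (Finset.sum_le_sum key)
  rw [Finset.sum_add_distrib, Finset.sum_const, nsmul_eq_mul, Finset.sum_sub_distrib,
    ← Finset.mul_sum, Finset.sum_const, nsmul_eq_mul, Finset.sum_ite_mem,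
    Finset.inter_eq_right.2 hY.cands_sub, Finset.sum_const, nsmul_eq_mul, mul_one]
  have hfin : (Y.card : ℝ) * ((q * δ + κ) * c) ≤
      q * K * s.lam * (s.cands alive w).card := by
    have h1 : q * K * s.lam * ((1 - θ) * Y.card) ≤ q * K * s.lam * (s.cands alive w).card :=
      mul_le_mul_of_nonneg_left hcard
        (mul_nonneg (mul_nonneg hq0.le hK0) hInv.lam_nonneg)
    refine le_trans (le_of_eq ?_) h1
    rw [hK, hcdef]
    field_simp
    ring
  linarith

/-- The value of the selected set and the value that it leaves over `V`, in expectation. -/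
theorem le_ev_loop_meanVal {Q : Type} {A : Sampler n Q} {O : Q → ℝ}
    (hδ0 : 0 < δ) (hδ1 : δ ≤ 1) (hI : FilterIndep D R T δ) (hf : IsSubmodular f)
    (hf0 : ∀ S, 0 ≤ f S)
    (hw : ∀ ⦃P P' : Finset (Fin n)⦄ e, P ⊆ P' → A.w O P' e ≤ A.w O P e)
    (hwZ : ∀ P e, |A.w O P e - meanWt D R T f P e| ≤ Z)
    {N : Fin m → Finset (Fin n)} (hE : ∀ i, (M i).E = (N i : Set (Fin n))) {p : ℕ}
    (hp : InAtMost p N)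
    (halive : ∀ P e, A.alive O P e ↔ ∀ i, e ∈ (M i).E → e ∉ (M i).closure P)
    (hq0 : 0 < A.q) (hκ1 : 1 ≤ κ) (hκp : A.q * p ≤ κ) (hθ0 : 0 ≤ A.θ) (hθ1 : A.θ < 1)
    {K : ℝ} (hK : K = (κ / A.q + δ) / (1 - A.θ) ^ 2) {L Tt : ℕ}
    (hL : (1 - A.θ) ^ L * n < 1) (hL1 : 1 ≤ L) {lam0 : ℝ} (hlam0 : 0 ≤ lam0)
    (hbound : ∀ e, A.w O ∅ e ≤ lam0) (hV : MatchoidIndep M V) :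
    (A.loop (min n (L * (Tt + 2))) ⟨∅, ∅, ∅, ∅, lam0⟩).Ensures O
        (fun s => MatchoidIndep M s.G) ∧
    (D.ex fun x => f (R x)) + δ / K * ((1 - A.q * δ) * (D.ex fun x => f (R x ∪ V)) -
        (D.ex fun x => f (R x)) - (K * Z * n + 2 * n * Z + n * ((1 - A.θ) ^ Tt * lam0))) ≤
      (A.loop (min n (L * (Tt + 2))) ⟨∅, ∅, ∅, ∅, lam0⟩).ev O (fun s => meanVal D R T f s.G) ∧
    (1 - A.q * δ) * (D.ex fun x => f (R x ∪ V)) ≤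
      (A.loop (min n (L * (Tt + 2))) ⟨∅, ∅, ∅, ∅, lam0⟩).ev O
        (fun s => meanVal D R T (fun S => f (S ∪ V)) s.G) := by
  have hθ' : 0 < 1 - A.θ := sub_pos.2 hθ1
  have hK0 : 0 < K := by rw [hK]; positivity
  have hS : Setup (A.alive O) (A.w O) (MatchoidIndep M) :=
    { alive_anti := fun P P' e h ha => (halive P e).2 fun i hi hcl =>
        (halive P' e).1 ha i hi ((M i).closure_subset_closure (Finset.coe_subset.2 h) hcl)
      w_anti := hw
      J_insert := fun P G e hG ha hJ => hJ.insert hG ((halive P e).1 ha) }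
  set s0 : PState n := ⟨∅, ∅, ∅, ∅, lam0⟩ with hs0
  have hInv : s0.Inv (A.alive O) (A.w O) A.θ (MatchoidIndep M) :=
    { G_sub := subset_rfl
      P_sub := subset_rfl
      G_sub_H := subset_rfl
      H_sub := subset_rfl
      good := fun i => by simp [hs0]
      lam_nonneg := hlam0
      bound := fun e _ _ => (hbound e).trans (by
        rw [le_div_iff₀ hθ']
        exact mul_le_of_le_one_right hlam0 (by linarith)) }
  have hens := Sampler.ensures_loop_init hS hθ0 hθ1 hL hL1 hlam0 Tt hInv
  rw [← hs0] at hens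
  have hZ0 : ∀ e : Fin n, 0 ≤ Z := fun e => (abs_nonneg _).trans (hwZ ∅ e)
  have hnZ : 0 ≤ (n : ℝ) * Z := by
    rcases Nat.eq_zero_or_pos n with h | h
    · simp [h]
    · exact mul_nonneg (Nat.cast_nonneg _) (hZ0 ⟨0, h⟩)
  have hcardZ : ∀ S : Finset (Fin n), Z * S.card ≤ n * Z := by
    intro S
    rcases S.eq_empty_or_nonempty with rfl | ⟨e, -⟩
    · simpa using hnZ
    · rw [mul_comm]
      refine mul_le_mul_of_nonneg_right ?_ (hZ0 e)
      have := Finset.card_le_univ S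
      rw [Fintype.card_fin] at this
      exact_mod_cast this
  have hcard : ∀ S : Finset (Fin n), (S.card : ℝ) ≤ n := fun S => by
    have := Finset.card_le_univ S
    rw [Fintype.card_fin] at this
    exact_mod_cast this
  set B : ℝ := (1 - A.θ) ^ Tt * lam0 with hBdef
  have hB0 : 0 ≤ B := by positivity
  have hmean0 : ∀ g : Finset (Fin n) → ℝ, meanVal D R T g ∅ = D.ex fun x => g (R x) := by
    intro g; simp [meanVal]
  have hqδ : 0 ≤ A.q * δ := mul_nonneg hq0.le hδ0.le
  refine ⟨hens.mono fun s hs => hs.1.good, ?_, ?_⟩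
  · have h1 := Sampler.le_ev_loop hS hθ0 hθ1 (stepIneq_gainPotential (V := V) hδ0 hI hf hw hwZ hE hp
      halive hq0 A.q_le_one hκ1 hκp hθ1 hK) (fun _ _ => rfl) (min n (L * (Tt + 2))) s0 hInv
    have h2 : (A.loop (min n (L * (Tt + 2))) s0).ev O
        (gainPotential D R T M (A.w O) δ A.q K Z f V) ≤
        (A.loop (min n (L * (Tt + 2))) s0).ev O fun s =>
          K / δ * meanVal D R T f s.G + (K * Z * n + 2 * n * Z + n * B) := by
      refine AdaptiveAlg.ev_mono hens fun s hs => ?_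
      obtain ⟨hsI, hsB⟩ := hs
      obtain ⟨X, hX, hXeq⟩ := Finset.exists_mem_eq_inf' (spare_nonempty M V s)
        (charge (A.w O) V s.P)
      obtain ⟨hXV, hXC, hXI⟩ := mem_spare.1 hX
      have e1 : meanVal D R T (fun S => f (S ∪ V)) s.P ≤ meanVal D R T f s.P +
          (minCharge M (A.w O) V s + n * B + n * Z) := by
        refine (hI.meanVal_union_le hδ0.le hδ1 hf s.P V).trans ?_
        gcongr
        calc ∑ o ∈ V, max 0 (meanWt D R T f s.P o)
            ≤ ∑ o ∈ V, (max 0 (A.w O s.P o) + Z) := by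
              refine Finset.sum_le_sum fun o _ => max_le ?_ ?_
              · exact add_nonneg (le_max_left _ _) (hZ0 o)
              · have := (abs_le.1 (hwZ s.P o)).1
                linarith [le_max_right 0 (A.w O s.P o)]
          _ = (∑ o ∈ V \ X, max 0 (A.w O s.P o)) + (∑ o ∈ X, max 0 (A.w O s.P o)) +
                Z * V.card := by
              rw [Finset.sum_add_distrib, Finset.sum_sdiff hXV, Finset.sum_const, nsmul_eq_mul]
              ring
          _ ≤ minCharge M (A.w O) V s + n * B + n * Z := by
              refine add_le_add (add_le_add (le_of_eq hXeq.symm) ?_) (hcardZ V)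
              refine le_trans (Finset.sum_le_sum (g := fun _ => B) fun o ho => max_le hB0 ?_) ?_
              · exact hsB o (Finset.disjoint_left.1 hXC ho)
                  ((halive _ _).2 fun i hi => hXI.notMem_closure ho i hi)
              · rw [Finset.sum_const, nsmul_eq_mul]
                exact mul_le_mul_of_nonneg_right (hcard X) hB0
      have e2 : 0 ≤ A.q * δ * D.ex fun x => f (R x ∪ s.C ∪ V) :=
        mul_nonneg hqδ (D.ex_nonneg fun x => hf0 _)
      have e3 : K * (Z * s.G.card) ≤ K * (n * Z) :=
        mul_le_mul_of_nonneg_left (hcardZ s.G) hK0.le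
      have e4 : Z * δ * s.P.card ≤ n * Z := by
        have := mul_le_mul_of_nonneg_left (hcardZ s.P) hδ0.le
        nlinarith
      rw [gainPotential]
      have e5 : K * (meanVal D R T f s.G / δ + Z * s.G.card) =
          K / δ * meanVal D R T f s.G + K * (Z * s.G.card) := by ring
      rw [e5]
      linarith
    rw [AdaptiveAlg.ev_add _ _ hens, AdaptiveAlg.ev_mul, AdaptiveAlg.ev_const] at h2
    have h3 : gainPotential D R T M (A.w O) δ A.q K Z f V s0 ≥ K / δ * (D.ex fun x => f (R x))
        - (D.ex fun x => f (R x)) + (1 - A.q * δ) * (D.ex fun x => f (R x ∪ V)) := by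
      have hm : minCharge M (A.w O) V s0 ≤ 0 := by
        refine (Finset.inf'_le _ (mem_spare.2
          ⟨subset_rfl, by simp [hs0], hV.indepOver_empty⟩ : V ∈ spare M V s0)).trans ?_
        simp [charge]
      simp only [gainPotential, hs0, hmean0, Finset.card_empty, Nat.cast_zero, mul_zero, add_zero,
        sub_zero, Finset.union_empty] at hm ⊢
      rw [ge_iff_le, mul_div_assoc', div_mul_eq_mul_div]
      linarith
    have h4 := h3.trans (h1.trans h2)
    set E := (A.loop (min n (L * (Tt + 2))) s0).ev O fun s => meanVal D R T f s.G
    have h5 : δ / K * (K / δ * E) = E := by field_simp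
    have h6 : δ / K * (K / δ * D.ex fun x => f (R x)) = D.ex fun x => f (R x) := by field_simp
    have h7 := mul_le_mul_of_nonneg_left h4 (div_pos hδ0 hK0).le
    nlinarith
  · have h1 := Sampler.le_ev_loop hS hθ0 hθ1 (stepIneq_lossPotential (V := V) hδ0.le hq0.le hI hf)
      (fun _ _ => rfl) (min n (L * (Tt + 2))) s0 hInv
    have h2 : lossPotential D R T δ A.q f V s0 =
        (1 - A.q * δ) * (D.ex fun x => f (R x ∪ V)) := by
      simp only [lossPotential, hs0, hmean0, Finset.union_empty]
      ring
    rw [h2] at h1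
    refine h1.trans (AdaptiveAlg.ev_mono hens fun s _ => ?_)
    rw [lossPotential, sub_le_self_iff]
    exact mul_nonneg hqδ (D.ex_nonneg fun x => hf0 _)

end Stage
end

noncomputable section

variable {n m ℓ : ℕ}

/-! ### One stage -/

/-- The elements that pass the `k`-th filter. -/
def filterSet (k : Fin ℓ) (x : Fin ℓ × Fin n → Bool) : Finset (Fin n) :=
  Finset.univ.filter fun e => x (k, e) = true

/-- The union of the thinned sets. -/
def thinUnion (I : Fin ℓ → Finset (Fin n)) (x : Fin ℓ × Fin n → Bool) : Finset (Fin n) :=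
  Finset.univ.biUnion (thin x I)

theorem mem_thinUnion {I : Fin ℓ → Finset (Fin n)} {x : Fin ℓ × Fin n → Bool} {e : Fin n} :
    e ∈ thinUnion I x ↔ ∃ k, e ∈ I k ∧ x (k, e) = true := by
  simp [thinUnion, thin]

theorem thinUnion_empty (x : Fin ℓ × Fin n → Bool) : thinUnion (fun _ => ∅) x = ∅ := by
  ext e
  simp [mem_thinUnion]

theorem thinUnion_update {I : Fin ℓ → Finset (Fin n)} {k : Fin ℓ} (hk : I k = ∅)
    (P : Finset (Fin n)) (x : Fin ℓ × Fin n → Bool) :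
    thinUnion (Function.update I k P) x = thinUnion I x ∪ (P ∩ filterSet k x) := by
  ext e
  simp only [mem_thinUnion, Finset.mem_union, Finset.mem_inter, filterSet, Finset.mem_filter,
    Finset.mem_univ, true_and]
  constructor
  · rintro ⟨j, hj, hx⟩
    by_cases h : j = k
    · subst h
      rw [Function.update_self] at hj
      exact Or.inr ⟨hj, hx⟩
    · rw [Function.update_of_ne h] at hj
      exact Or.inl ⟨j, hj, hx⟩
  · rintro (⟨j, hj, hx⟩ | ⟨hj, hx⟩)
    · refine ⟨j, ?_, hx⟩
      rw [Function.update_of_ne]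
      · exact hj
      · rintro rfl
        simp [hk] at hj
    · exact ⟨k, by rwa [Function.update_self], hx⟩

/-- The distribution of the filters. -/
def filterDist (n ℓ : ℕ) (δ : ℝ) (h0 : 0 ≤ δ) (h1 : δ ≤ 1) : FinDist (Fin ℓ × Fin n → Bool) :=
  (FinDist.coin δ h0 h1).pi (Fin ℓ × Fin n)

theorem filterIndep_filterDist {δ : ℝ} (h0 : 0 ≤ δ) (h1 : δ ≤ 1) {I : Fin ℓ → Finset (Fin n)}
    {k : Fin ℓ} (hk : I k = ∅) :
    FilterIndep (filterDist n ℓ δ h0 h1) (thinUnion I) (filterSet k) δ := by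
  intro g P u hu
  have hR : ∀ x b, thinUnion I (Function.update x (k, u) b) = thinUnion I x := by
    intro x b
    ext e
    simp only [mem_thinUnion]
    refine exists_congr fun j => and_congr_right fun hj => ?_
    rw [Function.update_of_ne]
    rintro h
    rw [Prod.mk.injEq] at h
    rw [h.1, hk] at hj
    simp at hj
  have hT : ∀ x b, insert u P ∩ filterSet k (Function.update x (k, u) b) =
      if b then insert u (P ∩ filterSet k x) else P ∩ filterSet k x := by
    intro x b
    ext e
    by_cases he : e = u
    · subst he
      cases b <;> simp [filterSet, hu]
    · cases b <;> simp [filterSet, he]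
  rw [meanVal, filterDist, ← FinDist.ex_pi_update _ (k, u)]
  simp only [FinDist.ex_coin, hR, hT, if_true, Bool.false_eq_true, if_false]
  rw [meanVal, ← FinDist.ex_mul, ← FinDist.ex_add]
  congr 1
  funext x
  rw [Finset.union_insert, marg]
  ring

/-- The value oracle, restricted to subsets of `E`. -/
def oracleVal (O : MatchoidQuery n m → ℝ) (E S : Finset (Fin n)) : ℝ := O (.inl (S ∩ E))

open Classical in
/-- The queries about a set `P` in one stage. -/
def stageQs {Nn : ℕ} (E : Finset (Fin n)) (I : Fin ℓ → Finset (Fin n)) (k : Fin ℓ)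
    (xs : Fin Nn → Fin ℓ × Fin n → Bool) (P : Finset (Fin n)) : Finset (MatchoidQuery n m) :=
  (((Finset.univ : Finset (Fin Nn × Fin n)).image fun y =>
      .inl ((insert y.2 (thinUnion I (xs y.1) ∪ (P.erase y.2 ∩ filterSet k (xs y.1)))) ∩ E)) ∪
    ((Finset.univ : Finset (Fin Nn × Fin n)).image fun y =>
      .inl ((thinUnion I (xs y.1) ∪ (P.erase y.2 ∩ filterSet k (xs y.1))) ∩ E))) ∪
  (((Finset.univ : Finset (Fin m)).image fun i => .inr (i, P)) ∪
    ((Finset.univ : Finset (Fin m × Fin n)).image fun y => .inr (y.1, insert y.2 P)))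

theorem card_stageQs_le {Nn : ℕ} (E : Finset (Fin n)) (I : Fin ℓ → Finset (Fin n)) (k : Fin ℓ)
    (xs : Fin Nn → Fin ℓ × Fin n → Bool) (P : Finset (Fin n)) :
    (stageQs (m := m) E I k xs P).card ≤ 2 * (Nn * n) + (m + m * n) := by
  classical
  have h1 : ∀ g : Fin Nn × Fin n → MatchoidQuery n m,
      ((Finset.univ : Finset (Fin Nn × Fin n)).image g).card ≤ Nn * n := fun g =>
    Finset.card_image_le.trans (by simp)
  have h2 : ∀ g : Fin m × Fin n → MatchoidQuery n m,
      ((Finset.univ : Finset (Fin m × Fin n)).image g).card ≤ m * n := fun g =>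
    Finset.card_image_le.trans (by simp)
  have h3 : ∀ g : Fin m → MatchoidQuery n m,
      ((Finset.univ : Finset (Fin m)).image g).card ≤ m := fun g =>
    Finset.card_image_le.trans (by simp)
  rw [stageQs]
  refine (Finset.card_union_le _ _).trans (Nat.add_le_add
    ((Finset.card_union_le _ _).trans ((Nat.add_le_add (h1 _) (h1 _)).trans (by omega)))
    ((Finset.card_union_le _ _).trans (Nat.add_le_add (h3 _) (h2 _))))

/-- The sampler of one stage: weights are empirical means over the samples `xs`. -/
def stageSampler (Ns : Fin m → Finset (Fin n)) (q θ : ℝ) (hq0 : 0 ≤ q) (hq1 : q ≤ 1)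
    {Nn : ℕ} (E : Finset (Fin n)) (I : Fin ℓ → Finset (Fin n)) (k : Fin ℓ)
    (xs : Fin Nn → Fin ℓ × Fin n → Bool) : Sampler n (MatchoidQuery n m) where
  alive O P e := Unblocked Ns O P e
  w O P e := (∑ i, sampleWt (thinUnion I) (filterSet k) (oracleVal O E) P e (xs i)) / Nn
  qs := stageQs E I k xs
  congr O O' P h := by
    classical
    simp only [stageQs, Finset.mem_union, Finset.mem_image, Finset.mem_univ, true_and] at h
    constructor
    · funext e
      simp only [Unblocked]
      refine propext (forall_congr' fun i => ?_)
      rw [h _ (Or.inr (Or.inl ⟨i, rfl⟩)), h _ (Or.inr (Or.inr ⟨(i, e), rfl⟩))]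
    · funext e
      congr 1
      refine Finset.sum_congr rfl fun i _ => ?_
      simp only [sampleWt, marg, oracleVal]
      rw [h _ (Or.inl (Or.inl ⟨(i, e), rfl⟩)), h _ (Or.inl (Or.inr ⟨(i, e), rfl⟩))]
  θ := θ
  q := q
  q_nonneg := hq0
  q_le_one := hq1

/-- The parameters of the algorithm. -/
structure Params (n m ℓ : ℕ) where
  Ns : Fin m → Finset (Fin n)
  q : ℝ
  θ : ℝ
  δ : ℝ
  q_pos : 0 < q
  q_le_one : q ≤ 1
  δ_pos : 0 < δ
  δ_le_one : δ ≤ 1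
  samples : ℕ
  iters : ℕ

namespace Params

variable (p : Params n m ℓ)

/-- The distribution of one sample. -/
def dist : FinDist (Fin ℓ × Fin n → Bool) := filterDist n ℓ p.δ p.δ_pos.le p.δ_le_one

/-- Stage `k`: compute the `k`-th set. -/
def stage (E : Finset (Fin n)) (lam0 : ℝ) (k : Fin ℓ) (I : Fin ℓ → Finset (Fin n)) :
    AdaptiveAlg (MatchoidQuery n m) (Fin ℓ → Finset (Fin n)) :=
  (p.dist.pi (Fin p.samples)).draw fun xs =>
    ((stageSampler p.Ns p.q p.θ p.q_pos.le p.q_le_one E I k xs).loop p.iters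
      ⟨∅, ∅, ∅, ∅, lam0⟩).bind fun s => .output (Function.update I k s.G)

/-- The first `k` stages. -/
def stages (E : Finset (Fin n)) (lam0 : ℝ) :
    ℕ → AdaptiveAlg (MatchoidQuery n m) (Fin ℓ → Finset (Fin n))
  | 0 => .output fun _ => ∅
  | k + 1 => (stages E lam0 k).bind fun I =>
      if h : k < ℓ then p.stage E lam0 ⟨k, h⟩ I else .output I

open Classical in
/-- The elements that are independent as singletons, and the sum of their values. -/
def initData (O : MatchoidQuery n m → ℝ) : Finset (Fin n) × ℝ :=
  (Finset.univ.filter fun e => Unblocked p.Ns O ∅ e,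
    ∑ e ∈ Finset.univ.filter fun e => Unblocked p.Ns O ∅ e, O (.inl {e}))

open Classical in
/-- The queries of the first round. -/
def initQs (n m : ℕ) : Finset (MatchoidQuery n m) :=
  ((Finset.univ : Finset (Fin n)).image fun e => .inl {e}) ∪
    (((Finset.univ : Finset (Fin m)).image fun i => .inr (i, ∅)) ∪
      ((Finset.univ : Finset (Fin m × Fin n)).image fun y => .inr (y.1, insert y.2 ∅)))

theorem card_initQs_le : (initQs n m).card ≤ n + (m + m * n) := by
  classical
  rw [initQs]
  refine (Finset.card_union_le _ _).trans (Nat.add_le_add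
    (Finset.card_image_le.trans (by simp)) ((Finset.card_union_le _ _).trans (Nat.add_le_add
      (Finset.card_image_le.trans (by simp)) (Finset.card_image_le.trans (by simp)))))

open Classical in
theorem local_initData : AdaptiveAlg.LocalOn (initQs n m) p.initData := by
  intro O O' h
  simp only [initQs, Finset.mem_union, Finset.mem_image, Finset.mem_univ, true_and] at h
  have h1 : ∀ e, Unblocked p.Ns O ∅ e ↔ Unblocked p.Ns O' ∅ e := by
    intro e
    simp only [Unblocked]
    refine forall_congr' fun i => ?_
    rw [h _ (Or.inr (Or.inl ⟨i, rfl⟩)), h _ (Or.inr (Or.inr ⟨(i, e), rfl⟩))]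
  have h2 : ∀ e : Fin n, O (.inl {e}) = O' (.inl {e}) := fun e => h _ (Or.inl ⟨e, rfl⟩)
  have h3 : (Finset.univ.filter fun e => Unblocked p.Ns O ∅ e) =
      Finset.univ.filter fun e => Unblocked p.Ns O' ∅ e := by
    ext e
    simp only [Finset.mem_filter, h1]
  rw [initData, initData, h3]
  simp only [h2]

/-- The whole algorithm. -/
def alg : AdaptiveAlg (MatchoidQuery n m) (Fin ℓ → Finset (Fin n)) :=
  (AdaptiveAlg.ask (initQs n m) p.initData).bind fun y => p.stages y.1 y.2 ℓ

theorem within_stage (E : Finset (Fin n)) (lam0 : ℝ) (k : Fin ℓ) (I : Fin ℓ → Finset (Fin n)) :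
    (p.stage E lam0 k I).Within (fun _ => True) (2 * p.iters)
      (p.iters * ((n + 2) * (2 * (p.samples * n) + (m + m * n)))) := by
  refine FinDist.within_draw _ fun xs => ?_
  refine ((Sampler.within_loop _ (fun P => card_stageQs_le E I k xs P) p.iters
    ⟨∅, ∅, ∅, ∅, lam0⟩).bind (R' := 0) (K' := 0) fun s _ => ?_)
  exact trivial

theorem within_stages (E : Finset (Fin n)) (lam0 : ℝ) (k : ℕ) :
    (p.stages E lam0 k).Within (fun _ => True) (k * (2 * p.iters))
      (k * (p.iters * ((n + 2) * (2 * (p.samples * n) + (m + m * n))))) := by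
  induction k with
  | zero => exact trivial
  | succ k ih =>
    refine (ih.bind (s := fun _ => True) (R' := 2 * p.iters)
      (K' := p.iters * ((n + 2) * (2 * (p.samples * n) + (m + m * n)))) fun I _ => ?_).mono
      (fun _ h => h) (le_of_eq (by ring)) (le_of_eq (by ring))
    split_ifs with h
    · exact p.within_stage E lam0 _ I
    · exact trivial

theorem within_alg : p.alg.Within (fun _ => True) (1 + ℓ * (2 * p.iters))
    (n + (m + m * n) +
      ℓ * (p.iters * ((n + 2) * (2 * (p.samples * n) + (m + m * n))))) :=
  (AdaptiveAlg.within_ask _ _ card_initQs_le).bind fun y _ => p.within_stages y.1 y.2 ℓ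

/-! ### Analysis -/

/-- The expected value of the union of the thinned sets. -/
def val (f : Finset (Fin n) → ℝ) (I : Fin ℓ → Finset (Fin n)) : ℝ :=
  p.dist.ex fun x => f (thinUnion I x)

/-- Everything that the analysis of a stage needs to know about the instance: `g` is the
function, restricted to the elements that are independent as singletons. -/
structure Instance (M : Fin m → Matroid (Fin n)) (O : MatchoidQuery n m → ℝ)
    (E : Finset (Fin n)) (lam0 opt : ℝ) (g : Finset (Fin n) → ℝ) (V : Finset (Fin n)) : Prop where
  hE : ∀ i, (M i).E = (p.Ns i : Set (Fin n))
  unblocked : ∀ P e, Unblocked p.Ns O P e ↔ ∀ i, e ∈ (M i).E → e ∉ (M i).closure P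
  g_eq : oracleVal O E = g
  submod : IsSubmodular g
  nonneg : ∀ S, 0 ≤ g S
  empty : g ∅ = 0
  single_le : ∀ e, g {e} ≤ lam0
  single_le_opt : ∀ e, g {e} ≤ opt
  lam0_le : lam0 ≤ n * opt
  opt_nonneg : 0 ≤ opt
  indep : MatchoidIndep M V
  val_opt : g V = opt

variable {p} {M : Fin m → Matroid (Fin n)} {O : MatchoidQuery n m → ℝ} {E : Finset (Fin n)}
  {lam0 opt : ℝ} {g : Finset (Fin n) → ℝ} {V : Finset (Fin n)}

theorem Instance.abs_marg_le (h : p.Instance M O E lam0 opt g V) (S : Finset (Fin n))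
    (u : Fin n) : |marg g S u| ≤ n * opt := by
  have hle : ∀ S : Finset (Fin n), g S ≤ n * opt := by
    intro S
    have h1 := h.submod.le_add_sum_marg ∅ S
    rw [Finset.empty_union, h.empty, zero_add] at h1
    refine h1.trans ((Finset.sum_le_sum (g := fun _ => opt) fun e _ => ?_).trans ?_)
    · have := h.single_le_opt e
      simpa [marg, h.empty] using this
    · rw [Finset.sum_const, nsmul_eq_mul]
      refine mul_le_mul_of_nonneg_right ?_ h.opt_nonneg
      have := Finset.card_le_univ S
      rw [Fintype.card_fin] at this
      exact_mod_cast this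
  rw [abs_le, marg]
  constructor <;> linarith [hle S, hle (insert u S), h.nonneg S, h.nonneg (insert u S)]

/-- The numerical conditions on the parameters. -/
structure Good (p : Params n m ℓ) (pp : ℕ) (κ σ K : ℝ) (L Tt : ℕ) : Prop where
  n_pos : 1 ≤ n
  inAtMost : InAtMost pp p.Ns
  κ_one : 1 ≤ κ
  κ_p : p.q * pp ≤ κ
  θ_nonneg : 0 ≤ p.θ
  θ_lt : p.θ < 1
  K_eq : K = (κ / p.q + p.δ) / (1 - p.θ) ^ 2
  L_pow : (1 - p.θ) ^ L * n < 1
  L_pos : 1 ≤ L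
  iters_eq : p.iters = min n (L * (Tt + 2))
  σ_pos : 0 < σ
  σ_le : σ ≤ 1
  samples_pos : 0 < p.samples
  samples_ge : 16 * Real.log (2 * Fintype.card (Finset (Fin n) × Fin n)) ≤ σ ^ 2 * p.samples

variable {pp : ℕ} {κ σ K : ℝ} {L Tt : ℕ}

theorem Good.K_pos (hp : p.Good pp κ σ K L Tt) : 0 < K := by
  have := sub_pos.2 hp.θ_lt
  have := p.q_pos
  have := p.δ_pos
  have := hp.κ_one
  rw [hp.K_eq]
  positivity

/-- The error of one stage. -/
def err (p : Params n m ℓ) (σ K : ℝ) (Tt : ℕ) (lam0 opt : ℝ) : ℝ :=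
  (K * n + 2 * n) * (σ * (n * opt)) + n * ((1 - p.θ) ^ Tt * lam0)

theorem Instance.stage_spec (h : p.Instance M O E lam0 opt g V) (hp : p.Good pp κ σ K L Tt)
    (k : Fin ℓ) (I : Fin ℓ → Finset (Fin n)) (hk : I k = ∅) :
    (p.stage E lam0 k I).Ensures O
      (fun I' => ∃ G, MatchoidIndep M G ∧ I' = Function.update I k G) ∧
    (0 < opt → p.val g I + p.δ / K * ((1 - p.q * p.δ) * p.val (fun S => g (S ∪ V)) I - p.val g I -
        err p σ K Tt lam0 opt) ≤ (p.stage E lam0 k I).ev O (p.val g)) ∧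
    (1 - p.q * p.δ) * p.val (fun S => g (S ∪ V)) I ≤
      (p.stage E lam0 k I).ev O (p.val fun S => g (S ∪ V)) := by
  have hind : FilterIndep p.dist (thinUnion I) (filterSet k) p.δ :=
    filterIndep_filterDist p.δ_pos.le p.δ_le_one hk
  have hn : (0 : ℝ) < n := by exact_mod_cast hp.n_pos
  have : Nonempty (Fin n) := ⟨⟨0, hp.n_pos⟩⟩
  have hlam0 : 0 ≤ lam0 := (h.nonneg _).trans (h.single_le ⟨0, hp.n_pos⟩)
  have hN : (0 : ℝ) < p.samples := by exact_mod_cast hp.samples_pos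
  let wt : Finset (Fin n) × Fin n → (Fin ℓ × Fin n → Bool) → ℝ := fun y =>
    sampleWt (thinUnion I) (filterSet k) g y.1 y.2
  let Zf : (Fin p.samples → Fin ℓ × Fin n → Bool) → ℝ := fun xs =>
    Finset.univ.sup' Finset.univ_nonempty
      fun y => |(∑ i, wt y (xs i)) / p.samples - p.dist.ex (wt y)|
  have hZ : 0 < opt → (p.dist.pi (Fin p.samples)).ex Zf ≤ σ * (n * opt) := fun hopt =>
    p.dist.ex_sup_dev_le wt (mul_pos hn hopt) (fun y x => h.abs_marg_le _ _) hp.σ_pos hp.σ_le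
      hp.samples_pos hp.samples_ge
  have hval : ∀ (g' : Finset (Fin n) → ℝ) (P : Finset (Fin n)),
      p.val g' (Function.update I k P) = meanVal p.dist (thinUnion I) (filterSet k) g' P := by
    intro g' P
    simp only [val, meanVal, thinUnion_update hk]
  have hloop : ∀ xs, _ := fun xs => le_ev_loop_meanVal (D := p.dist) (R := thinUnion I)
    (T := filterSet k) (f := g) (V := V) (M := M) (Z := Zf xs) (O := O) (κ := κ) (K := K)
    (L := L) (Tt := Tt) (lam0 := lam0) (p := pp) (N := p.Ns)
    (A := stageSampler p.Ns p.q p.θ p.q_pos.le p.q_le_one E I k xs) (δ := p.δ)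
    p.δ_pos p.δ_le_one hind h.submod h.nonneg
    (by
      intro P P' e hPP'
      simp only [stageSampler, h.g_eq]
      gcongr with i
      exact sampleWt_anti h.submod hPP' e (xs i))
    (by
      intro P e
      simp only [stageSampler, h.g_eq]
      exact Finset.le_sup' (fun y => |(∑ i, wt y (xs i)) / p.samples - p.dist.ex (wt y)|)
        (Finset.mem_univ (P, e)))
    h.hE hp.inAtMost h.unblocked p.q_pos hp.κ_one hp.κ_p hp.θ_nonneg hp.θ_lt hp.K_eq
    hp.L_pow hp.L_pos hlam0
    (by
      intro e
      simp only [stageSampler, h.g_eq]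
      rw [div_le_iff₀ hN, mul_comm]
      refine (Finset.sum_le_sum (g := fun _ => lam0) fun i _ => ?_).trans (by simp)
      rw [sampleWt]
      set S := thinUnion I (xs i) ∪ (Finset.erase ∅ e ∩ filterSet k (xs i))
      by_cases he : e ∈ S
      · rw [marg_of_mem g he]
        exact hlam0
      · refine (h.submod.marg_anti (Finset.empty_subset S) fun h => absurd h he).trans ?_
        simpa [marg, h.empty] using h.single_le e)
    h.indep
  refine ⟨FinDist.ensures_draw _ fun xs _ => ?_, fun hopt => ?_, ?_⟩
  · have h1 := (hloop xs).1
    rw [← hp.iters_eq] at h1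
    exact h1.bind fun s hs => ⟨s.G, hs, rfl⟩
  · rw [stage, FinDist.ev_draw]
    have h1 : ∀ xs, p.val g I + p.δ / K * ((1 - p.q * p.δ) * p.val (fun S => g (S ∪ V)) I -
        p.val g I - n * ((1 - p.θ) ^ Tt * lam0)) - p.δ / K * (K * n + 2 * n) * Zf xs ≤
        (((stageSampler p.Ns p.q p.θ p.q_pos.le p.q_le_one E I k xs).loop p.iters
          ⟨∅, ∅, ∅, ∅, lam0⟩).bind fun s => .output (Function.update I k s.G)).ev O (p.val g) := by
      intro xs
      rw [AdaptiveAlg.ev_bind]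
      simp only [AdaptiveAlg.ev, hval, hp.iters_eq]
      refine le_trans (le_of_eq ?_) (hloop xs).2.1
      simp only [val, stageSampler]
      ring
    refine le_trans ?_ (FinDist.ex_mono _ h1)
    rw [FinDist.ex_sub, FinDist.ex_const, FinDist.ex_mul]
    have h2 : 0 ≤ p.δ / K * (K * n + 2 * n) := by
      have := hp.K_pos
      have := p.δ_pos
      positivity
    have h3 := mul_le_mul_of_nonneg_left (hZ hopt) h2
    rw [err]
    linarith
  · rw [stage, FinDist.ev_draw]
    rw [← FinDist.ex_const (p.dist.pi (Fin p.samples))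
      ((1 - p.q * p.δ) * p.val (fun S => g (S ∪ V)) I)]
    refine FinDist.ex_mono _ fun xs => ?_
    rw [AdaptiveAlg.ev_bind]
    simp only [AdaptiveAlg.ev, hval, hp.iters_eq]
    exact (hloop xs).2.2

/-- The partial outputs: independent sets, empty from index `k` on. -/
def Partial (M : Fin m → Matroid (Fin n)) (k : ℕ) (I : Fin ℓ → Finset (Fin n)) : Prop :=
  (∀ j, MatchoidIndep M (I j)) ∧ ∀ j : Fin ℓ, k ≤ j.1 → I j = ∅

theorem val_nonneg {f : Finset (Fin n) → ℝ} (hf : ∀ S, 0 ≤ f S) (I : Fin ℓ → Finset (Fin n)) :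
    0 ≤ p.val f I := p.dist.ex_nonneg fun _ => hf _

theorem Instance.ensures_stages (h : p.Instance M O E lam0 opt g V)
    (hp : p.Good pp κ σ K L Tt) (k : ℕ) :
    (p.stages E lam0 k).Ensures O (Partial M k) := by
  induction k with
  | zero => exact ⟨fun j i => by simp, fun j _ => rfl⟩
  | succ k ih =>
    refine ih.bind fun I hI => ?_
    split_ifs with hk
    · refine (h.stage_spec hp ⟨k, hk⟩ I (hI.2 _ le_rfl)).1.mono ?_
      rintro I' ⟨G, hG, rfl⟩
      refine ⟨fun j => ?_, fun j hj => ?_⟩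
      · by_cases hjk : j = ⟨k, hk⟩
        · subst hjk
          rwa [Function.update_self]
        · rw [Function.update_of_ne hjk]
          exact hI.1 j
      · rw [Function.update_of_ne]
        · exact hI.2 j (by omega)
        · rintro rfl
          simp at hj
    · exact ⟨hI.1, fun j hj => hI.2 j (by omega)⟩

theorem Instance.val_union_stages (h : p.Instance M O E lam0 opt g V)
    (hp : p.Good pp κ σ K L Tt) (hr : 0 ≤ 1 - p.q * p.δ) (k : ℕ) (hk : k ≤ ℓ) :
    (1 - p.q * p.δ) ^ k * opt ≤ (p.stages E lam0 k).ev O (p.val fun S => g (S ∪ V)) := by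
  induction k with
  | zero =>
    simp [stages, AdaptiveAlg.ev, val, thinUnion_empty, h.val_opt, FinDist.ex_const]
  | succ k ih =>
    rw [stages, AdaptiveAlg.ev_bind]
    have h1 : (p.stages E lam0 k).ev O (fun I => (1 - p.q * p.δ) * p.val (fun S => g (S ∪ V)) I) ≤
        (p.stages E lam0 k).ev O fun I => (if h : k < ℓ then p.stage E lam0 ⟨k, h⟩ I
          else .output I : AdaptiveAlg (MatchoidQuery n m) _).ev O
            (p.val fun S => g (S ∪ V)) := by
      refine AdaptiveAlg.ev_mono (h.ensures_stages hp k) fun I hI => ?_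
      rw [dif_pos (show k < ℓ by omega)]
      exact (h.stage_spec hp ⟨k, by omega⟩ I (hI.2 _ le_rfl)).2.2
    rw [AdaptiveAlg.ev_mul] at h1
    refine le_trans ?_ h1
    rw [pow_succ, mul_comm _ (1 - p.q * p.δ), mul_assoc]
    exact mul_le_mul_of_nonneg_left (ih (by omega)) hr

theorem Instance.val_stages (h : p.Instance M O E lam0 opt g V)
    (hp : p.Good pp κ σ K L Tt) (hopt : 0 < opt) (k : ℕ) (hk : k ≤ ℓ) :
    k * (p.δ / K * ((1 - p.q * p.δ) ^ k * opt - err p σ K Tt lam0 opt)) ≤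
      (p.stages E lam0 k).ev O (p.val g) := by
  have hδ := p.δ_pos
  have hq := p.q_pos
  have hKpos := hp.K_pos
  have hr0 : 0 ≤ 1 - p.q * p.δ := by
    have := mul_le_one₀ p.q_le_one p.δ_pos.le p.δ_le_one
    linarith
  have hr1 : 1 - p.q * p.δ ≤ 1 := by
    have : 0 ≤ p.q * p.δ := by positivity
    linarith
  have ha : p.δ / K ≤ p.q * p.δ := by
    rw [div_le_iff₀ hKpos, mul_right_comm]
    refine le_mul_of_one_le_left hδ.le ?_
    have hθ := sub_pos.2 hp.θ_lt
    rw [hp.K_eq, mul_div_assoc', le_div_iff₀ (by positivity), one_mul, mul_add,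
      mul_div_cancel₀ _ hq.ne']
    have h1 : (1 - p.θ) ^ 2 ≤ 1 := pow_le_one₀ hθ.le (by linarith [hp.θ_nonneg])
    have h2 : 0 ≤ p.q * p.δ := by positivity
    linarith [hp.κ_one]
  have ha0 : 0 ≤ p.δ / K := by positivity
  have herr : 0 ≤ err p σ K Tt lam0 opt := by
    have h1 : 0 ≤ lam0 := (h.nonneg _).trans (h.single_le ⟨0, hp.n_pos⟩)
    have h2 := sub_pos.2 hp.θ_lt
    have h3 := hp.σ_pos
    rw [err]
    positivity
  induction k with
  | zero =>
    rw [Nat.cast_zero, zero_mul]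
    exact val_nonneg h.nonneg _
  | succ k ih =>
    have ih' := ih (by omega)
    rw [stages, AdaptiveAlg.ev_bind]
    set a := p.δ / K
    set r := 1 - p.q * p.δ with hr
    set e := err p σ K Tt lam0 opt
    have h1 : (p.stages E lam0 k).ev O (fun I => (1 - a) * p.val g I +
        (a * r * p.val (fun S => g (S ∪ V)) I + -(a * e))) ≤
        (p.stages E lam0 k).ev O fun I => (if h : k < ℓ then p.stage E lam0 ⟨k, h⟩ I
          else .output I : AdaptiveAlg (MatchoidQuery n m) _).ev O (p.val g) := by
      refine AdaptiveAlg.ev_mono (h.ensures_stages hp k) fun I hI => ?_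
      rw [dif_pos (show k < ℓ by omega)]
      refine le_trans (le_of_eq ?_)
        ((h.stage_spec hp ⟨k, by omega⟩ I (hI.2 _ le_rfl)).2.1 hopt)
      ring
    rw [AdaptiveAlg.ev_add _ _ (h.ensures_stages hp k),
      AdaptiveAlg.ev_add _ _ (h.ensures_stages hp k), AdaptiveAlg.ev_mul, AdaptiveAlg.ev_mul,
      AdaptiveAlg.ev_const] at h1
    refine le_trans ?_ h1
    have h2 := h.val_union_stages hp hr0 k (by omega)
    have h3 : 0 ≤ (p.stages E lam0 k).ev O (p.val g) := by
      have := AdaptiveAlg.ev_mono (g := fun _ => 0) (h.ensures_stages hp k)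
        fun I _ => val_nonneg (p := p) h.nonneg I
      rwa [AdaptiveAlg.ev_const] at this
    have h4 : r * (p.stages E lam0 k).ev O (p.val g) ≤
        (1 - a) * (p.stages E lam0 k).ev O (p.val g) :=
      mul_le_mul_of_nonneg_right (by linarith) h3
    have h5 := mul_le_mul_of_nonneg_left ih' hr0
    have h6 := mul_le_mul_of_nonneg_left h2 (mul_nonneg ha0 hr0)
    have h7 : (k : ℝ) * a * (r * e) ≤ k * a * e :=
      mul_le_mul_of_nonneg_left (mul_le_of_le_one_left herr hr1) (by positivity)
    push_cast
    rw [pow_succ]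
    nlinarith

open Classical in
theorem instance_initData (p : Params n m ℓ) {f : Finset (Fin n) → ℝ} (hf0 : ∀ S, 0 ≤ f S)
    (hfe : f ∅ = 0) (hf : IsSubmodular f)
    (hE : ∀ i, (M i).E = (p.Ns i : Set (Fin n))) :
    (∀ I, MatchoidIndep M I → I ⊆ (p.initData (matchoidOracle M f)).1) ∧ ∃ V,
      p.Instance M (matchoidOracle M f) (p.initData (matchoidOracle M f)).1
        (p.initData (matchoidOracle M f)).2 (matchoidOpt M f)
        (fun S => f (S ∩ (p.initData (matchoidOracle M f)).1)) V := by
  set E := (p.initData (matchoidOracle M f)).1 with hEdef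
  have hlam : (p.initData (matchoidOracle M f)).2 = ∑ e ∈ E, f {e} := rfl
  rw [hlam]
  have hgr := matchoidOpt_isGreatest M f
  have hmem : ∀ e, e ∈ E ↔ Unblocked p.Ns (matchoidOracle M f) ∅ e := by
    intro e
    rw [hEdef, initData]
    simp only [Finset.mem_filter, Finset.mem_univ, true_and]
  have hsub : ∀ I, MatchoidIndep M I → I ⊆ E := by
    intro I hI e he
    rw [hmem, unblocked_iff hE]
    exact fun i hi => hI.indepOver_empty.notMem_closure he i hi
  have hempty : MatchoidIndep M ∅ := fun i => by simp
  have hsingle : ∀ e ∈ E, f {e} ≤ matchoidOpt M f := by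
    intro e he
    rw [hmem, unblocked_iff hE] at he
    exact hgr.2 ⟨{e}, hempty.insert subset_rfl he, rfl⟩
  have hopt0 : 0 ≤ matchoidOpt M f := (hf0 ∅).trans (hgr.2 ⟨∅, hempty, rfl⟩)
  obtain ⟨V, hV, hVopt⟩ := hgr.1
  have hsumnn : 0 ≤ ∑ e ∈ E, f {e} := Finset.sum_nonneg fun e _ => hf0 _
  refine ⟨hsub, V, ?_⟩
  exact
    { hE := hE
      unblocked := fun P e => unblocked_iff hE f P e
      g_eq := rfl
      submod := fun S T => by
        have := hf (S ∩ E) (T ∩ E)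
        rwa [← Finset.union_inter_distrib_right, ← Finset.inter_inter_distrib_right] at this
      nonneg := fun S => hf0 _
      empty := by simpa using hfe
      single_le := fun e => by
        by_cases he : e ∈ E
        · rw [Finset.singleton_inter_of_mem he]
          exact Finset.single_le_sum (f := fun e => f {e}) (fun e _ => hf0 _) he
        · rwa [Finset.singleton_inter_of_notMem he, hfe]
      single_le_opt := fun e => by
        by_cases he : e ∈ E
        · rw [Finset.singleton_inter_of_mem he]
          exact hsingle e he
        · rwa [Finset.singleton_inter_of_notMem he, hfe]
      lam0_le := by
        refine (Finset.sum_le_sum hsingle).trans ?_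
        rw [Finset.sum_const, nsmul_eq_mul]
        refine mul_le_mul_of_nonneg_right ?_ hopt0
        have := Finset.card_le_univ E
        rw [Fintype.card_fin] at this
        exact_mod_cast this
      opt_nonneg := hopt0
      indep := hV
      val_opt := by rw [Finset.inter_eq_left.2 (hsub V hV), hVopt] }

/-- The guarantee of the algorithm. -/
theorem alg_spec (p : Params n m ℓ) (hp : p.Good pp κ σ K L Tt) (hℓ : 1 ≤ ℓ)
    (hδ : p.δ = 1 / (ℓ : ℝ)) (hr : 1 / 8 ≤ (1 - p.q * p.δ) ^ ℓ)
    (herr : (K * n + 2 * n) * (σ * n) + n * ((1 - p.θ) ^ Tt * n) ≤ p.θ / 8)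
    {f : Finset (Fin n) → ℝ} (hf0 : ∀ S, 0 ≤ f S) (hfe : f ∅ = 0) (hf : IsSubmodular f)
    (hE : ∀ i, (M i).E = (p.Ns i : Set (Fin n))) :
    p.alg.Ensures (matchoidOracle M f) (fun I => ∀ k, MatchoidIndep M (I k)) ∧
    (1 - p.θ) ^ 3 * (ℓ / (κ / p.q * ℓ + 1)) * (1 - p.q * p.δ) ^ ℓ * matchoidOpt M f ≤
      p.alg.ev (matchoidOracle M f) (subsampledUnionValue f) := by
  obtain ⟨hsub, V, hI⟩ := p.instance_initData hf0 hfe hf hE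
  have hens := hI.ensures_stages hp ℓ
  have hℓ0 : (0 : ℝ) < ℓ := by exact_mod_cast hℓ
  refine ⟨(AdaptiveAlg.Ensures.bind (r := fun y => y = p.initData (matchoidOracle M f))
    (AdaptiveAlg.ensures_ask p.local_initData rfl) fun y hy => ?_), ?_⟩
  · subst hy
    exact hens.mono fun I h => h.1
  rw [alg, AdaptiveAlg.ev_bind,
    AdaptiveAlg.ev_ask p.local_initData]
  have hval : (p.stages (p.initData (matchoidOracle M f)).1 (p.initData (matchoidOracle M f)).2
      ℓ).ev (matchoidOracle M f)
        (p.val fun S => f (S ∩ (p.initData (matchoidOracle M f)).1)) ≤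
      (p.stages (p.initData (matchoidOracle M f)).1 (p.initData (matchoidOracle M f)).2
      ℓ).ev (matchoidOracle M f) (subsampledUnionValue f) := by
    refine AdaptiveAlg.ev_mono hens fun I h => le_of_eq ?_
    rw [subsampledUnionValue_eq_ex f I (hδ ▸ p.δ_pos.le) (hδ ▸ p.δ_le_one)]
    simp only [val, dist, filterDist, hδ]
    congr 1
    funext x
    congr 1
    refine Finset.inter_eq_left.2 fun e he => ?_
    obtain ⟨k, hk, -⟩ := mem_thinUnion.1 he
    exact hsub _ (h.1 k) hk
  refine le_trans ?_ hval
  rcases hI.opt_nonneg.eq_or_lt with h0 | hpos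
  · rw [← h0, mul_zero]
    have := AdaptiveAlg.ev_mono (g := fun _ => 0) hens
      fun I _ => val_nonneg (p := p) hI.nonneg I
    rwa [AdaptiveAlg.ev_const] at this
  · refine le_trans ?_ (hI.val_stages hp hpos ℓ le_rfl)
    have hθ' := sub_pos.2 hp.θ_lt
    have hq := p.q_pos
    have hκ : 0 < κ := lt_of_lt_of_le one_pos hp.κ_one
    have hcoef : (ℓ : ℝ) * (p.δ / K) = (1 - p.θ) ^ 2 * (ℓ / (κ / p.q * ℓ + 1)) := by
      rw [hp.K_eq, hδ]
      field_simp
    rw [← mul_assoc, hcoef]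
    have herr' : err p σ K Tt (p.initData (matchoidOracle M f)).2 (matchoidOpt M f) ≤
        p.θ * ((1 - p.q * p.δ) ^ ℓ * matchoidOpt M f) := by
      calc _ ≤ ((K * n + 2 * n) * (σ * n) + n * ((1 - p.θ) ^ Tt * n)) * matchoidOpt M f := by
            have h1 : n * ((1 - p.θ) ^ Tt * (p.initData (matchoidOracle M f)).2) ≤
                n * ((1 - p.θ) ^ Tt * (n * matchoidOpt M f)) := by
              gcongr
              exact hI.lam0_le
            rw [err]
            linarith
        _ ≤ p.θ / 8 * matchoidOpt M f := mul_le_mul_of_nonneg_right herr hpos.le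
        _ = p.θ * (1 / 8 * matchoidOpt M f) := by ring
        _ ≤ _ := by
            have := hp.θ_nonneg
            gcongr
    have hc : 0 ≤ (1 - p.θ) ^ 2 * (ℓ / (κ / p.q * ℓ + 1)) := by positivity
    refine le_trans (le_of_eq ?_) (mul_le_mul_of_nonneg_left (sub_le_sub_left herr' _) hc)
    ring

end Params
end

noncomputable section

/-! ### Choice of the parameters -/

theorem one_le_two_log {n : ℕ} (hn : 2 ≤ n) : 1 ≤ 2 * Real.log n := by
  have h1 : Real.log 2 ≤ Real.log n := Real.log_le_log (by norm_num) (by exact_mod_cast hn)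
  have := Real.log_two_gt_d9
  linarith

theorem one_sub_pow_le_exp {θ : ℝ} (h : θ ≤ 1) (k : ℕ) :
    (1 - θ) ^ k ≤ Real.exp (-(θ * k)) := by
  rw [show -(θ * k) = k * (-θ) by ring, Real.exp_nat_mul]
  exact pow_le_pow_left₀ (by linarith) (Real.one_sub_le_exp_neg θ) k

/-- The number of iterations can be chosen as small as claimed. -/
theorem exists_iters {n : ℕ} (hn : 2 ≤ n) {θ : ℝ} (hθ : 0 < θ) (hθ1 : θ ≤ 1 / 3) :
    ∃ L Tt : ℕ, 1 ≤ L ∧ (1 - θ) ^ L * n < 1 ∧ n * ((1 - θ) ^ Tt * n) ≤ θ / 16 ∧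
      ((min n (L * (Tt + 2)) : ℕ) : ℝ) ≤ 65 * Real.log n ^ 2 / θ ^ 2 := by
  have hn0 : (0 : ℝ) < n := by positivity
  have hlog := one_le_two_log hn
  have hinv : 1 ≤ 1 / θ := by rw [le_div_iff₀ hθ]; linarith
  set lg := Real.log n with hlg
  refine ⟨⌈(lg + 1) / θ⌉₊, ⌈Real.log (16 * n ^ 2 / θ) / θ⌉₊, ?_, ?_, ?_, ?_⟩
  · rw [Nat.one_le_ceil_iff]
    positivity
  · have h1 := Nat.le_ceil ((lg + 1) / θ)
    rw [div_le_iff₀ hθ] at h1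
    calc _ ≤ Real.exp (-(θ * ⌈(lg + 1) / θ⌉₊)) * n :=
          mul_le_mul_of_nonneg_right (one_sub_pow_le_exp (by linarith) _) hn0.le
      _ ≤ Real.exp (-(lg + 1)) * n := by
          gcongr; linarith
      _ < 1 := by
          rw [neg_add, Real.exp_add, Real.exp_neg, hlg, Real.exp_log hn0, mul_right_comm,
            inv_mul_cancel₀ hn0.ne', one_mul]
          have := Real.exp_lt_exp.2 (show (-1 : ℝ) < 0 by norm_num)
          rwa [Real.exp_zero] at this
  · have h1 := Nat.le_ceil (Real.log (16 * n ^ 2 / θ) / θ)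
    rw [div_le_iff₀ hθ] at h1
    have h2 : (1 - θ) ^ ⌈Real.log (16 * n ^ 2 / θ) / θ⌉₊ ≤ θ / (16 * n ^ 2) := by
      refine (one_sub_pow_le_exp (by linarith) _).trans ?_
      calc _ ≤ Real.exp (-Real.log (16 * n ^ 2 / θ)) := by
            gcongr; linarith
        _ = θ / (16 * n ^ 2) := by
            rw [Real.exp_neg, Real.exp_log (by positivity), inv_div]
    calc _ ≤ n * (θ / (16 * n ^ 2) * n) := by gcongr
      _ = θ / 16 := by field_simp
  · rcases le_total (n : ℝ) (1 / θ) with h | h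
    · calc ((min n _ : ℕ) : ℝ) ≤ n := by exact_mod_cast min_le_left _ _
        _ ≤ 1 / θ * 1 := by linarith
        _ ≤ 1 / θ * (1 / θ) := by gcongr
        _ ≤ 65 * lg ^ 2 / θ ^ 2 := by
            rw [div_mul_div_comm, one_mul, ← sq]
            gcongr
            nlinarith
    · have e1 : (⌈(lg + 1) / θ⌉₊ : ℝ) ≤ 5 * lg / θ := by
        refine (Nat.ceil_lt_add_one (by positivity)).le.trans ?_
        have : (1 : ℝ) ≤ 2 * lg / θ := by
          rw [le_div_iff₀ hθ]; linarith
        calc (lg + 1) / θ + 1 ≤ (lg + 2 * lg) / θ + 2 * lg / θ := by gcongr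
          _ = 5 * lg / θ := by ring
      have hlogb : Real.log (16 * n ^ 2 / θ) ≤ 7 * lg := by
        have h2 : 16 * (n : ℝ) ^ 2 / θ ≤ (n : ℝ) ^ 7 := by
          have h3 : (16 : ℝ) ≤ (n : ℝ) ^ 4 := by
            have : (2 : ℝ) ≤ n := by exact_mod_cast hn
            calc (16 : ℝ) = 2 ^ 4 := by norm_num
              _ ≤ (n : ℝ) ^ 4 := by gcongr
          calc 16 * (n : ℝ) ^ 2 / θ = 16 * (n : ℝ) ^ 2 * (1 / θ) := by ring
            _ ≤ (n : ℝ) ^ 4 * (n : ℝ) ^ 2 * n := by gcongr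
            _ = (n : ℝ) ^ 7 := by ring
        have h4 := Real.log_le_log (by positivity) h2
        rw [Real.log_pow] at h4
        exact_mod_cast h4
      have e2 : ((⌈Real.log (16 * n ^ 2 / θ) / θ⌉₊ : ℕ) : ℝ) + 2 ≤ 13 * lg / θ := by
        have h3 : Real.log (16 * n ^ 2 / θ) / θ ≤ 7 * lg / θ := by gcongr
        have h4 : ((⌈Real.log (16 * n ^ 2 / θ) / θ⌉₊ : ℕ) : ℝ) ≤ 7 * lg / θ + 1 := by
          refine (Nat.cast_le.2 (Nat.ceil_mono h3)).trans (Nat.ceil_lt_add_one ?_).le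
          positivity
        have : (3 : ℝ) ≤ 6 * lg / θ := by
          rw [le_div_iff₀ hθ]; linarith
        calc _ ≤ 7 * lg / θ + 6 * lg / θ := by linarith
          _ = 13 * lg / θ := by ring
      calc ((min n _ : ℕ) : ℝ)
          ≤ ((⌈(lg + 1) / θ⌉₊ * (⌈Real.log (16 * n ^ 2 / θ) / θ⌉₊ + 2) : ℕ) : ℝ) := by
            exact_mod_cast min_le_right _ _
        _ = (⌈(lg + 1) / θ⌉₊ : ℝ) * (((⌈Real.log (16 * n ^ 2 / θ) / θ⌉₊ : ℕ) : ℝ) + 2) := by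
            push_cast; ring
        _ ≤ (5 * lg / θ) * (13 * lg / θ) := by gcongr
        _ = 65 * lg ^ 2 / θ ^ 2 := by ring

theorem log_two_mul_card_le {n : ℕ} (hn : 1 ≤ n) :
    Real.log (2 * Fintype.card (Finset (Fin n) × Fin n)) ≤ 3 * n := by
  have hn0 : (1 : ℝ) ≤ n := by exact_mod_cast hn
  have h1 : (2 * Fintype.card (Finset (Fin n) × Fin n) : ℝ) = 2 * (2 ^ n * n) := by
    simp
  rw [h1, Real.log_mul (by norm_num) (by positivity), Real.log_mul (by positivity) (by positivity),
    Real.log_pow]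
  have h2 : Real.log 2 ≤ 1 := by linarith [Real.log_two_lt_d9]
  have h3 : Real.log n ≤ n := Real.log_le_self (by linarith)
  nlinarith

/-- The algorithm with suitable parameters. -/
theorem exists_alg {n m ℓ : ℕ} (Ns : Fin m → Finset (Fin n)) {p : ℕ} {q κ θ : ℝ} (hn : 2 ≤ n)
    (hℓ : 1 ≤ ℓ) (hp1 : 1 ≤ p) (hpm : p ≤ m + 1) (hN : InAtMost p Ns) (hq0 : 0 < q)
    (hq1 : q ≤ 1) (hκ1 : 1 ≤ κ) (hκp : q * p ≤ κ) (hκq : κ / q ≤ 3 * p) (hθ : 0 < θ)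
    (hθ1 : θ ≤ 1 / 3) (hr : 1 / 8 ≤ (1 - q * (1 / (ℓ : ℝ))) ^ ℓ) :
    ∃ (A : AdaptiveAlg (MatchoidQuery n m) (Fin ℓ → Finset (Fin n))) (R s : ℕ),
      (R : ℝ) ≤ 134 * ℓ * Real.log n ^ 2 / θ ^ 2 ∧
      (s : ℝ) ≤ 48 * n * (176 * n ^ 2 * (m + 1) / θ) ^ 2 + 1 ∧
      A.Within (fun _ => True) R
        (n + (m + m * n) + ℓ * (n * ((n + 2) * (2 * (s * n) + (m + m * n))))) ∧
      ∀ (f : Finset (Fin n) → ℝ) (M : Fin m → Matroid (Fin n)),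
        (∀ S, 0 ≤ f S) → f ∅ = 0 → IsSubmodular f →
        (∀ i, (M i).E = (Ns i : Set (Fin n))) →
        A.Ensures (matchoidOracle M f) (fun I => ∀ k, MatchoidIndep M (I k)) ∧
        (1 - θ) ^ 3 * (ℓ / (κ / q * ℓ + 1)) * (1 - q * (1 / (ℓ : ℝ))) ^ ℓ * matchoidOpt M f ≤
          A.ev (matchoidOracle M f) (subsampledUnionValue f) := by
  obtain ⟨L, Tt, hL1, hL, hT, hit⟩ := exists_iters hn hθ hθ1
  have hn0 : (0 : ℝ) < n := by positivity
  have hn1 : (1 : ℝ) ≤ n := by exact_mod_cast (by omega : 1 ≤ n)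
  have hℓ0 : (0 : ℝ) < ℓ := by exact_mod_cast hℓ
  have hℓ1 : (1 : ℝ) ≤ ℓ := by exact_mod_cast hℓ
  have hδ1 : 1 / (ℓ : ℝ) ≤ 1 := by rw [div_le_one hℓ0]; exact hℓ1
  have hm : (p : ℝ) ≤ m + 1 := by exact_mod_cast hpm
  have hp : (1 : ℝ) ≤ p := by exact_mod_cast hp1
  set σ : ℝ := θ / (176 * n ^ 2 * (m + 1)) with hσ
  have hσ0 : 0 < σ := by positivity
  have hσ1 : σ ≤ 1 := by
    rw [hσ, div_le_one (by positivity)]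
    have : (1 : ℝ) ≤ n ^ 2 * (m + 1) := one_le_mul_of_one_le_of_one_le (one_le_pow₀ hn1) (by simp)
    linarith
  set K : ℝ := (κ / q + 1 / ℓ) / (1 - θ) ^ 2 with hK
  have hK9 : K + 2 ≤ 11 * (m + 1) := by
    have h1 : (4 / 9 : ℝ) ≤ (1 - θ) ^ 2 := by nlinarith
    have h2 : K ≤ 9 * p := by
      rw [hK, div_le_iff₀ (by positivity)]
      calc κ / q + 1 / ℓ ≤ 3 * p + 1 := by linarith
        _ ≤ 9 * p * (4 / 9) := by linarith
        _ ≤ 9 * p * (1 - θ) ^ 2 := by gcongr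
    linarith
  set s : ℕ := ⌈48 * n / σ ^ 2⌉₊ with hs
  let P : Params n m ℓ :=
    { Ns := Ns, q := q, θ := θ, δ := 1 / ℓ, q_pos := hq0, q_le_one := hq1
      δ_pos := by positivity
      δ_le_one := hδ1
      samples := s
      iters := min n (L * (Tt + 2)) }
  have hgood : P.Good p κ σ K L Tt :=
    { n_pos := by omega
      inAtMost := hN
      κ_one := hκ1
      κ_p := hκp
      θ_nonneg := hθ.le
      θ_lt := by change θ < 1; linarith
      K_eq := rfl
      L_pow := hL
      L_pos := hL1
      iters_eq := rfl
      σ_pos := hσ0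
      σ_le := hσ1
      samples_pos := Nat.ceil_pos.2 (by positivity)
      samples_ge := by
        have h1 : 48 * n / σ ^ 2 ≤ (s : ℝ) := Nat.le_ceil _
        rw [div_le_iff₀ (by positivity)] at h1
        have h2 := log_two_mul_card_le (show 1 ≤ n by omega)
        change _ ≤ σ ^ 2 * (s : ℝ)
        linarith }
  have hlog := one_le_two_log hn
  refine ⟨P.alg, 1 + ℓ * (2 * min n (L * (Tt + 2))), s, ?_, ?_, ?_, fun f M hf0 hfe hf hE => ?_⟩
  · have h1 : (1 : ℝ) ≤ 4 * ℓ * Real.log n ^ 2 / θ ^ 2 := by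
      rw [le_div_iff₀ (by positivity), one_mul]
      have h2 : θ ^ 2 ≤ 1 := pow_le_one₀ hθ.le (by linarith)
      have h3 : 1 ≤ 4 * Real.log n ^ 2 := by nlinarith
      nlinarith
    calc ((1 + ℓ * (2 * min n (L * (Tt + 2))) : ℕ) : ℝ)
        = 1 + 2 * ℓ * ((min n (L * (Tt + 2)) : ℕ) : ℝ) := by push_cast; ring
      _ ≤ 4 * ℓ * Real.log n ^ 2 / θ ^ 2 + 2 * ℓ * (65 * Real.log n ^ 2 / θ ^ 2) := by gcongr
      _ = 134 * ℓ * Real.log n ^ 2 / θ ^ 2 := by ring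
  · refine (Nat.ceil_lt_add_one (by positivity)).le.trans (le_of_eq ?_)
    rw [hσ]
    field_simp
  · refine P.within_alg.mono (fun _ h => h) le_rfl ?_
    have : P.iters ≤ n := min_le_left _ _
    gcongr
  · refine P.alg_spec hgood hℓ rfl hr ?_ hf0 hfe hf hE
    have h1 : (K * n + 2 * n) * (σ * n) ≤ θ / 16 := by
      calc (K * n + 2 * n) * (σ * n) = (K + 2) * (σ * n ^ 2) := by ring
        _ ≤ 11 * (m + 1) * (σ * n ^ 2) := by gcongr
        _ = θ / 16 := by rw [hσ]; field_simp; norm_num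
    change (K * n + 2 * n) * (σ * n) + n * ((1 - θ) ^ Tt * n) ≤ θ / 8
    linarith

/-- The number of queries is polynomially bounded. -/
theorem queries_le {n m ℓ s : ℕ} {ε θ : ℝ} (hn : 2 ≤ n) (hε : 0 < ε) (hε1 : ε < 1)
    (hθ : ε / 6 ≤ θ) (hℓ : (ℓ : ℝ) ≤ 8 / ε)
    (hs : (s : ℝ) ≤ 48 * n * (176 * n ^ 2 * (m + 1) / θ) ^ 2 + 1) :
    ((n + (m + m * n) + ℓ * (n * ((n + 2) * (2 * (s * n) + (m + m * n)))) : ℕ) : ℝ) ≤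
      10 ^ 10 * ((n : ℝ) + m + 1 / ε) ^ 13 := by
  set X : ℝ := (n : ℝ) + m + 1 / ε with hX
  have hn2 : (2 : ℝ) ≤ n := by exact_mod_cast hn
  have hm0 : (0 : ℝ) ≤ m := Nat.cast_nonneg m
  have hinv : 1 < 1 / ε := by rw [lt_div_iff₀ hε]; linarith
  have hnX : (n : ℝ) ≤ X := by linarith
  have hmX : (m : ℝ) + 1 ≤ X := by linarith
  have hmX' : (m : ℝ) ≤ X := by linarith
  have hεX : 1 / ε ≤ X := by linarith
  have hX1 : 1 ≤ X := by linarith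
  have hX0 : 0 ≤ X := by linarith
  have hθ0 : 0 < θ := lt_of_lt_of_le (by positivity) hθ
  have hθX : 1 / θ ≤ 6 * X := by
    calc 1 / θ ≤ 1 / (ε / 6) := one_div_le_one_div_of_le (by positivity) hθ
      _ = 6 * (1 / ε) := by field_simp
      _ ≤ 6 * X := by gcongr
  have hℓX : (ℓ : ℝ) ≤ 8 * X := by
    refine hℓ.trans ?_
    rw [div_eq_mul_one_div]
    gcongr
  have hpow : ∀ a b : ℕ, a ≤ b → X ^ a ≤ X ^ b := fun a b h => pow_le_pow_right₀ hX1 h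
  have hsX : (s : ℝ) ≤ 6 * 10 ^ 7 * X ^ 9 := by
    calc (s : ℝ) ≤ 48 * n * (176 * n ^ 2 * (m + 1) * (1 / θ)) ^ 2 + 1 := by
          refine hs.trans (le_of_eq ?_)
          ring
      _ ≤ 48 * X * (176 * X ^ 2 * X * (6 * X)) ^ 2 + X ^ 9 := by
          gcongr
          exact one_le_pow₀ hX1
      _ = 53526529 * X ^ 9 := by ring
      _ ≤ 6 * 10 ^ 7 * X ^ 9 := by gcongr; norm_num
  have hmn : (m : ℝ) + m * n ≤ 2 * X ^ 2 := by
    calc (m : ℝ) + m * n ≤ X + X * X := by gcongr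
      _ = X ^ 1 + X ^ 2 := by ring
      _ ≤ X ^ 2 + X ^ 2 := by gcongr ?_ + _; exact hpow 1 2 (by norm_num)
      _ = 2 * X ^ 2 := by ring
  push_cast
  calc (n : ℝ) + (m + m * n) + ℓ * (n * ((n + 2) * (2 * (s * n) + (m + m * n))))
      ≤ X + 2 * X ^ 2 + 8 * X * (X * ((X + X) * (2 * (6 * 10 ^ 7 * X ^ 9 * X) + 2 * X ^ 2))) := by
        gcongr
        linarith
    _ = X ^ 1 + 2 * X ^ 2 + 32 * X ^ 5 + 192 * 10 ^ 7 * X ^ 13 := by ring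
    _ ≤ X ^ 13 + 2 * X ^ 13 + 32 * X ^ 13 + 192 * 10 ^ 7 * X ^ 13 := by
        gcongr ?_ + 2 * ?_ + 32 * ?_ + _
        · exact hpow 1 13 (by norm_num)
        · exact hpow 2 13 (by norm_num)
        · exact hpow 5 13 (by norm_num)
    _ = 1920000035 * X ^ 13 := by ring
    _ ≤ 10 ^ 10 * X ^ 13 := by gcongr; norm_num

theorem InAtMost.min_succ {n m p : ℕ} {N : Fin m → Finset (Fin n)} (h : InAtMost p N) :
    InAtMost (min p (m + 1)) N := fun e => le_min (h e)
  ((Finset.card_le_univ _).trans (by simp))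

/-! ### The approximation ratios -/

/-- The approximation ratio for a single independent set. -/
def singleRatio (p : ℕ) : ℝ := 2 * (p : ℝ) + 1 - 2 * √((p : ℝ) * ((p : ℝ) + 1))

theorem singleRatio_eq (p : ℕ) :
    singleRatio p = 1 / (2 * (p : ℝ) + 1 + 2 * √((p : ℝ) * ((p : ℝ) + 1))) := by
  have h : √((p : ℝ) * ((p : ℝ) + 1)) ^ 2 = p * (p + 1) := Real.sq_sqrt (by positivity)
  rw [singleRatio, eq_div_iff (by positivity)]
  nlinarith

theorem singleRatio_anti {p p' : ℕ} (h : p' ≤ p) : singleRatio p ≤ singleRatio p' := by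
  rw [singleRatio_eq, singleRatio_eq]
  have : (p' : ℝ) ≤ p := by exact_mod_cast h
  gcongr

theorem sqrt_mul_succ_bounds (p : ℕ) (hp : 1 ≤ p) :
    (p : ℝ) + 2 / 5 ≤ √((p : ℝ) * ((p : ℝ) + 1)) ∧
      √((p : ℝ) * ((p : ℝ) + 1)) ≤ (p : ℝ) + 1 / 2 := by
  have hp' : (1 : ℝ) ≤ p := by exact_mod_cast hp
  constructor
  · apply Real.le_sqrt_of_sq_le
    nlinarith
  · rw [Real.sqrt_le_left (by positivity)]
    nlinarith

theorem tendsto_singleRatio :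
    Tendsto (fun p : ℕ => singleRatio p * (4 * ((p : ℝ) + 1)) - 1) atTop (𝓝 0) := by
  refine squeeze_zero' (g := fun p : ℕ => 1 / (p : ℝ)) ?_ ?_ tendsto_one_div_atTop_nhds_zero_nat
  · filter_upwards [eventually_ge_atTop 1] with p hp
    obtain ⟨h1, h2⟩ := sqrt_mul_succ_bounds p hp
    rw [singleRatio_eq, sub_nonneg, one_div_mul_eq_div, le_div_iff₀ (by positivity)]
    linarith
  · filter_upwards [eventually_ge_atTop 1] with p hp
    obtain ⟨h1, h2⟩ := sqrt_mul_succ_bounds p hp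
    have hp' : (1 : ℝ) ≤ p := by exact_mod_cast hp
    rw [singleRatio_eq, one_div_mul_eq_div, sub_le_iff_le_add, div_le_iff₀ (by positivity)]
    have h3 : (1 / (p : ℝ) + 1) * (4 * p + 1) ≤
        (1 / (p : ℝ) + 1) * (2 * p + 1 + 2 * √((p : ℝ) * (p + 1))) :=
      mul_le_mul_of_nonneg_left (by linarith) (by positivity)
    refine le_trans ?_ h3
    have : (1 / (p : ℝ) + 1) * (4 * p + 1) = 4 * p + 5 + 1 / p := by field_simp; ring
    rw [this]
    have : 0 ≤ 1 / (p : ℝ) := by positivity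
    linarith

theorem multiRatio_anti {p p' : ℕ} (hp' : 1 ≤ p') (h : p' ≤ p) :
    1 / (p : ℝ) * Real.exp (-1 / (p : ℝ)) ≤ 1 / (p' : ℝ) * Real.exp (-1 / (p' : ℝ)) := by
  have h0 : (1 : ℝ) ≤ p' := by exact_mod_cast hp'
  have h1 : (p' : ℝ) ≤ p := by exact_mod_cast h
  set x : ℝ := 1 / (p : ℝ) with hx
  set y : ℝ := 1 / (p' : ℝ) with hy
  have hxy : x ≤ y := one_div_le_one_div_of_le (by linarith) h1
  have hx0 : 0 ≤ x := by rw [hx]; positivity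
  have hy1 : y ≤ 1 := by rw [hy, div_le_one (by linarith)]; exact h0
  rw [show -1 / (p : ℝ) = -x by rw [hx]; ring, show -1 / (p' : ℝ) = -y by rw [hy]; ring]
  have h2 : x ≤ y * Real.exp (x - y) := by
    have h3 := Real.add_one_le_exp (x - y)
    calc x ≤ y * (x - y + 1) := by nlinarith
      _ ≤ _ := by gcongr
  calc x * Real.exp (-x) ≤ y * Real.exp (x - y) * Real.exp (-x) := by gcongr
    _ = y * Real.exp (-y) := by rw [mul_assoc, ← Real.exp_add]; ring_nf

/-- A lower bound for `(1 - 1 / (p ℓ)) ^ ℓ`. -/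
theorem one_sub_pow_ge {p ℓ : ℕ} (hp : 1 ≤ p) {τ : ℝ} (hτ : 0 < τ) (hℓ : 1 / τ + 1 ≤ ℓ) :
    Real.exp (-1 / (p : ℝ)) * (1 - τ) ≤ (1 - 1 / (p : ℝ) * (1 / (ℓ : ℝ))) ^ ℓ := by
  have hp' : (1 : ℝ) ≤ p := by exact_mod_cast hp
  have hτ' : 0 < 1 / τ := by positivity
  have hℓ1 : (1 : ℝ) < ℓ := by linarith
  set x : ℝ := p * ℓ with hx
  have hxℓ : (ℓ : ℝ) ≤ x := by rw [hx]; nlinarith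
  have hx1 : 0 < x - 1 := by linarith
  have hx0 : 0 < x := by linarith
  have h1 : Real.exp (-(1 / (x - 1))) ≤ 1 - 1 / (p : ℝ) * (1 / (ℓ : ℝ)) := by
    have h2 := Real.add_one_le_exp (1 / (x - 1))
    have h3 : 1 - 1 / (p : ℝ) * (1 / (ℓ : ℝ)) = (1 / (x - 1) + 1)⁻¹ := by
      have : 1 / (p : ℝ) * (1 / (ℓ : ℝ)) = 1 / x := by rw [hx]; field_simp
      rw [this]
      field_simp
      ring
    rw [h3, Real.exp_neg]
    gcongr
  have h2 := pow_le_pow_left₀ (Real.exp_pos _).le h1 ℓ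
  rw [← Real.exp_nat_mul] at h2
  refine le_trans ?_ h2
  have h3 : (ℓ : ℝ) * -(1 / (x - 1)) = -1 / p + -(1 / (p * (x - 1))) := by
    have hne : x - 1 ≠ 0 := hx1.ne'
    have hp0 : (p : ℝ) ≠ 0 := by positivity
    rw [show (ℓ : ℝ) = x / p by rw [hx]; field_simp]
    field_simp
    ring
  rw [h3, Real.exp_add]
  gcongr
  have h4 := Real.add_one_le_exp (-(1 / (p * (x - 1))))
  have h5 : 1 / (p * (x - 1)) ≤ τ := by
    rw [div_le_iff₀ (by positivity)]
    have h6 : 1 / τ ≤ p * (x - 1) := by nlinarith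
    rw [div_le_iff₀ hτ] at h6
    linarith
  linarith

theorem subsampledUnionValue_one {n : ℕ} (f : Finset (Fin n) → ℝ) (I : Fin 1 → Finset (Fin n)) :
    subsampledUnionValue f I = f (I 0) := by
  rw [subsampledUnionValue, Finset.sum_eq_single I]
  · simp [subsampleProb]
  · intro J _ hJ
    have hne : J 0 ≠ I 0 := fun h => hJ (funext fun k => by rw [Subsingleton.elim k 0, h])
    have : subsampleProb (1 / ((1 : ℕ) : ℝ)) (I 0) (J 0) = 0 := by
      rw [subsampleProb]
      split_ifs with hsub
      · have := Finset.card_lt_card (lt_of_le_of_ne hsub hne)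
        simp only [Nat.cast_one, div_one, sub_self, one_pow, one_mul]
        exact zero_pow (by omega)
      · rfl
    rw [Fin.prod_univ_one, this, zero_mul]
  · simp

theorem one_sub_le_pow_three {ε : ℝ} (h0 : 0 ≤ ε) (h1 : ε ≤ 1) : 1 - ε ≤ (1 - ε / 3) ^ 3 := by
  nlinarith [sq_nonneg ε, pow_pos (show (0 : ℝ) < 1 by norm_num) 2, mul_nonneg h0 h0,
    mul_nonneg (mul_nonneg h0 h0) (sub_nonneg.2 h1)]

theorem exists_single {n m p : ℕ} {ε : ℝ} (N : Fin m → Finset (Fin n)) (hn : 2 ≤ n)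
    (hp : 1 ≤ p) (hε : 0 < ε) (hε1 : ε < 1) (hN : InAtMost p N) :
    ∃ A : AdaptiveAlg (MatchoidQuery n m) (Finset (Fin n)),
      ∀ (f : Finset (Fin n) → ℝ) (M : Fin m → Matroid (Fin n)),
        (∀ S, 0 ≤ f S) → f ∅ = 0 → IsSubmodular f →
        (∀ i, (M i).E = (N i : Set (Fin n))) →
        (∀ x ∈ (A.run (matchoidOracle M f)).support, MatchoidIndep M x.result) ∧
        (1 - ε) * singleRatio p * matchoidOpt M f ≤
          expectedValue (A.run (matchoidOracle M f)) f ∧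
        expectedRounds (A.run (matchoidOracle M f)) ≤
          ENNReal.ofReal (10 ^ 10 * Real.log n ^ 2 / ε ^ 2) ∧
        expectedQueries (A.run (matchoidOracle M f)) ≤
          ENNReal.ofReal (10 ^ 10 * ((n : ℝ) + m + 1 / ε) ^ 13) := by
  have hp1 : 1 ≤ min p (m + 1) := le_min hp (by omega)
  obtain ⟨hs1, hs2⟩ := sqrt_mul_succ_bounds _ hp1
  have hanti := singleRatio_anti (min_le_left p (m + 1))
  have hN' := hN.min_succ
  have hpm : min p (m + 1) ≤ m + 1 := min_le_right _ _
  generalize min p (m + 1) = p' at *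
  have hpr : (1 : ℝ) ≤ p' := by exact_mod_cast hp1
  set S := √((p' : ℝ) * ((p' : ℝ) + 1)) with hS
  have hSsq : S ^ 2 = p' * (p' + 1) := Real.sq_sqrt (by positivity)
  set q : ℝ := S - p' with hq
  have hq0 : 0 < q := by linarith
  obtain ⟨A, R, s, hR, hs, hW, hA⟩ := exists_alg (ℓ := 1) (q := q) (κ := p') (θ := ε / 3) N hn
    le_rfl hp1 hpm hN' hq0 (by linarith) hpr (by nlinarith)
    (by rw [div_le_iff₀ hq0]; nlinarith) (by positivity) (by linarith)
    (by
      rw [Nat.cast_one, pow_one]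
      linarith)
  refine ⟨A.bind fun I => .output (I 0), fun f M hf0 hfe hf hE => ?_⟩
  obtain ⟨h1, h2⟩ := hA f M hf0 hfe hf hE
  have hW' := hW.bind (k := fun I => (AdaptiveAlg.output (I 0) :
    AdaptiveAlg (MatchoidQuery n m) (Finset (Fin n)))) (s := fun _ => True) (R' := 0) (K' := 0)
    fun _ _ => trivial
  have hens : (A.bind fun I => .output (I 0)).Ensures (matchoidOracle M f)
      (fun I => MatchoidIndep M I) :=
    AdaptiveAlg.Ensures.bind (k := fun I => AdaptiveAlg.output (I 0)) h1 fun I hI => by exact hI 0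
  refine ⟨hens.support, ?_, ?_, ?_⟩
  · rw [AdaptiveAlg.expectedValue_run, AdaptiveAlg.ev_bind]
    simp only [AdaptiveAlg.ev]
    rw [show subsampledUnionValue f = fun I : Fin 1 → Finset (Fin n) => f (I 0) from
      funext fun I => subsampledUnionValue_one f I] at h2
    refine le_trans ?_ h2
    have hopt : 0 ≤ matchoidOpt M f :=
      (hf0 ∅).trans ((matchoidOpt_isGreatest M f).2 ⟨∅, fun i => by simp, rfl⟩)
    refine mul_le_mul_of_nonneg_right ?_ hopt
    have hratio : ((1 : ℕ) : ℝ) / (p' / q * ((1 : ℕ) : ℝ) + 1) *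
        (1 - q * (1 / ((1 : ℕ) : ℝ))) ^ 1 = singleRatio p' := by
      rw [singleRatio, ← hS, Nat.cast_one, pow_one, mul_one, div_one, mul_one,
        div_mul_eq_mul_div, one_mul, div_eq_iff (by positivity)]
      have : S = q + p' := by rw [hq]; ring
      rw [this] at hSsq ⊢
      field_simp
      nlinarith
    rw [mul_assoc, hratio]
    have hnn : 0 ≤ singleRatio p := by rw [singleRatio_eq]; positivity
    have hcube := one_sub_le_pow_three hε.le hε1.le
    calc (1 - ε) * singleRatio p ≤ (1 - ε / 3) ^ 3 * singleRatio p := by gcongr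
      _ ≤ _ := by
        have : 0 ≤ (1 - ε / 3) ^ 3 := by linarith
        gcongr
  · refine (hW'.expectedRounds_le _).trans ?_
    rw [← ENNReal.ofReal_natCast]
    refine ENNReal.ofReal_le_ofReal ?_
    rw [add_zero]
    refine hR.trans ?_
    rw [Nat.cast_one, show (134 : ℝ) * 1 * Real.log n ^ 2 / (ε / 3) ^ 2 =
      1206 * Real.log n ^ 2 / ε ^ 2 by field_simp; ring]
    gcongr
    norm_num
  · refine (hW'.expectedQueries_le _).trans ?_
    rw [← ENNReal.ofReal_natCast]
    refine ENNReal.ofReal_le_ofReal ?_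
    rw [add_zero]
    refine queries_le hn hε hε1 (by linarith) ?_ hs
    rw [Nat.cast_one, le_div_iff₀ hε]
    linarith

theorem exists_multi {n m p : ℕ} {ε : ℝ} (N : Fin m → Finset (Fin n)) (hn : 2 ≤ n)
    (hp : 1 ≤ p) (hε : 0 < ε) (hε1 : ε < 1) (hN : InAtMost p N) :
    ∃ ℓ : ℕ, 1 ≤ ℓ ∧ (ℓ : ℝ) ≤ 10 ^ 10 / ε ∧
      ∃ A : AdaptiveAlg (MatchoidQuery n m) (Fin ℓ → Finset (Fin n)),
        ∀ (f : Finset (Fin n) → ℝ) (M : Fin m → Matroid (Fin n)),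
          (∀ S, 0 ≤ f S) → f ∅ = 0 → IsSubmodular f →
          (∀ i, (M i).E = (N i : Set (Fin n))) →
          (∀ x ∈ (A.run (matchoidOracle M f)).support, ∀ k, MatchoidIndep M (x.result k)) ∧
          (1 - ε) / (p : ℝ) * Real.exp (-1 / (p : ℝ)) * matchoidOpt M f ≤
            expectedValue (A.run (matchoidOracle M f)) (subsampledUnionValue f) ∧
          expectedRounds (A.run (matchoidOracle M f)) ≤
            ENNReal.ofReal (10 ^ 10 * Real.log n ^ 2 / ε ^ 3) ∧
          expectedQueries (A.run (matchoidOracle M f)) ≤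
            ENNReal.ofReal (10 ^ 10 * ((n : ℝ) + m + 1 / ε) ^ 13) := by
  have hp1 : 1 ≤ min p (m + 1) := le_min hp (by omega)
  have hanti := multiRatio_anti hp1 (min_le_left p (m + 1))
  have hN' := hN.min_succ
  have hpm : min p (m + 1) ≤ m + 1 := min_le_right _ _
  generalize min p (m + 1) = p' at *
  have hpr : (1 : ℝ) ≤ p' := by exact_mod_cast hp1
  obtain ⟨ℓ, hℓ⟩ : ∃ ℓ : ℕ, ℓ = ⌈6 / ε⌉₊ + 1 := ⟨_, rfl⟩
  have hτ : 1 / (ε / 6) + 1 ≤ (ℓ : ℝ) := by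
    rw [hℓ, one_div_div]
    push_cast
    linarith [Nat.le_ceil (6 / ε)]
  have hℓ8 : (ℓ : ℝ) ≤ 8 / ε := by
    have h1 := (Nat.ceil_lt_add_one (show 0 ≤ 6 / ε by positivity)).le
    have h2 : 1 ≤ 1 / ε := by rw [le_div_iff₀ hε]; linarith
    rw [hℓ]
    push_cast
    calc _ ≤ 6 / ε + 1 + 1 := by linarith
      _ ≤ 6 / ε + 1 / ε + 1 / ε := by linarith
      _ = 8 / ε := by ring
  have hℓ1 : 1 ≤ ℓ := by omega
  have hℓpos : (0 : ℝ) < ℓ := by exact_mod_cast hℓ1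
  have hpow := one_sub_pow_ge hp1 (show 0 < ε / 6 by positivity) hτ
  have hκq : (1 : ℝ) / (1 / p') = p' := by rw [one_div_one_div]
  obtain ⟨A, R, s, hR, hs, hW, hA⟩ := exists_alg (ℓ := ℓ) (q := 1 / p') (κ := 1) (θ := ε / 6) N hn
    hℓ1 hp1 hpm hN' (by positivity) (by rw [div_le_one (by linarith)]; exact hpr) le_rfl
    (by rw [one_div_mul_cancel (by positivity)])
    (by rw [hκq]; linarith) (by positivity) (by linarith)
    (by
      refine le_trans ?_ hpow
      have h1 : Real.exp (-1) ≤ Real.exp (-1 / (p' : ℝ)) := by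
        gcongr
        rw [neg_div, neg_le_neg_iff, div_le_one (by linarith)]
        exact hpr
      have h2 : (1 / 3 : ℝ) ≤ Real.exp (-1) := by
        rw [Real.exp_neg, one_div]
        exact inv_anti₀ (Real.exp_pos _) (by linarith [Real.exp_one_lt_d9])
      nlinarith)
  refine ⟨ℓ, hℓ1, hℓ8.trans (by gcongr; norm_num), A, fun f M hf0 hfe hf hE => ?_⟩
  obtain ⟨h1, h2⟩ := hA f M hf0 hfe hf hE
  refine ⟨h1.support, ?_, ?_, ?_⟩
  · rw [AdaptiveAlg.expectedValue_run]
    refine le_trans ?_ h2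
    have hopt : 0 ≤ matchoidOpt M f :=
      (hf0 ∅).trans ((matchoidOpt_isGreatest M f).2 ⟨∅, fun i => by simp, rfl⟩)
    refine mul_le_mul_of_nonneg_right ?_ hopt
    rw [hκq]
    set t : ℝ := 1 - ε / 6 with ht
    have ht0 : 0 ≤ t := by linarith
    have h3 : 1 / (p' : ℝ) * t ≤ ℓ / (p' * ℓ + 1) := by
      rw [one_div_mul_eq_div, div_le_div_iff₀ (by positivity) (by positivity)]
      have h4 : t ≤ ε / 6 * ℓ * p' := by
        have h5 : 1 / (ε / 6) ≤ (ℓ : ℝ) := by linarith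
        rw [div_le_iff₀ (by positivity)] at h5
        nlinarith
      rw [ht] at h4 ⊢
      nlinarith
    have h5 : 1 - ε ≤ t ^ 5 := by
      have hb := one_add_mul_le_pow (show (-2 : ℝ) ≤ -(ε / 6) by linarith) 5
      have : t = 1 + -(ε / 6) := by rw [ht]; ring
      rw [this]
      push_cast at hb
      linarith
    calc (1 - ε) / (p : ℝ) * Real.exp (-1 / (p : ℝ))
        = (1 - ε) * (1 / (p : ℝ) * Real.exp (-1 / (p : ℝ))) := by ring
      _ ≤ (1 - ε) * (1 / (p' : ℝ) * Real.exp (-1 / (p' : ℝ))) := by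
          have : 0 ≤ 1 - ε := by linarith
          gcongr
      _ ≤ t ^ 5 * (1 / (p' : ℝ) * Real.exp (-1 / (p' : ℝ))) := by gcongr
      _ = t ^ 3 * (1 / (p' : ℝ) * t) * (Real.exp (-1 / (p' : ℝ)) * t) := by ring
      _ ≤ t ^ 3 * (ℓ / (p' * ℓ + 1)) *
          (1 - 1 / (p' : ℝ) * (1 / (ℓ : ℝ))) ^ ℓ := by gcongr
  · refine (hW.expectedRounds_le _).trans ?_
    rw [← ENNReal.ofReal_natCast]
    refine ENNReal.ofReal_le_ofReal (hR.trans ?_)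
    calc 134 * ℓ * Real.log n ^ 2 / (ε / 6) ^ 2
        ≤ 134 * (8 / ε) * Real.log n ^ 2 / (ε / 6) ^ 2 := by gcongr
      _ = 38592 * Real.log n ^ 2 / ε ^ 3 := by field_simp; ring
      _ ≤ 10 ^ 10 * Real.log n ^ 2 / ε ^ 3 := by gcongr; norm_num
  · refine (hW.expectedQueries_le _).trans ?_
    rw [← ENNReal.ofReal_natCast]
    exact ENNReal.ofReal_le_ofReal (queries_le hn hε hε1 le_rfl hℓ8 hs)

end

theorem mainTheorem4 :
    ∃ (C : ℝ) (d : ℕ) (η : ℕ → ℝ), 0 < C ∧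
      Tendsto η atTop (𝓝 0) ∧
      (∀ p : ℕ, 1 ≤ p →
        (1 + η p) / (4 * ((p : ℝ) + 1)) = 2 * (p : ℝ) + 1 - 2 * √((p : ℝ) * ((p : ℝ) + 1))) ∧
      ∀ (n m p : ℕ) (ε : ℝ) (N : Fin m → Finset (Fin n)),
        2 ≤ n → 1 ≤ p → 0 < ε → ε < 1 → InAtMost p N →
        -- a single independent set
        (∃ A : AdaptiveAlg (MatchoidQuery n m) (Finset (Fin n)),
          ∀ (f : Finset (Fin n) → ℝ) (M : Fin m → Matroid (Fin n)),
            (∀ S, 0 ≤ f S) → f ∅ = 0 → IsSubmodular f →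
            (∀ i, (M i).E = (N i : Set (Fin n))) →
            (∀ x ∈ (A.run (matchoidOracle M f)).support, MatchoidIndep M x.result) ∧
            (1 - ε) * ((1 + η p) / (4 * ((p : ℝ) + 1))) * matchoidOpt M f ≤
              expectedValue (A.run (matchoidOracle M f)) f ∧
            expectedRounds (A.run (matchoidOracle M f)) ≤
              ENNReal.ofReal (C * Real.log n ^ 2 / ε ^ 2) ∧
            expectedQueries (A.run (matchoidOracle M f)) ≤
              ENNReal.ofReal (C * ((n : ℝ) + m + 1 / ε) ^ d)) ∧
        -- `ℓ = O(1 / ε)` independent sets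
        (∃ ℓ : ℕ, 1 ≤ ℓ ∧ (ℓ : ℝ) ≤ C / ε ∧
          ∃ A : AdaptiveAlg (MatchoidQuery n m) (Fin ℓ → Finset (Fin n)),
            ∀ (f : Finset (Fin n) → ℝ) (M : Fin m → Matroid (Fin n)),
              (∀ S, 0 ≤ f S) → f ∅ = 0 → IsSubmodular f →
              (∀ i, (M i).E = (N i : Set (Fin n))) →
              (∀ x ∈ (A.run (matchoidOracle M f)).support, ∀ k, MatchoidIndep M (x.result k)) ∧
              (1 - ε) / (p : ℝ) * Real.exp (-1 / (p : ℝ)) * matchoidOpt M f ≤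
                expectedValue (A.run (matchoidOracle M f)) (subsampledUnionValue f) ∧
              expectedRounds (A.run (matchoidOracle M f)) ≤
                ENNReal.ofReal (C * Real.log n ^ 2 / ε ^ 3) ∧
              expectedQueries (A.run (matchoidOracle M f)) ≤
                ENNReal.ofReal (C * ((n : ℝ) + m + 1 / ε) ^ d)) := by
  refine ⟨10 ^ 10, 13, fun p => singleRatio p * (4 * ((p : ℝ) + 1)) - 1, by norm_num,
    tendsto_singleRatio, fun p _ => ?_, fun n m p ε N hn hp hε hε1 hN => ⟨?_, ?_⟩⟩
  · rw [add_sub_cancel, mul_div_cancel_right₀ _ (by positivity), singleRatio]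
  · rw [add_sub_cancel, mul_div_cancel_right₀ _ (by positivity)]
    exact exists_single N hn hp hε hε1 hN
  · exact exists_multi N hn hp hε hε1 hN
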